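/- Let $q=p^d>4$ be a prime power ($p$ prime). Let $\mathcal{P}$ be a chiral $4$-polytope, that is, an abstract polytope of rank $4$ whose automorphism group $\Gamma(\mathcal{P})$ has exactly two orbits on flags, with adjacent flags always in different orbits. Fix a base flag $\Phi$ and, for $i=1,2,3$, let $\sigma_i\in\Gamma(\mathcal{P})$ be the distinguished generator that maps $\Phi$ to $\Phi^{i,i-1}$, the $(i-1)$-adjacent flag of the $i$-adjacent flag of $\Phi$. Suppose that $\Gamma(\mathcal{P})\cong\mathrm{PGL}(2,q)$. We say that $\mathcal{P}$ has non fixed point free parabolic subgroups if, under some such isomorphism, each of the subgroups $\langle\sigma_1,\sigma_2\rangle$ and $\langle\sigma_2,\sigma_3\rangle$ fixes at least one point of the projective line $\mathrm{PG}(1,q)$. Say that $\mathcal{P}$ has type $[p_1,p_2,p_3]$ if for $i=1,2,3$ every section $G/F$ between incident faces $F$ of rank $i-2$ and $G$ of rank $i+1$ is a $p_i$-gon. Call an integer $k>2$ admissible if $k\mid q-1$, $k\nmid (q-1)/2$, and $k\nmid p^e+1$ and $k\nmid p^e-1$ for all integers $e$ with $1\le e<d$. (If $q$ is even, the condition $k\nmid(q-1)/2$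 is void.) Chiral $4$-polytopes are counted up to isomorphism with the two enantiomorphic forms of a chiral polytope counted separately; that is, we count pairs $(\mathcal{P},\Phi)$ of a polytope and a base flag, up to isomorphisms of polytopes that map base flag to base flag. 1. If $q\not\equiv 3\pmod 4$, then every chiral $4$-polytope with automorphism group $\mathrm{PGL}(2,q)$ and non fixed point free parabolic subgroups has type $[k,k,k]$ for some admissible $k$, and for every admissible $k$ there are exactly $\varphi(k)/d$ such polytopes of type $[k,k,k]$, where $\varphi$ is Euler's function. 2. If $q\equiv 3\pmod 4$, then every chiral $4$-polytope with automorphism group $\mathrm{PGL}(2,q)$ and non fixed point free parabolic subgroups has type $[k/2,k,k/2]$ for some admissible $k$, and for every admissible $k$ there are exactly $\varphi(k)/d$ such polytopes of type $[k/2,k,k/2]$. -/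

import Mathlib

open scoped MatrixGroups LinearAlgebra.Projectivization

universe u v

/-- Two flags (maximal chains) are `i`-adjacent if they are distinct and
have the same faces in every rank other than `i`. -/
def FlagAdj {α : Type u} [PartialOrder α] (rank : α → ℤ) (i : ℤ) (Φ Ψ : Flag α) : Prop :=
  Φ ≠ Ψ ∧ ∀ F : α, rank F ≠ i → (F ∈ Φ ↔ F ∈ Ψ)

/-- An abstract polytope of rank `n` (an abstract `n`-polytope). -/
structure AbstractPolytope (n : ℕ) : Type (u + 1) where
  Face : Type u
  [order : PartialOrder Face]
  rank : Face → ℤ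
  rank_strictMono : StrictMono rank
  rank_mem : ∀ F, -1 ≤ rank F ∧ rank F ≤ n
  /-- There is a least face. -/
  exists_least : ∃ F : Face, ∀ G, F ≤ G
  /-- There is a greatest face. -/
  exists_greatest : ∃ F : Face, ∀ G, G ≤ F
  /-- Every maximal chain has exactly one face of each rank `-1, 0, …, n`. -/
  flag_full : ∀ Φ : Flag Face, ∀ i : ℤ, -1 ≤ i → i ≤ n → ∃! F, F ∈ Φ ∧ rank F = i
  /-- Strong flag connectedness: any two flags `Φ`, `Ψ` are joined by a sequence of
  successively adjacent flags, all of which contain `Φ ∩ Ψ`. -/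
  strongly_connected : ∀ Φ Ψ : Flag Face,
    Relation.ReflTransGen
      (fun A B : Flag Face => (∃ i, FlagAdj rank i A B) ∧ ∀ F, F ∈ Φ → F ∈ Ψ → F ∈ B) Φ Ψ
  /-- The diamond condition. -/
  diamond : ∀ J K : Face, J < K → rank J = rank K - 2 →
    {I : Face | J < I ∧ I < K ∧ rank I = rank K - 1}.ncard = 2

attribute [instance] AbstractPolytope.order

namespace AbstractPolytope

variable {n : ℕ}

/-- The automorphism group of a polytope. (Order automorphisms preserve the rank, since all
maximal chains have one face of each rank.) It acts on the flags by Mathlib's action of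
`α ≃o α` on `Flag α`. -/
abbrev Aut (P : AbstractPolytope.{u} n) : Type u := P.Face ≃o P.Face

/-- A polytope is chiral if its automorphism group has exactly two orbits on the flags and
adjacent flags always lie in different orbits. -/
def IsChiral (P : AbstractPolytope.{u} n) : Prop :=
  Nat.card (MulAction.orbitRel.Quotient P.Aut (Flag P.Face)) = 2 ∧
  ∀ (i : ℤ) (Φ Ψ : Flag P.Face), FlagAdj P.rank i Φ Ψ → Ψ ∉ MulAction.orbit P.Aut Φ

/-- `P` has (Schläfli) type `[p₁, …, p_{n-1}]`, where `p i` stands for `p_{i+1}`: whenever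
`F ≤ G` are faces of ranks `i - 1` and `i + 2`, the section `G / F` is a `p i`-gon,
i.e. has exactly `p i` vertices (faces of rank `i` of `P`). -/
def HasType (P : AbstractPolytope.{u} n) (p : Fin (n - 1) → ℕ) : Prop :=
  ∀ (i : Fin (n - 1)) (F G : P.Face), F ≤ G →
    P.rank F = (i : ℤ) - 1 → P.rank G = (i : ℤ) + 2 →
    0 < p i ∧ Nat.card {x : P.Face // F < x ∧ x < G ∧ P.rank x = (i : ℤ)} = p i

/-- `σ` is the distinguished generator `σ_i` of `P` with respect to the base flag `Φ`:
it maps `Φ` to `Φ^{i,i-1}`, the flag that is `(i-1)`-adjacent to the `i`-adjacent flag of `Φ`.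
(If `P` is regular, this is the product of the reflections `ρ_{i-1}` and `ρ_i`; if `P` is chiral,
there is exactly one such `σ` for each `1 ≤ i ≤ n - 1`.) -/
def IsDistinguished (P : AbstractPolytope.{u} n) (Φ : Flag P.Face) (i : ℤ) (σ : P.Aut) : Prop :=
  ∃ Ψ : Flag P.Face, FlagAdj P.rank i Φ Ψ ∧ FlagAdj P.rank (i - 1) Ψ (σ • Φ)

/-- The subgroup `⟨σ_i, σ_j⟩` generated by two distinguished generators. -/
def parabolic (P : AbstractPolytope.{u} n) (Φ : Flag P.Face) (i j : ℤ) : Subgroup P.Aut :=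
  Subgroup.closure {σ | P.IsDistinguished Φ i σ ∨ P.IsDistinguished Φ j σ}

end AbstractPolytope

/-- A polytope with a chosen base flag. -/
structure BasedPolytope (n : ℕ) : Type (u + 1) extends AbstractPolytope.{u} n where
  baseFlag : Flag Face

namespace BasedPolytope

/-- Isomorphism of based polytopes. Based polytopes `(P, Φ)` and `(P, Ψ)` are isomorphic exactly
if `Φ` and `Ψ` lie in the same orbit of the automorphism group of `P`. So a regular
polytope underlies one isomorphism class, and a chiral polytope underlies exactly two,
its two enantiomorphic forms. -/
instance isoSetoid (n : ℕ) : Setoid (BasedPolytope.{u} n) where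
  r X Y := ∃ e : X.Face ≃o Y.Face, Flag.map e X.baseFlag = Y.baseFlag
  iseqv :=
    { refl := fun X => ⟨OrderIso.refl _, by ext; simp⟩
      symm := by
        rintro X Y ⟨e, he⟩
        exact ⟨e.symm, by rw [← he]; ext; simp⟩
      trans := by
        rintro X Y Z ⟨e, he⟩ ⟨f, hf⟩
        exact ⟨e.trans f, by rw [← hf, ← he]; ext; simp⟩ }

/-- `X` is a chiral `4`-polytope (with a base flag) with automorphism group `PGL(2, F)` and
with non fixed point free parabolic subgroups: after an identification of the automorphism group
with `PGL(2, F)`, each of `⟨σ₁, σ₂⟩` and `⟨σ₂, σ₃⟩` fixes a point of the projective line. -/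
def IsChiralPGLWithFixedPoints (F : Type v) [Field F] (X : BasedPolytope.{u} 4) : Prop :=
  X.IsChiral ∧
  ∃ f : X.Aut ≃* PGL(Fin 2, F),
    (∃ x : ℙ F (Fin 2 → F), ∀ g ∈ X.parabolic X.baseFlag 1 2, f g • x = x) ∧
    (∃ y : ℙ F (Fin 2 → F), ∀ g ∈ X.parabolic X.baseFlag 2 3, f g • y = y)

/-- The number of isomorphism classes of based `4`-polytopes with property `Q`, i.e. for chiral
polytopes the number of isomorphism classes where enantiomorphic forms are counted separately. -/
noncomputable def countForms (Q : BasedPolytope.{u} 4 → Prop) : ℕ :=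
  Set.ncard {c : Quotient (isoSetoid.{u} 4) | ∃ X, Q X ∧ (Quotient.mk _ X) = c}

end BasedPolytope

/-- The integers `k` that occur for `q = p ^ d`. -/
def AdmissiblePGL (p d k : ℕ) : Prop :=
  2 < k ∧ k ∣ p ^ d - 1 ∧ ¬ k ∣ (p ^ d - 1) / 2 ∧
  ∀ e : ℕ, 1 ≤ e → e < d → ¬ k ∣ p ^ e + 1 ∧ ¬ k ∣ p ^ e - 1

/-!
Let `X` be a based polytope of rank `n` whose automorphism group `G` has two flag orbits as in the
definition of chirality. Then the flags correspond to `G × Bool`, with base flag `(1, false)`, and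
the `i`-adjacency is `(g, false) ↔ (g * a i, true)` (`groupAdj`), where `a 0 = 1` and
`a i = σ_i ⋯ σ_1`. This is `exists_groupModel`. Everything in the theorem can be read off from `a`:

* A polytope is determined by its flags and their adjacency maps, and such maps come from a polytope
  if and only if they satisfy `IsPolytopal`; the faces are recovered as the classes of flags that
  are connected without `i`-adjacencies (`IsPolytopal.exists_flagModel`, `FlagModel.isPolytopal`,
  `FlagModel.equiv`).
* The polytope of `a` is chiral with automorphism group `G` if no endomorphism of `G` inverts all
  `a i`, and it is not chiral if an automorphism does so (`FlagModel.exists_groupModel`,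
  `FlagModel.not_isChiral`). The entries of the type are the orders of the
  `σ_i = a i * (a (i - 1))⁻¹` (`FlagModel.hasType`).
* For `n = 4` the intersection property reduces to three conditions on subgroups generated by the
  `σ_i` (`isPolytopal_groupAdj_four`).

For `G = PGL(2, F)`, a point fixed by `⟨σ₁, σ₂⟩` and one fixed by `⟨σ₂, σ₃⟩` are distinct, and can
be moved to `∞` and `0`. The relations `(σ₂ σ₁)² = (σ₃ σ₂)² = (σ₃ σ₂ σ₁)² = 1` then leave, up to a
conjugation with a diagonal element, exactly one family of generators, `stdGen ω`, where `σ₂` is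
`x ↦ ω x` (`exists_conj_eq_stdGen`). The orders of `σ₁, σ₂, σ₃` are those of `-ω⁻¹, ω, -ω⁻¹`.

It remains to see that `ω` gives a chiral polytope if and only if its order is admissible. If `ω`
lies in a proper subfield, then so do the entries of the generators, and they do not generate
`PGL(2, F)`. If `ω` is conjugate to `ω⁻¹` under the Galois group, then the automorphism induced by
the Galois group, composed with a conjugation, inverts all `a i`. If `q` is odd and `ω` is a
square, then `-1` is a square as well, because `x ↦ -x` lies in `⟨σ₁, σ₂⟩ ∩ ⟨σ₂, σ₃⟩ = ⟨σ₂⟩`, so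
that all generators have square determinants and do not generate `PGL(2, F)`
(`HasParameter.admissible`). Conversely, for admissible orders `⟨σ₁, σ₂⟩` and `⟨σ₂, σ₃⟩` contain
all upper and all lower unipotent matrices, the generators generate `PGL(2, F)`
(`closure_stdGen_eq_top`), and the intersection property holds because the elements in question
fix three points, or are diagonal (`isPolytopal_stdGen`). A homomorphism that maps `stdGen ω` to
`stdGen ω'` respects the translations and the scalings `x ↦ ω x`, so that it matches the
polynomial relations of `ω` and `ω'`, and these are conjugate (`aeval_eq_zero_of_hom_stdGen`,
`exists_eq_pow_of_aeval`). The same argument with `ω' = ω⁻¹` gives the chirality. So the polytopes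
with `σ₂` of order `k` correspond to the orbits of the Galois group on the `φ(k)` elements of
order `k`, and all orbits have length `d` (`countForms_mul_eq_totient`).
-/

/-! ### Polytopes from systems of flag involutions -/

/-- `FlagConn r J α β` means that `β` is reached from `α` by applying maps `r j` with `j ∈ J`. -/
def FlagConn {Ω : Type*} {n : ℕ} (r : Fin n → Ω → Ω) (J : Set (Fin n)) : Ω → Ω → Prop :=
  Relation.ReflTransGen (fun α β => ∃ j ∈ J, β = r j α)

/-- Maps `r 0, …, r (n - 1)` on a set `Ω` that behave like the adjacency maps on the flags of an
`n`-polytope. The condition `inter` says that elements joined by a path avoiding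
`r i`, for each `i ∈ K` separately, are joined by a path avoiding all of them at once. With `K = ∅`
it says that `Ω` is connected. -/
structure IsPolytopal {Ω : Type*} {n : ℕ} (r : Fin n → Ω → Ω) : Prop where
  invol : ∀ i α, r i (r i α) = α
  ne : ∀ i α, r i α ≠ α
  comm : ∀ i j : Fin n, (i : ℕ) + 2 ≤ j → ∀ α, r i (r j α) = r j (r i α)
  inter : ∀ (K : Set (Fin n)) (α β : Ω), (∀ i ∈ K, FlagConn r {i}ᶜ α β) → FlagConn r Kᶜ α β

namespace FlagConn

variable {Ω : Type*} {n : ℕ} {r : Fin n → Ω → Ω} {I J : Set (Fin n)} {α β γ : Ω}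

theorem refl (α : Ω) : FlagConn r J α α := Relation.ReflTransGen.refl

theorem trans (h : FlagConn r J α β) (h' : FlagConn r J β γ) : FlagConn r J α γ :=
  Relation.ReflTransGen.trans h h'

theorem step {j : Fin n} (hj : j ∈ J) (α : Ω) : FlagConn r J α (r j α) :=
  Relation.ReflTransGen.single ⟨j, hj, rfl⟩

theorem mono (hIJ : I ⊆ J) (h : FlagConn r I α β) : FlagConn r J α β := by
  induction h with
  | refl => exact refl _
  | tail _ h ih =>
    obtain ⟨j, hj, rfl⟩ := h
    exact trans ih (step (hIJ hj) _)

theorem eq_of_empty (h : FlagConn r ∅ α β) : β = α := by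
  induction h with
  | refl => rfl
  | tail _ h _ => obtain ⟨j, hj, _⟩ := h; exact hj.elim

variable (hinv : ∀ i α, r i (r i α) = α)
include hinv

theorem symm (h : FlagConn r J α β) : FlagConn r J β α := by
  induction h with
  | refl => exact refl _
  | tail _ h ih =>
    obtain ⟨j, hj, rfl⟩ := h
    refine trans ?_ ih
    simpa only [hinv] using step (r := r) hj (r j _)

theorem eq_or_eq {i : Fin n} (h : FlagConn r {i} α β) : β = α ∨ β = r i α := by
  induction h with
  | refl => exact Or.inl rfl
  | tail _ h ih =>
    obtain ⟨j, hj, rfl⟩ := h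
    obtain rfl : j = i := hj
    rcases ih with rfl | rfl
    · exact Or.inr rfl
    · exact Or.inl (hinv _ _)

omit hinv

theorem apply_of_commute {f : Ω → Ω} (hf : ∀ j ∈ J, ∀ α, f (r j α) = r j (f α))
    (h : FlagConn r J α β) : FlagConn r J (f α) (f β) := by
  induction h with
  | refl => exact refl _
  | tail _ h ih =>
    obtain ⟨j, hj, rfl⟩ := h
    rw [hf j hj]
    exact trans ih (step hj _)

/-- If the maps of `I` commute with those of `J`, a path can be rearranged so that the steps
in `I` come first. -/
theorem split (hc : ∀ i ∈ I, ∀ j ∈ J, ∀ α, r i (r j α) = r j (r i α))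
    (h : FlagConn r (I ∪ J) α γ) : ∃ β, FlagConn r I α β ∧ FlagConn r J β γ := by
  induction h with
  | refl => exact ⟨α, refl _, refl _⟩
  | tail _ h ih =>
    obtain ⟨j, hj, rfl⟩ := h
    obtain ⟨β, h1, h2⟩ := ih
    rcases hj with hj | hj
    · refine ⟨r j β, h1.trans (step hj _), ?_⟩
      exact h2.apply_of_commute (hc j hj)
    · exact ⟨β, h1, h2.trans (step hj _)⟩

end FlagConn

namespace FlagSystem

variable {Ω : Type u} {n : ℕ} (r : Fin n → Ω → Ω)

/-- The `FlagConn`-class of `α` for the maps other than `r i`: the face of rank `i` of `α`. -/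
def cls (i : ℤ) (α : Ω) : Set Ω := {β | FlagConn r {j | ((j : ℕ) : ℤ) ≠ i} α β}

/-- The faces of the polytope with flags `Ω`, as pairs of a rank and the set of the flags
on the face. -/
def Face : Type u := {x : ℤ × Set Ω // -1 ≤ x.1 ∧ x.1 ≤ n ∧ ∃ α, x.2 = cls r x.1 α}

variable {r}

theorem mem_cls_self (i : ℤ) (α : Ω) : α ∈ cls r i α := FlagConn.refl α

theorem Face.exists_mem (x : Face r) : ∃ α, α ∈ x.1.2 := by
  obtain ⟨α, hα⟩ := x.2.2.2
  exact ⟨α, hα ▸ mem_cls_self _ _⟩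

variable (hr : IsPolytopal r)
include hr

theorem cls_eq_of_mem {i : ℤ} {α β : Ω} (h : β ∈ cls r i α) : cls r i α = cls r i β := by
  ext γ
  exact ⟨fun h' => (FlagConn.symm hr.invol h).trans h', fun h' => FlagConn.trans h h'⟩

theorem Face.eq_cls {x : Face r} {α : Ω} (h : α ∈ x.1.2) : x.1.2 = cls r x.1.1 α := by
  obtain ⟨β, hβ⟩ := x.2.2.2
  rw [hβ] at h ⊢
  exact cls_eq_of_mem hr h

theorem Face.conn {x : Face r} {α β : Ω} (h : α ∈ x.1.2) (h' : β ∈ x.1.2) :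
    FlagConn r {j | ((j : ℕ) : ℤ) ≠ x.1.1} α β := by
  rw [Face.eq_cls hr h] at h'
  exact h'

theorem Face.mem_of_conn {x : Face r} {α β : Ω} {J : Set (Fin n)} (h : α ∈ x.1.2)
    (hc : FlagConn r J α β) (hJ : ∀ j ∈ J, ((j : ℕ) : ℤ) ≠ x.1.1) : β ∈ x.1.2 := by
  rw [Face.eq_cls hr h]
  exact hc.mono hJ

theorem Face.eq_of_mem {x y : Face r} {α : Ω} (hx : α ∈ x.1.2) (hy : α ∈ y.1.2)
    (h : x.1.1 = y.1.1) : x = y := by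
  apply Subtype.ext
  apply Prod.ext h
  rw [Face.eq_cls hr hx, Face.eq_cls hr hy, h]

theorem comm_of_lt {i j : Fin n} (h : (i : ℕ) + 2 ≤ j ∨ (j : ℕ) + 2 ≤ i) (α : Ω) :
    r i (r j α) = r j (r i α) := by
  rcases h with h | h
  · exact hr.comm _ _ h _
  · exact (hr.comm _ _ h _).symm

/-- A path avoiding `r j` can be split into a part with steps above `j` and a part with
steps below `j`. -/
theorem split_at {m : ℤ} {α β : Ω} (h : FlagConn r {j | ((j : ℕ) : ℤ) ≠ m} α β) :
    ∃ γ, FlagConn r {j | m < ((j : ℕ) : ℤ)} α γ ∧ FlagConn r {j | ((j : ℕ) : ℤ) < m} γ β := by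
  apply FlagConn.split
  · intro i hi j hj α
    simp only [Set.mem_ofPred_eq] at hi hj
    exact comm_of_lt hr (by omega) α
  · refine h.mono fun j hj => ?_
    simp only [Set.mem_ofPred_eq, Set.mem_union] at hj ⊢
    omega

/-- Faces are incident if they have a flag in common. -/
@[reducible] def faceOrder : PartialOrder (Face r) where
  le x y := x.1.1 ≤ y.1.1 ∧ (x.1.2 ∩ y.1.2).Nonempty
  le_refl x := by
    obtain ⟨β, hβ⟩ := x.exists_mem
    exact ⟨le_rfl, β, hβ, hβ⟩
  le_trans x y z := by
    rintro ⟨h1, α, hx, hy⟩ ⟨h2, β, hy', hz⟩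
    refine ⟨h1.trans h2, ?_⟩
    rcases h1.eq_or_lt with h1 | h1
    · rw [Face.eq_of_mem hr hx hy h1]
      exact ⟨β, hy', hz⟩
    rcases h2.eq_or_lt with h2 | h2
    · rw [← Face.eq_of_mem hr hy' hz h2]
      exact ⟨α, hx, hy⟩
    obtain ⟨γ, h3, h4⟩ := split_at hr (Face.conn hr hy hy')
    refine ⟨γ, Face.mem_of_conn hr hx h3 ?_,
      Face.mem_of_conn hr hz (FlagConn.symm hr.invol h4) ?_⟩
    · intro j hj
      simp only [Set.mem_ofPred_eq] at hj
      omega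
    · intro j hj
      simp only [Set.mem_ofPred_eq] at hj
      omega
  le_antisymm x y := by
    rintro ⟨h1, α, hx, hy⟩ ⟨h2, -⟩
    exact Face.eq_of_mem hr hx hy (le_antisymm h1 h2)

/-- All faces of a chain have a flag in common. -/
theorem exists_common {C : Set (Face r)} (hne : Nonempty Ω)
    (hC : @IsChain _ (faceOrder hr).le C) : ∃ α, ∀ x ∈ C, α ∈ x.1.2 := by
  suffices H : ∀ m : ℕ, ∃ α : Ω, ∀ x ∈ C, x.1.1 + 1 < m → α ∈ x.1.2 by
    obtain ⟨α, h⟩ := H (n + 2)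
    exact ⟨α, fun x hx => h x hx (by have := x.2.2.1; push_cast; omega)⟩
  intro m
  induction m with
  | zero =>
    obtain ⟨α⟩ := hne
    exact ⟨α, fun x _ h => absurd x.2.1 (by push_cast at h; omega)⟩
  | succ m ih =>
    obtain ⟨α, hα⟩ := ih
    by_cases hx : ∃ x ∈ C, x.1.1 + 1 = (m : ℤ)
    swap
    · refine ⟨α, fun x hxC h => hα x hxC ?_⟩
      have : x.1.1 + 1 ≠ m := fun h' => hx ⟨x, hxC, h'⟩
      push_cast at h
      omega
    obtain ⟨x, hxC, hxm⟩ := hx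
    have huniq : ∀ y ∈ C, y.1.1 = x.1.1 → y = x := by
      intro y hy h
      by_contra hne
      rcases hC hy hxC hne with ⟨-, β, h1, h2⟩ | ⟨-, β, h1, h2⟩
      · exact hne (Face.eq_of_mem hr h1 h2 h)
      · exact hne (Face.eq_of_mem hr h2 h1 h)
    by_cases hlow : ∃ i : ℤ, ∃ y ∈ C, y.1.1 = i ∧ i < x.1.1
    swap
    · obtain ⟨β, hβ⟩ := x.exists_mem
      refine ⟨β, fun y hy h => ?_⟩
      have : ¬ y.1.1 < x.1.1 := fun h' => hlow ⟨_, y, hy, rfl, h'⟩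
      push_cast at h
      rw [huniq y hy (by omega)]
      exact hβ
    -- The face `y` is the highest face of the chain below `x`.
    obtain ⟨i, ⟨y, hyC, hyi, hi⟩, hmax⟩ :=
      Int.exists_greatest_of_bdd ⟨x.1.1, fun z ⟨_, _, _, h⟩ => h.le⟩ hlow
    have hyx : y ≠ x := by rintro rfl; omega
    obtain ⟨δ, hδy, hδx⟩ : (y.1.2 ∩ x.1.2).Nonempty := by
      rcases hC hyC hxC hyx with h | h
      · exact h.2
      · rw [Set.inter_comm]; exact h.2
    obtain ⟨ε, h1, h2⟩ := split_at hr (Face.conn hr (hα y hyC (by omega)) hδy)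
    refine ⟨ε, fun z hz h => ?_⟩
    push_cast at h
    rcases eq_or_ne z.1.1 x.1.1 with hzx | hzx
    · rw [huniq z hz hzx]
      refine Face.mem_of_conn hr hδx (FlagConn.symm hr.invol h2) fun j hj => ?_
      simp only [Set.mem_ofPred_eq] at hj
      omega
    · have hz' := hmax _ ⟨z, hz, rfl, by omega⟩
      refine Face.mem_of_conn hr (hα z hz (by omega)) h1 fun j hj => ?_
      simp only [Set.mem_ofPred_eq] at hj
      omega

/-- The face of rank `i` of `α`. -/
def face (i : ℤ) (h : -1 ≤ i) (h' : i ≤ n) (α : Ω) : Face r := ⟨(i, cls r i α), h, h', α, rfl⟩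

omit hr in
theorem mem_face (i : ℤ) (h : -1 ≤ i) (h' : i ≤ n) (α : Ω) : α ∈ (face i h h' α : Face r).1.2 :=
  mem_cls_self _ _

/-- The faces of `α`, as a maximal chain. -/
def flagOf (α : Ω) : @Flag (Face r) (faceOrder hr).toLE :=
  letI := faceOrder hr
  { carrier := {x | α ∈ x.1.2}
    Chain' := by
      intro x hx y hy _
      rcases le_total x.1.1 y.1.1 with h | h
      · exact Or.inl ⟨h, α, hx, hy⟩
      · exact Or.inr ⟨h, α, hy, hx⟩
    max_chain' := by
      intro s hs hsub
      refine hsub.antisymm fun x hx => ?_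
      have hy := mem_face (r := r) x.1.1 x.2.1 x.2.2.1 α
      have hys : face (r := r) x.1.1 x.2.1 x.2.2.1 α ∈ s := hsub (by exact hy)
      by_cases h : x = face x.1.1 x.2.1 x.2.2.1 α
      · rw [h]; exact hy
      · rcases hs hx hys h with ⟨-, β, h1, h2⟩ | ⟨-, β, h1, h2⟩
        · exact absurd (Face.eq_of_mem hr h1 h2 rfl) h
        · exact absurd (Face.eq_of_mem hr h2 h1 rfl) h }

theorem mem_flagOf {α : Ω} {x : Face r} :
    letI := faceOrder hr
    x ∈ flagOf hr α ↔ α ∈ x.1.2 := Iff.rfl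

theorem conn_of_mem_of_mem {α β : Ω} {i : Fin n} {x : Face r} (hx : x.1.1 = ((i : ℕ) : ℤ))
    (hα : α ∈ x.1.2) (hβ : β ∈ x.1.2) : FlagConn r {i}ᶜ α β := by
  refine (Face.conn hr hα hβ).mono fun j hj => ?_
  simp only [Set.mem_ofPred_eq, hx] at hj
  rintro rfl
  exact hj rfl

theorem flagOf_injective : Function.Injective (flagOf hr) := by
  let := faceOrder hr
  intro α β h
  have : FlagConn r (Set.univ)ᶜ α β := by
    refine hr.inter _ _ _ fun i _ => ?_
    have h1 := mem_face (r := r) (i : ℕ) (by omega) (by have := i.2; omega) α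
    have h2 : face (r := r) (i : ℕ) (by omega) (by have := i.2; omega) α ∈ flagOf hr α := h1
    rw [h] at h2
    exact conn_of_mem_of_mem hr rfl h1 h2
  rw [Set.compl_univ] at this
  exact this.eq_of_empty.symm

theorem flagOf_surjective (hne : Nonempty Ω) : Function.Surjective (flagOf hr) := by
  let := faceOrder hr
  intro Φ
  obtain ⟨α, hα⟩ := exists_common hr hne Φ.Chain'
  refine ⟨α, ?_⟩
  apply Flag.ext
  exact (Φ.max_chain' (flagOf hr α).Chain' hα).symm

theorem flagAdj_flagOf (j : Fin n) (α : Ω) :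
    letI := faceOrder hr
    FlagAdj (fun x : Face r => x.1.1) (j : ℕ) (flagOf hr α) (flagOf hr (r j α)) := by
  let := faceOrder hr
  refine ⟨fun h => hr.ne j α (flagOf_injective hr h).symm, fun F hF => ?_⟩
  rw [mem_flagOf, mem_flagOf]
  have key : ∀ β : Ω, β ∈ F.1.2 → r j β ∈ F.1.2 := fun β h =>
    Face.mem_of_conn hr h (FlagConn.step (J := {j}) rfl β) (by rintro _ rfl; exact hF.symm)
  exact ⟨key α, fun h => by simpa only [hr.invol] using key _ h⟩

theorem eq_of_flagAdj {j : Fin n} {α β : Ω}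
    (h : letI := faceOrder hr
      FlagAdj (fun x : Face r => x.1.1) (j : ℕ) (flagOf hr α) (flagOf hr β)) : β = r j α := by
  let := faceOrder hr
  have h1 : FlagConn r ({j}ᶜ)ᶜ α β := by
    refine hr.inter _ _ _ fun i hi => ?_
    have h1 := mem_face (r := r) (i : ℕ) (by omega) (by have := i.2; omega) α
    have h2 : face (r := r) (i : ℕ) (by omega) (by have := i.2; omega) α ∈ flagOf hr α := h1
    rw [h.2 _ (by
      simp only [face]
      intro h
      exact hi (Fin.ext (by exact_mod_cast h)))] at h2
    exact conn_of_mem_of_mem hr rfl h1 h2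
  rw [compl_compl] at h1
  rcases h1.eq_or_eq hr.invol with rfl | h1
  · exact absurd rfl h.1
  · exact h1

theorem strongly_connected (α β : Ω) :
    letI := faceOrder hr
    Relation.ReflTransGen
      (fun A B : Flag (Face r) => (∃ i, FlagAdj (fun x : Face r => x.1.1) i A B) ∧
        ∀ F, F ∈ flagOf hr α → F ∈ flagOf hr β → F ∈ B) (flagOf hr α) (flagOf hr β) := by
  let := faceOrder hr
  have hc : FlagConn r {j | FlagConn r {j}ᶜ α β}ᶜ α β := hr.inter _ _ _ fun i hi => hi
  suffices H : ∀ γ, FlagConn r {j | FlagConn r {j}ᶜ α β}ᶜ α γ → Relation.ReflTransGen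
      (fun A B : Flag (Face r) => (∃ i, FlagAdj (fun x : Face r => x.1.1) i A B) ∧
        ∀ F, F ∈ flagOf hr α → F ∈ flagOf hr β → F ∈ B) (flagOf hr α) (flagOf hr γ) from H β hc
  intro γ h
  induction h with
  | refl => exact Relation.ReflTransGen.refl
  | @tail γ δ h hs ih =>
    refine ih.tail ?_
    have hs' := Relation.ReflTransGen.tail h hs
    obtain ⟨j, hj, rfl⟩ := hs
    refine ⟨⟨_, flagAdj_flagOf hr j γ⟩, fun F hα hβ => ?_⟩
    refine Face.mem_of_conn hr hα hs' fun k hk h => hk ?_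
    exact conn_of_mem_of_mem hr h.symm hα hβ

theorem diamond {x y : Face r} (hne : Nonempty Ω) (hxy : (faceOrder hr).lt x y)
    (hrank : x.1.1 = y.1.1 - 2) :
    {z : Face r | (faceOrder hr).lt x z ∧ (faceOrder hr).lt z y ∧
      z.1.1 = y.1.1 - 1}.ncard = 2 := by
  let := faceOrder hr
  obtain ⟨-, ω, hx, hy⟩ := hxy.le
  have hx1 := x.2.1
  have hy1 := y.2.2.1
  obtain ⟨i, hi⟩ : ∃ i : Fin n, ((i : ℕ) : ℤ) = y.1.1 - 1 :=
    ⟨⟨(y.1.1 - 1).toNat, by omega⟩, by simp only; omega⟩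
  have hlt : ∀ {u w : Face r} {γ : Ω}, γ ∈ u.1.2 → γ ∈ w.1.2 → u.1.1 < w.1.1 → u < w := by
    intro u w γ hu hw h
    refine lt_of_le_of_ne ⟨h.le, γ, hu, hw⟩ ?_
    rintro rfl
    exact h.false
  have hb : -1 ≤ y.1.1 - 1 := by omega
  have hb' : y.1.1 - 1 ≤ n := by omega
  rw [Set.ncard_eq_two]
  refine ⟨face (y.1.1 - 1) hb hb' ω, face (y.1.1 - 1) hb hb' (r i ω), ?_, ?_⟩
  · intro h
    have h0 : r i ω ∈ cls r (y.1.1 - 1) ω := by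
      have : cls r (y.1.1 - 1) ω = cls r (y.1.1 - 1) (r i ω) := congrArg (fun z => z.1.2) h
      rw [this]
      exact mem_cls_self _ _
    have h1 : FlagConn r (Set.univ)ᶜ ω (r i ω) := by
      refine hr.inter _ _ _ fun j _ => ?_
      rcases eq_or_ne i j with rfl | hij
      · refine FlagConn.mono ?_ h0
        intro k hk
        simp only [Set.mem_ofPred_eq] at hk
        rintro rfl
        exact hk hi
      · exact FlagConn.step hij ω
    rw [Set.compl_univ] at h1
    exact hr.ne i ω h1.eq_of_empty
  · ext z
    simp only [Set.mem_ofPred_eq, Set.mem_insert_iff, Set.mem_singleton_iff]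
    constructor
    · rintro ⟨hxz, hzy, hz⟩
      have hch : IsChain (· ≤ ·) ({x, z, y} : Set (Face r)) := by
        have := hxz.le.trans hzy.le
        rintro a (rfl | rfl | rfl) b (rfl | rfl | rfl) _ <;>
          simp_all [hxz.le, hzy.le, le_of_lt]
      obtain ⟨γ, hγ⟩ := exists_common hr hne hch
      have h1 := hγ x (by simp)
      have h2 := hγ z (by simp)
      have h3 := hγ y (by simp)
      have hc : FlagConn r ({i} ∪ {j : Fin n | (j : ℕ) + 2 ≤ i ∨ (i : ℕ) + 2 ≤ j}) ω γ := by
        refine (hr.inter {j : Fin n | ((j : ℕ) : ℤ) = x.1.1 ∨ ((j : ℕ) : ℤ) = y.1.1} ω γ ?_).mono ?_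
        · rintro j (hj | hj)
          · exact conn_of_mem_of_mem hr hj.symm hx h1
          · exact conn_of_mem_of_mem hr hj.symm hy h3
        · intro j hj
          simp only [Set.mem_compl_iff, Set.mem_ofPred_eq, Set.mem_union, Set.mem_singleton_iff,
            Fin.ext_iff] at hj ⊢
          omega
      obtain ⟨δ, h4, h5⟩ := hc.split (by
        rintro _ rfl j hj α
        exact comm_of_lt hr hj.symm α)
      have h6 : z = face (y.1.1 - 1) hb hb' δ := by
        refine Face.eq_of_mem hr h2 ?_ hz
        refine h5.mono fun j hj => ?_
        simp only [Set.mem_ofPred_eq] at hj ⊢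
        omega
      rcases h4.eq_or_eq hr.invol with rfl | rfl
      · exact Or.inl h6
      · exact Or.inr h6
    · have key : ∀ δ, δ ∈ x.1.2 → δ ∈ y.1.2 → ∀ z, z = face (y.1.1 - 1) hb hb' δ →
          x < z ∧ z < y ∧ z.1.1 = y.1.1 - 1 := by
        rintro δ h1 h2 z rfl
        refine ⟨hlt h1 (mem_face _ _ _ _) ?_, hlt (mem_face _ _ _ _) h2 ?_, rfl⟩ <;>
          simp only [face] <;> omega
      rintro (hz | hz)
      · exact key ω hx hy z hz
      · refine key _ ?_ ?_ z hz
        · refine Face.mem_of_conn hr hx (FlagConn.step (J := {i}) rfl ω) ?_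
          rintro _ rfl
          omega
        · refine Face.mem_of_conn hr hy (FlagConn.step (J := {i}) rfl ω) ?_
          rintro _ rfl
          omega

/-- The polytope whose flags are the elements of `Ω`. -/
def polytope (hne : Nonempty Ω) : AbstractPolytope.{u} n :=
  letI := faceOrder hr
  { Face := Face r
    rank := fun x => x.1.1
    rank_strictMono := by
      intro x y hxy
      obtain ⟨h1, α, hx, hy⟩ := hxy.le
      exact lt_of_le_of_ne h1 fun h => hxy.ne (Face.eq_of_mem hr hx hy h)
    rank_mem := fun x => ⟨x.2.1, x.2.2.1⟩
    exists_least := by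
      obtain ⟨α⟩ := hne
      refine ⟨face (-1) le_rfl (by omega) α, fun y => ⟨y.2.1, ?_⟩⟩
      obtain ⟨β, hβ⟩ := y.exists_mem
      refine ⟨β, ?_, hβ⟩
      refine (hr.inter ∅ α β (by simp)).mono fun j _ => ?_
      simp only [Set.mem_ofPred_eq]
      omega
    exists_greatest := by
      obtain ⟨α⟩ := hne
      refine ⟨face n (by omega) le_rfl α, fun y => ⟨y.2.2.1, ?_⟩⟩
      obtain ⟨β, hβ⟩ := y.exists_mem
      refine ⟨β, hβ, ?_⟩
      refine (hr.inter ∅ α β (by simp)).mono fun j _ => ?_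
      have := j.2
      simp only [Set.mem_ofPred_eq]
      omega
    flag_full := by
      intro Φ i h1 h2
      obtain ⟨α, rfl⟩ := flagOf_surjective hr hne Φ
      refine ⟨face i h1 h2 α, ⟨mem_face i h1 h2 α, rfl⟩, ?_⟩
      rintro x ⟨hx, hxi⟩
      exact Face.eq_of_mem hr hx (mem_face i h1 h2 α) hxi
    strongly_connected := by
      intro Φ Ψ
      obtain ⟨α, rfl⟩ := flagOf_surjective hr hne Φ
      obtain ⟨β, rfl⟩ := flagOf_surjective hr hne Ψ
      exact strongly_connected hr α β
    diamond := fun x y hxy h => diamond hr hne hxy h }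

end FlagSystem

/-- The maps `r i` on `Ω` with the base point `o` are, up to a bijection, the adjacency maps on the
flags of the polytope `X` with its base flag. -/
def FlagModel {n : ℕ} (X : BasedPolytope.{u} n) {Ω : Type*} (r : Fin n → Ω → Ω) (o : Ω) : Prop :=
  ∃ e : Flag X.Face ≃ Ω, e X.baseFlag = o ∧
    ∀ (i : Fin n) (Φ Ψ : Flag X.Face), FlagAdj X.rank (i : ℕ) Φ Ψ ↔ e Ψ = r i (e Φ)

theorem IsPolytopal.exists_flagModel {n : ℕ} {Ω : Type u} {r : Fin n → Ω → Ω}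
    (hr : IsPolytopal r) (o : Ω) : ∃ X : BasedPolytope.{u} n, FlagModel X r o := by
  have hne : Nonempty Ω := ⟨o⟩
  let X : BasedPolytope.{u} n :=
    { toAbstractPolytope := FlagSystem.polytope hr hne, baseFlag := FlagSystem.flagOf hr o }
  let e : Ω ≃ Flag X.Face := Equiv.ofBijective (FlagSystem.flagOf hr)
    ⟨FlagSystem.flagOf_injective hr, FlagSystem.flagOf_surjective hr hne⟩
  refine ⟨X, e.symm, e.symm_apply_apply o, fun i Φ Ψ => ?_⟩
  obtain ⟨α, rfl⟩ := e.surjective Φ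
  obtain ⟨β, rfl⟩ := e.surjective Ψ
  rw [Equiv.symm_apply_apply, Equiv.symm_apply_apply]
  refine ⟨fun h => FlagSystem.eq_of_flagAdj hr h, ?_⟩
  rintro rfl
  exact FlagSystem.flagAdj_flagOf hr i α

theorem FlagModel.transport {n : ℕ} {X : BasedPolytope.{u} n} {Ω Ω' : Type*} {r : Fin n → Ω → Ω}
    {r' : Fin n → Ω' → Ω'} {o : Ω} (h : FlagModel X r o) (f : Ω ≃ Ω')
    (hf : ∀ i α, f (r i α) = r' i (f α)) : FlagModel X r' (f o) := by
  obtain ⟨e, he, h⟩ := h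
  refine ⟨e.trans f, by simp [he], fun i Φ Ψ => ?_⟩
  rw [h, Equiv.trans_apply, Equiv.trans_apply, ← hf, f.apply_eq_iff_eq]

theorem FlagConn.map {n : ℕ} {Ω Ω' : Type*} {r : Fin n → Ω → Ω} {r' : Fin n → Ω' → Ω'}
    (f : Ω → Ω') (hf : ∀ i α, f (r i α) = r' i (f α)) {J : Set (Fin n)} {α β : Ω}
    (h : FlagConn r J α β) : FlagConn r' J (f α) (f β) :=
by
  induction h with
  | refl => exact FlagConn.refl _
  | tail _ h ih =>
    obtain ⟨j, hj, rfl⟩ := h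
    rw [hf]
    exact ih.trans (FlagConn.step hj _)

theorem IsPolytopal.transport {n : ℕ} {Ω Ω' : Type*} {r : Fin n → Ω → Ω}
    {r' : Fin n → Ω' → Ω'} (hr : IsPolytopal r) (f : Ω ≃ Ω')
    (hf : ∀ i α, f (r i α) = r' i (f α)) : IsPolytopal r' := by
  have hf' : ∀ i α, f.symm (r' i α) = r i (f.symm α) := fun i α => by
    rw [Equiv.symm_apply_eq, hf, f.apply_symm_apply]
  constructor
  · intro i α
    apply f.symm.injective
    rw [hf', hf', hr.invol]
  · intro i α h
    apply hr.ne i (f.symm α)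
    rw [← hf', h]
  · intro i j hij α
    apply f.symm.injective
    simp only [hf', hr.comm i j hij]
  · intro K α β h
    have := (hr.inter K (f.symm α) (f.symm β) fun i hi => (h i hi).map f.symm hf').map f hf
    simpa using this

/-- A polytopal system of maps on a small set belongs to a polytope in any universe. -/
theorem IsPolytopal.exists_flagModel_of_small {n : ℕ} {Ω : Type v} [Small.{u} Ω]
    {r : Fin n → Ω → Ω} (hr : IsPolytopal r) (o : Ω) :
    ∃ X : BasedPolytope.{u} n, FlagModel X r o := by
  let f := equivShrink.{u} Ω
  have hr' : IsPolytopal (fun i α => f (r i (f.symm α))) :=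
    hr.transport f (by simp)
  obtain ⟨X, hX⟩ := hr'.exists_flagModel (f o)
  refine ⟨X, ?_⟩
  have := hX.transport (r' := r) f.symm (by simp)
  simpa using this

/-! ### The adjacency maps on the flags of a polytope -/

namespace AbstractPolytope

variable {n : ℕ} (P : AbstractPolytope.{u} n)

theorem eq_of_mem_flag {Φ : Flag P.Face} {A B : P.Face} (hA : A ∈ Φ) (hB : B ∈ Φ)
    (h : P.rank A = P.rank B) : A = B := by
  rcases Φ.le_or_le hA hB with h' | h'
  · exact h'.eq_or_lt.resolve_right fun h'' => (P.rank_strictMono h'').ne h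
  · exact (h'.eq_or_lt.resolve_right fun h'' => (P.rank_strictMono h'').ne' h).symm

theorem exists_mem_flag (Φ : Flag P.Face) {i : ℤ} (h : -1 ≤ i) (h' : i ≤ n) :
    ∃ A, A ∈ Φ ∧ P.rank A = i := (P.flag_full Φ i h h').exists

theorem lt_of_mem_flag {Φ : Flag P.Face} {A B : P.Face} (hA : A ∈ Φ) (hB : B ∈ Φ)
    (h : P.rank A < P.rank B) : A < B := by
  rcases Φ.le_or_le hA hB with h' | h'
  · refine lt_of_le_of_ne h' ?_
    rintro rfl
    exact h.false
  · exact absurd (P.rank_strictMono.monotone h') (by omega)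

theorem le_of_mem_flag {Φ : Flag P.Face} {A B : P.Face} (hA : A ∈ Φ) (hB : B ∈ Φ)
    (h : P.rank A ≤ P.rank B) : A ≤ B := by
  rcases h.eq_or_lt with h | h
  · exact (P.eq_of_mem_flag hA hB h).le
  · exact (P.lt_of_mem_flag hA hB h).le

theorem flag_eq_of_subset {α : Type*} [PartialOrder α] {Φ Ψ : Flag α}
    (h : ∀ A, A ∈ Φ → A ∈ Ψ) : Φ = Ψ := by
  apply Flag.ext
  exact Φ.max_chain' Ψ.Chain' h

theorem _root_.FlagAdj.symm {α : Type*} [PartialOrder α] {rank : α → ℤ} {i : ℤ} {Φ Ψ : Flag α}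
    (h : FlagAdj rank i Φ Ψ) : FlagAdj rank i Ψ Φ :=
  ⟨h.1.symm, fun F hF => (h.2 F hF).symm⟩

theorem eq_of_diamond {J K A B C : P.Face} (hJK : P.rank J = P.rank K - 2)
    (hA : J < A ∧ A < K ∧ P.rank A = P.rank K - 1) (hB : J < B ∧ B < K ∧ P.rank B = P.rank K - 1)
    (hC : J < C ∧ C < K ∧ P.rank C = P.rank K - 1) (hBA : B ≠ A) (hCA : C ≠ A) : B = C := by
  have h2 := P.diamond J K (hA.1.trans hA.2.1) hJK
  rw [Set.ncard_eq_two] at h2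
  obtain ⟨x, y, hxy, hS⟩ := h2
  have hA' : A ∈ ({x, y} : Set P.Face) := hS ▸ hA
  have hB' : B ∈ ({x, y} : Set P.Face) := hS ▸ hB
  have hC' : C ∈ ({x, y} : Set P.Face) := hS ▸ hC
  simp only [Set.mem_insert_iff, Set.mem_singleton_iff] at hA' hB' hC'
  grind

/-- Adjacent flags differ in a face of a rank between `0` and `n - 1`, since all flags contain
the least and the greatest face. -/
theorem exists_fin_of_flagAdj {i : ℤ} {Φ Ψ : Flag P.Face} (h : FlagAdj P.rank i Φ Ψ) :
    ∃ j : Fin n, i = ((j : ℕ) : ℤ) := by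
  obtain ⟨A, hA, hAΨ⟩ : ∃ A, A ∈ Φ ∧ A ∉ Ψ := by
    by_contra! hc
    exact h.1 (flag_eq_of_subset hc)
  have hi : P.rank A = i := by
    by_contra hne
    exact hAΨ ((h.2 A hne).1 hA)
  have hb := P.rank_mem A
  obtain ⟨B, hB, hBi⟩ := P.exists_mem_flag Ψ hb.1 hb.2
  have hAB : A ≠ B := by rintro rfl; exact hAΨ hB
  by_contra hno
  have hcases : i = -1 ∨ i = n := by
    by_contra hc
    exact hno ⟨⟨i.toNat, by omega⟩, by simp only; omega⟩
  rcases hcases with hc | hc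
  · obtain ⟨L, hL⟩ := P.exists_least
    have key : ∀ C, P.rank C = -1 → C = L := fun C hC =>
      ((hL C).eq_or_lt.resolve_right fun h' => by
        have := P.rank_strictMono h'
        have := (P.rank_mem L).1
        omega).symm
    exact hAB ((key A (by omega)).trans (key B (by omega)).symm)
  · obtain ⟨L, hL⟩ := P.exists_greatest
    have key : ∀ C, P.rank C = n → C = L := fun C hC =>
      ((hL C).eq_or_lt.resolve_right fun h' => by
        have := P.rank_strictMono h'
        have := (P.rank_mem L).2
        omega)
    exact hAB ((key A (by omega)).trans (key B (by omega)).symm)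

theorem existsUnique_flagAdj (i : Fin n) (Φ : Flag P.Face) :
    ∃! Ψ, FlagAdj P.rank (i : ℕ) Φ Ψ := by
  obtain ⟨J, hJ, hJi⟩ := P.exists_mem_flag Φ (i := (i : ℕ) - 1) (by omega) (by omega)
  obtain ⟨A, hA, hAi⟩ := P.exists_mem_flag Φ (i := (i : ℕ)) (by omega) (by omega)
  obtain ⟨K, hK, hKi⟩ := P.exists_mem_flag Φ (i := (i : ℕ) + 1) (by omega) (by omega)
  have hJK : P.rank J = P.rank K - 2 := by omega
  have hAS : J < A ∧ A < K ∧ P.rank A = P.rank K - 1 :=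
    ⟨P.lt_of_mem_flag hJ hA (by omega), P.lt_of_mem_flag hA hK (by omega), by omega⟩
  apply existsUnique_of_exists_of_unique
  · obtain ⟨B, hBS, hBA⟩ : ∃ B, (J < B ∧ B < K ∧ P.rank B = P.rank K - 1) ∧ B ≠ A := by
      have h2 := P.diamond J K (hAS.1.trans hAS.2.1) hJK
      obtain ⟨B, hB, hne⟩ := Set.exists_ne_of_one_lt_ncard (by rw [h2]; norm_num) A
      exact ⟨B, hB, hne⟩
    have hchain : IsChain (· ≤ ·) (insert B {C | C ∈ Φ ∧ C ≠ A}) := by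
      refine IsChain.insert (fun C hC D hD hne => Φ.chain_le hC.1 hD.1 hne) ?_
      rintro C ⟨hC, hCA⟩ -
      have hne : P.rank C ≠ (i : ℕ) := fun h => hCA (P.eq_of_mem_flag hC hA (by omega))
      rcases lt_or_gt_of_ne hne with h | h
      · exact Or.inr ((P.le_of_mem_flag hC hJ (by omega)).trans hBS.1.le)
      · exact Or.inl (hBS.2.1.le.trans (P.le_of_mem_flag hK hC (by omega)))
    obtain ⟨Ψ, hΨ⟩ := hchain.exists_subset_flag
    have hB : B ∈ Ψ := hΨ (Set.mem_insert _ _)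
    have hsub : ∀ C, P.rank C ≠ (i : ℕ) → C ∈ Φ → C ∈ Ψ := fun C hC hCΦ =>
      hΨ (Set.mem_insert_of_mem _ ⟨hCΦ, by rintro rfl; exact hC hAi⟩)
    refine ⟨Ψ, ?_, fun C hC => ⟨hsub C hC, fun hCΨ => ?_⟩⟩
    · rintro rfl
      exact hBA (P.eq_of_mem_flag hB hA (by omega))
    · obtain ⟨D, hD, hDC⟩ := P.exists_mem_flag Φ (P.rank_mem C).1 (P.rank_mem C).2
      rw [P.eq_of_mem_flag hCΨ (hsub D (by omega) hD) hDC.symm]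
      exact hD
  · have key : ∀ Ψ, FlagAdj P.rank (i : ℕ) Φ Ψ →
        ∃ B, B ∈ Ψ ∧ (J < B ∧ B < K ∧ P.rank B = P.rank K - 1) ∧ B ≠ A := by
      intro Ψ h
      obtain ⟨B, hB, hBi⟩ := P.exists_mem_flag Ψ (i := (i : ℕ)) (by omega) (by omega)
      have hJ' := (h.2 J (by omega)).1 hJ
      have hK' := (h.2 K (by omega)).1 hK
      refine ⟨B, hB, ⟨P.lt_of_mem_flag hJ' hB (by omega), P.lt_of_mem_flag hB hK' (by omega),
        by omega⟩, ?_⟩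
      rintro rfl
      refine h.1 (flag_eq_of_subset fun C hC => ?_)
      by_cases hCi : P.rank C = (i : ℕ)
      · rw [P.eq_of_mem_flag hC hA (by omega)]
        exact hB
      · exact (h.2 C hCi).1 hC
    intro Ψ Ψ' h h'
    obtain ⟨B, hB, hBS, hBA⟩ := key Ψ h
    obtain ⟨B', hB', hBS', hBA'⟩ := key Ψ' h'
    have hBB := P.eq_of_diamond hJK hAS hBS hBS' hBA hBA'
    refine flag_eq_of_subset fun C hC => ?_
    by_cases hCi : P.rank C = (i : ℕ)
    · rw [P.eq_of_mem_flag hC hB (by omega), hBB]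
      exact hB'
    · exact (h'.2 C hCi).1 ((h.2 C hCi).2 hC)

/-- The flag that is `i`-adjacent to a given flag. -/
noncomputable def adj (i : Fin n) (Φ : Flag P.Face) : Flag P.Face :=
  (P.existsUnique_flagAdj i Φ).choose

theorem flagAdj_adj (i : Fin n) (Φ : Flag P.Face) : FlagAdj P.rank (i : ℕ) Φ (P.adj i Φ) :=
  (P.existsUnique_flagAdj i Φ).choose_spec.1

theorem flagAdj_iff {i : Fin n} {Φ Ψ : Flag P.Face} :
    FlagAdj P.rank (i : ℕ) Φ Ψ ↔ Ψ = P.adj i Φ := by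
  constructor
  · exact (P.existsUnique_flagAdj i Φ).choose_spec.2 Ψ
  · rintro rfl
    exact P.flagAdj_adj i Φ

theorem mem_adj {i : Fin n} {Φ : Flag P.Face} {A : P.Face} (h : P.rank A ≠ (i : ℕ)) :
    A ∈ P.adj i Φ ↔ A ∈ Φ := ((P.flagAdj_adj i Φ).2 A h).symm

theorem adj_adj (i : Fin n) (Φ : Flag P.Face) : P.adj i (P.adj i Φ) = Φ :=
  (P.flagAdj_iff.1 (P.flagAdj_adj i Φ).symm).symm

theorem adj_comm {i j : Fin n} (hij : (i : ℕ) + 2 ≤ j) (Φ : Flag P.Face) :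
    P.adj i (P.adj j Φ) = P.adj j (P.adj i Φ) := by
  symm
  rw [← P.flagAdj_iff]
  refine ⟨fun h => (P.flagAdj_adj i Φ).1 ?_, fun A hA => ?_⟩
  · have := congrArg (P.adj j) h
    rwa [P.adj_adj, P.adj_adj] at this
  by_cases hAj : P.rank A = (j : ℕ)
  swap
  · rw [P.mem_adj hAj, P.mem_adj hAj, P.mem_adj hA]
  -- The flags `Φ` and `adj i Φ` have the same faces of ranks `j - 1`, `j` and `j + 1`, which
  -- determine the face of rank `j` of the `j`-adjacent flag.
  obtain ⟨J, hJ, hJi⟩ := P.exists_mem_flag Φ (i := (j : ℕ) - 1) (by omega) (by omega)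
  obtain ⟨C, hC, hCi⟩ := P.exists_mem_flag Φ (i := (j : ℕ)) (by omega) (by omega)
  obtain ⟨K, hK, hKi⟩ := P.exists_mem_flag Φ (i := (j : ℕ) + 1) (by omega) (by omega)
  have key : ∀ Ψ, J ∈ Ψ → C ∈ Ψ → K ∈ Ψ → ∀ B, P.rank B = (j : ℕ) → B ∈ P.adj j Ψ →
      (J < B ∧ B < K ∧ P.rank B = P.rank K - 1) ∧ B ≠ C := by
    intro Ψ hJ hC hK B hBj hB
    have hJ' := (P.mem_adj (i := j) (by omega)).2 hJ
    have hK' := (P.mem_adj (i := j) (by omega)).2 hK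
    refine ⟨⟨P.lt_of_mem_flag hJ' hB (by omega), P.lt_of_mem_flag hB hK' (by omega), by omega⟩, ?_⟩
    rintro rfl
    refine (P.flagAdj_adj j Ψ).1 (flag_eq_of_subset fun D hD => ?_)
    by_cases hDj : P.rank D = (j : ℕ)
    · rw [P.eq_of_mem_flag hD hC (by omega)]
      exact hB
    · exact (P.mem_adj hDj).2 hD
  have hS : J < C ∧ C < K ∧ P.rank C = P.rank K - 1 :=
    ⟨P.lt_of_mem_flag hJ hC (by omega), P.lt_of_mem_flag hC hK (by omega), by omega⟩
  have k1 := key Φ hJ hC hK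
  have k2 := key (P.adj i Φ) ((P.mem_adj (by omega)).2 hJ) ((P.mem_adj (by omega)).2 hC)
    ((P.mem_adj (by omega)).2 hK)
  obtain ⟨B1, hB1, hB1j⟩ := P.exists_mem_flag (P.adj j Φ) (i := (j : ℕ)) (by omega) (by omega)
  obtain ⟨B2, hB2, hB2j⟩ :=
    P.exists_mem_flag (P.adj j (P.adj i Φ)) (i := (j : ℕ)) (by omega) (by omega)
  obtain rfl := P.eq_of_diamond (by omega) hS (k1 B1 hB1j hB1).1 (k2 B2 hB2j hB2).1
    (k1 B1 hB1j hB1).2 (k2 B2 hB2j hB2).2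
  constructor
  · intro h
    rwa [P.eq_of_mem_flag h hB1 (by omega)]
  · intro h
    rwa [P.eq_of_mem_flag h hB2 (by omega)]

variable {P}

theorem mem_of_flagConn {J : Set (Fin n)} {Φ Ψ : Flag P.Face} (h : FlagConn P.adj J Φ Ψ)
    {A : P.Face} (hA : ∀ j ∈ J, P.rank A ≠ ((j : ℕ) : ℤ)) (hΦ : A ∈ Φ) : A ∈ Ψ := by
  induction h with
  | refl => exact hΦ
  | tail _ h ih =>
    obtain ⟨j, hj, rfl⟩ := h
    exact (P.mem_adj (hA j hj)).2 ih

theorem flagConn_of_mem {K : Set (Fin n)} {Φ Ψ : Flag P.Face}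
    (h : ∀ i ∈ K, ∃ A, P.rank A = ((i : ℕ) : ℤ) ∧ A ∈ Φ ∧ A ∈ Ψ) : FlagConn P.adj Kᶜ Φ Ψ := by
  suffices H : ∀ Δ, Relation.ReflTransGen
      (fun A B : Flag P.Face => (∃ i, FlagAdj P.rank i A B) ∧ ∀ F, F ∈ Φ → F ∈ Ψ → F ∈ B) Φ Δ →
      FlagConn P.adj Kᶜ Φ Δ ∧ ∀ F, F ∈ Φ → F ∈ Ψ → F ∈ Δ from (H Ψ (P.strongly_connected Φ Ψ)).1
  intro Δ hΔ
  induction hΔ with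
  | refl => exact ⟨FlagConn.refl _, fun F h _ => h⟩
  | @tail Γ Δ _ hs ih =>
    obtain ⟨⟨i, hi⟩, hF⟩ := hs
    refine ⟨?_, hF⟩
    obtain ⟨j, rfl⟩ := P.exists_fin_of_flagAdj hi
    obtain rfl := P.flagAdj_iff.1 hi
    suffices hj : j ∉ K from ih.1.trans (FlagConn.step (J := Kᶜ) hj _)
    intro hj
    refine hi.1 ?_
    obtain ⟨A, hA, hAΦ, hAΨ⟩ := h j hj
    refine flag_eq_of_subset fun B hB => ?_
    by_cases hBj : P.rank B = (j : ℕ)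
    · rw [P.eq_of_mem_flag hB (ih.2 A hAΦ hAΨ) (by omega)]
      exact hF A hAΦ hAΨ
    · exact (P.mem_adj hBj).2 hB

theorem isPolytopal_adj : IsPolytopal P.adj where
  invol := P.adj_adj
  ne i Φ := (P.flagAdj_adj i Φ).1.symm
  comm _ _ hij := P.adj_comm hij
  inter K Φ Ψ h := by
    refine flagConn_of_mem fun i hi => ?_
    obtain ⟨A, hA, hAi⟩ := P.exists_mem_flag Φ (i := (i : ℕ)) (by omega) (by omega)
    refine ⟨A, hAi, hA, mem_of_flagConn (h i hi) (fun j hj hj' => hj ?_) hA⟩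
    exact Fin.ext (by omega)

/-- Flags with a common face are connected without changing that face. -/
theorem flagConn_of_mem_of_mem {Φ Ψ : Flag P.Face} {A : P.Face} (h : A ∈ Φ) (h' : A ∈ Ψ) :
    FlagConn P.adj {j | P.rank A ≠ ((j : ℕ) : ℤ)} Φ Ψ :=
  (flagConn_of_mem (K := {j | P.rank A = ((j : ℕ) : ℤ)}) fun _ hi => ⟨A, hi, h, h'⟩).mono
    fun _ h => h

/-- A strictly monotone function with values `≥ -1` is bounded below by the rank. -/
theorem rank_le_of_strictMono {f : P.Face → ℤ} (hf : StrictMono f) (h0 : ∀ A, -1 ≤ f A)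
    (A : P.Face) : P.rank A ≤ f A := by
  obtain ⟨Φ, hA⟩ := Flag.exists_mem A
  suffices H : ∀ m : ℕ, ∀ B ∈ Φ, P.rank B + 1 = m → P.rank B ≤ f B from
    H (P.rank A + 1).toNat A hA (by have := (P.rank_mem A).1; omega)
  intro m
  induction m with
  | zero =>
    intro B _ h
    have := h0 B
    push_cast at h
    omega
  | succ m ih =>
    intro B hB h
    push_cast at h
    obtain ⟨C, hC, hCr⟩ := P.exists_mem_flag Φ (i := P.rank B - 1) (by omega)
      (by have := (P.rank_mem B).2; omega)
    have h1 := ih C hC (by omega)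
    have h2 := hf (P.lt_of_mem_flag hC hB (by omega))
    omega

theorem rank_orderIso {Q : AbstractPolytope.{u} n} (e : P.Face ≃o Q.Face) (A : P.Face) :
    Q.rank (e A) = P.rank A := by
  apply le_antisymm
  · have := rank_le_of_strictMono (P := Q) (f := fun B => P.rank (e.symm B))
      (P.rank_strictMono.comp e.symm.strictMono) (fun B => (P.rank_mem _).1) (e A)
    simpa using this
  · exact rank_le_of_strictMono (f := fun B => Q.rank (e B))
      (Q.rank_strictMono.comp e.strictMono) (fun B => (Q.rank_mem _).1) A

theorem mem_map_flag {α β : Type*} [PartialOrder α] [PartialOrder β] (e : α ≃o β) {Φ : Flag α}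
    {B : β} : B ∈ Flag.map e Φ ↔ e.symm B ∈ Φ := by
  rw [← SetLike.mem_coe, Flag.coe_map, Set.mem_image]
  constructor
  · rintro ⟨A, hA, rfl⟩
    simpa using hA
  · exact fun h => ⟨_, h, by simp⟩

theorem map_adj {Q : AbstractPolytope.{u} n} (e : P.Face ≃o Q.Face) (i : Fin n)
    (Φ : Flag P.Face) : Flag.map e (P.adj i Φ) = Q.adj i (Flag.map e Φ) := by
  rw [← Q.flagAdj_iff]
  refine ⟨fun h => (P.flagAdj_adj i Φ).1 ((Flag.map e).injective h), fun B hB => ?_⟩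
  rw [mem_map_flag, mem_map_flag, P.mem_adj]
  rwa [rank_orderIso]

theorem smul_adj (σ : P.Aut) (i : Fin n) (Φ : Flag P.Face) : σ • P.adj i Φ = P.adj i (σ • Φ) :=
  map_adj σ i Φ

/-- Every bijection of flags that commutes with the adjacency maps comes from an
isomorphism of polytopes. -/
theorem exists_orderIso_of_equiv {Q : AbstractPolytope.{u} n} (e : Flag P.Face ≃ Flag Q.Face)
    (he : ∀ i Φ, e (P.adj i Φ) = Q.adj i (e Φ)) :
    ∃ E : P.Face ≃o Q.Face, ∀ Φ, Flag.map E Φ = e Φ := by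
  have key : ∀ {P Q : AbstractPolytope.{u} n} (e : Flag P.Face ≃ Flag Q.Face)
      (_ : ∀ i Φ, e (P.adj i Φ) = Q.adj i (e Φ)) (A : P.Face),
      ∃ B : Q.Face, Q.rank B = P.rank A ∧ ∀ Φ, A ∈ Φ → B ∈ e Φ := by
    intro P Q e he A
    obtain ⟨Φ, hA⟩ := Flag.exists_mem A
    obtain ⟨B, hB, hBA⟩ := Q.exists_mem_flag (e Φ) (P.rank_mem A).1 (P.rank_mem A).2
    refine ⟨B, hBA, fun Ψ hΨ => ?_⟩
    exact mem_of_flagConn ((flagConn_of_mem_of_mem hA hΨ).map e he)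
      (fun j hj => by rw [hBA]; exact hj) hB
  have he' : ∀ i Φ, e.symm (Q.adj i Φ) = P.adj i (e.symm Φ) := fun i Φ => by
    rw [Equiv.symm_apply_eq, he, e.apply_symm_apply]
  choose f hf1 hf2 using key e he
  choose g hg1 hg2 using key e.symm he'
  have hgf : ∀ A, g (f A) = A := fun A => by
    obtain ⟨Φ, hA⟩ := Flag.exists_mem A
    have := hg2 (f A) (e Φ) (hf2 A Φ hA)
    rw [e.symm_apply_apply] at this
    exact P.eq_of_mem_flag this hA (by rw [hg1, hf1])
  have hfg : ∀ B, f (g B) = B := fun B => by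
    obtain ⟨Φ, hB⟩ := Flag.exists_mem B
    have := hf2 (g B) (e.symm Φ) (hg2 B Φ hB)
    rw [e.apply_symm_apply] at this
    exact Q.eq_of_mem_flag this hB (by rw [hf1, hg1])
  have hfm : Monotone f := fun A B hAB => by
    obtain ⟨Φ, hA, hB⟩ := Flag.exists_mem_mem hAB
    exact Q.le_of_mem_flag (hf2 A Φ hA) (hf2 B Φ hB)
      (by rw [hf1, hf1]; exact P.rank_strictMono.monotone hAB)
  have hgm : Monotone g := fun A B hAB => by
    obtain ⟨Φ, hA, hB⟩ := Flag.exists_mem_mem hAB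
    exact P.le_of_mem_flag (hg2 A Φ hA) (hg2 B Φ hB)
      (by rw [hg1, hg1]; exact Q.rank_strictMono.monotone hAB)
  refine ⟨{ toFun := f, invFun := g, left_inv := hgf, right_inv := hfg, map_rel_iff' := ?_ }, ?_⟩
  · intro A B
    refine ⟨fun h => ?_, fun h => hfm h⟩
    have := hgm h
    simpa [hgf] using this
  · intro Φ
    refine flag_eq_of_subset fun B hB => ?_
    rw [mem_map_flag] at hB
    have := hf2 _ _ hB
    change f (g B) ∈ e Φ at this
    rwa [hfg] at this

theorem smul_injective_of_flag {σ τ : P.Aut} {Φ : Flag P.Face} (h : σ • Φ = τ • Φ) : σ = τ := by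
  have hall : ∀ Ψ : Flag P.Face, σ • Ψ = τ • Ψ := by
    intro Ψ
    have hc : FlagConn P.adj ∅ᶜ Φ Ψ := isPolytopal_adj.inter ∅ Φ Ψ (by simp)
    induction hc with
    | refl => exact h
    | tail _ hs ih =>
      obtain ⟨j, -, rfl⟩ := hs
      rw [smul_adj, smul_adj, ih]
  apply OrderIso.ext
  funext A
  obtain ⟨Φ, hA⟩ := Flag.exists_mem A
  have h1 : σ A ∈ σ • Φ := (mem_map_flag σ).2 (by simpa using hA)
  have h2 : τ A ∈ τ • Φ := (mem_map_flag τ).2 (by simpa using hA)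
  rw [hall] at h1
  exact P.eq_of_mem_flag h1 h2 (by rw [rank_orderIso, rank_orderIso])

end AbstractPolytope

namespace FlagModel

open AbstractPolytope

variable {n : ℕ} {X Y : BasedPolytope.{u} n} {Ω : Type*} {r : Fin n → Ω → Ω} {o : Ω}

theorem iff_adj : FlagModel X r o ↔ ∃ e : Flag X.Face ≃ Ω, e X.baseFlag = o ∧
    ∀ i Φ, e (X.adj i Φ) = r i (e Φ) := by
  refine exists_congr fun e => and_congr_right fun _ => ⟨fun h i Φ => ?_, fun h i Φ Ψ => ?_⟩
  · exact (h i Φ _).1 (X.flagAdj_adj i Φ)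
  · rw [X.flagAdj_iff, ← h, e.apply_eq_iff_eq]

theorem isPolytopal (h : FlagModel X r o) : IsPolytopal r := by
  obtain ⟨e, -, h⟩ := iff_adj.1 h
  exact isPolytopal_adj.transport e h

/-- A flag model determines the based polytope. -/
theorem equiv (hX : FlagModel X r o) (hY : FlagModel Y r o) : X ≈ Y := by
  obtain ⟨e, he, h⟩ := iff_adj.1 hX
  obtain ⟨f, hf, h'⟩ := iff_adj.1 hY
  obtain ⟨E, hE⟩ := exists_orderIso_of_equiv (P := X.toAbstractPolytope)
    (Q := Y.toAbstractPolytope) (e.trans f.symm) (by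
      intro i Φ
      rw [Equiv.trans_apply, Equiv.trans_apply, Equiv.symm_apply_eq, h, h', f.apply_symm_apply])
  refine ⟨E, ?_⟩
  rw [hE, Equiv.trans_apply, he, Equiv.symm_apply_eq, hf]

theorem of_equiv (hX : FlagModel X r o) (hXY : X ≈ Y) : FlagModel Y r o := by
  obtain ⟨e, he, h⟩ := iff_adj.1 hX
  obtain ⟨E, hE⟩ := hXY
  refine iff_adj.2 ⟨(Flag.map E).symm.trans e, ?_, fun i Φ => ?_⟩
  · rw [Equiv.trans_apply, ← hE, Equiv.symm_apply_apply, he]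
  · rw [Equiv.trans_apply, Equiv.trans_apply, ← h]
    congr 1
    rw [Equiv.symm_apply_eq, map_adj (P := X.toAbstractPolytope) (Q := Y.toAbstractPolytope),
      Equiv.apply_symm_apply]

end FlagModel

/-! ### Polytopes with two flag orbits, described by a group -/

/-- For elements `a 0, …, a (n - 1)` of a group `G`, the `i`-th adjacency map on `G × Bool`.
The group acts on `G × Bool` with two orbits, by left multiplication, and every adjacency
map interchanges the orbits and commutes with the action. -/
def groupAdj {G : Type*} [Group G] {n : ℕ} (a : Fin n → G) (i : Fin n) : G × Bool → G × Bool
  | (g, false) => (g * a i, true)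
  | (g, true) => (g * (a i)⁻¹, false)

/-- The subgroup generated by the quotients of two of the elements `a i` with `i ∈ J`. -/
def quotientSubgroup {G : Type*} [Group G] {n : ℕ} (a : Fin n → G) (J : Set (Fin n)) :
    Subgroup G :=
  Subgroup.closure {x | ∃ i ∈ J, ∃ j ∈ J, x = a i * (a j)⁻¹}

section groupAdj

variable {G : Type*} [Group G] {n : ℕ} {a : Fin n → G} {J : Set (Fin n)}

theorem groupAdj_groupAdj (i : Fin n) (x : G × Bool) : groupAdj a i (groupAdj a i x) = x := by
  rcases x with ⟨g, _ | _⟩ <;> simp [groupAdj]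

theorem groupAdj_snd (i : Fin n) (x : G × Bool) : (groupAdj a i x).2 = !x.2 := by
  rcases x with ⟨g, _ | _⟩ <;> simp [groupAdj]

theorem groupAdj_mul (i : Fin n) (g : G) (x : G × Bool) :
    groupAdj a i (g * x.1, x.2) = (g * (groupAdj a i x).1, (groupAdj a i x).2) := by
  rcases x with ⟨h, _ | _⟩ <;> simp [groupAdj, mul_assoc]

theorem mul_inv_mem_quotientSubgroup {i j : Fin n} (hi : i ∈ J) (hj : j ∈ J) :
    a i * (a j)⁻¹ ∈ quotientSubgroup a J :=
  Subgroup.subset_closure ⟨i, hi, j, hj, rfl⟩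

theorem quotientSubgroup_mono {I : Set (Fin n)} (h : I ⊆ J) :
    quotientSubgroup a I ≤ quotientSubgroup a J :=
  Subgroup.closure_mono fun _ ⟨i, hi, j, hj, e⟩ => ⟨i, h hi, j, h hj, e⟩

theorem flagConn_groupAdj {g h : G} :
    FlagConn (groupAdj a) J (g, false) (h, false) ↔ g⁻¹ * h ∈ quotientSubgroup a J := by
  constructor
  · suffices H : ∀ β, FlagConn (groupAdj a) J (g, false) β →
        (β.2 = false → g⁻¹ * β.1 ∈ quotientSubgroup a J) ∧
        (β.2 = true → ∀ j ∈ J, g⁻¹ * β.1 * (a j)⁻¹ ∈ quotientSubgroup a J) from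
      fun hc => (H _ hc).1 rfl
    intro β hβ
    induction hβ with
    | refl => simp [one_mem]
    | @tail γ δ _ hs ih =>
      obtain ⟨j, hj, rfl⟩ := hs
      obtain ⟨x, _ | _⟩ := γ
      · refine ⟨by simp [groupAdj], fun _ k hk => ?_⟩
        have := mul_mem (ih.1 rfl) (mul_inv_mem_quotientSubgroup hj hk)
        simpa only [groupAdj, mul_assoc] using this
      · refine ⟨fun _ => ?_, by simp [groupAdj]⟩
        simpa only [groupAdj, mul_assoc] using ih.2 rfl j hj
  · suffices H : ∀ x ∈ quotientSubgroup a J, ∀ g,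
        FlagConn (groupAdj a) J (g, false) (g * x, false) from fun hx => by
      simpa using H _ hx g
    intro x hx
    induction hx using Subgroup.closure_induction with
    | mem x hx =>
      obtain ⟨i, hi, j, hj, rfl⟩ := hx
      intro g
      have h1 := FlagConn.step (r := groupAdj a) hi (g, false)
      have h2 := FlagConn.step (r := groupAdj a) hj (groupAdj a i (g, false))
      simpa only [groupAdj, mul_assoc] using h1.trans h2
    | one => intro g; simpa using FlagConn.refl _
    | mul x y _ _ hx hy =>
      intro g
      simpa only [mul_assoc] using (hx g).trans (hy (g * x))
    | inv x _ hx =>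
      intro g
      simpa using (hx (g * x⁻¹)).symm groupAdj_groupAdj

theorem flagConn_step_iff {Ω : Type*} {r : Fin n → Ω → Ω} (hr : ∀ i α, r i (r i α) = α)
    {j : Fin n} (hj : j ∈ J) {α β : Ω} : FlagConn r J α (r j β) ↔ FlagConn r J α β := by
  refine ⟨fun h => ?_, fun h => h.trans (FlagConn.step hj _)⟩
  simpa only [hr] using h.trans (FlagConn.step hj _)

/-- The path-intersection property of the adjacency maps is an intersection property of
the subgroups `quotientSubgroup a J`. -/
theorem isPolytopal_groupAdj [NeZero n] (h0 : a 0 = 1)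
    (hcomm : ∀ i j : Fin n, (i : ℕ) + 2 ≤ j → a j * (a i)⁻¹ = a i * (a j)⁻¹)
    (hodd : ∃ j ≠ 0, a j ∉ quotientSubgroup a {0}ᶜ)
    (hint : ∀ K : Set (Fin n), K ≠ Set.univ → ∀ x,
      (∀ i ∈ K, x ∈ quotientSubgroup a {i}ᶜ) → x ∈ quotientSubgroup a Kᶜ) :
    IsPolytopal (groupAdj a) := by
  have hproper : ∀ (K : Set (Fin n)), K ≠ Set.univ → ∀ α β,
      (∀ i ∈ K, FlagConn (groupAdj a) {i}ᶜ α β) → FlagConn (groupAdj a) Kᶜ α β := by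
    intro K hK
    obtain ⟨j, hj⟩ := (Set.ne_univ_iff_exists_notMem K).1 hK
    have hjc : j ∈ Kᶜ := hj
    have hji : ∀ i ∈ K, j ∈ ({i}ᶜ : Set (Fin n)) := by
      rintro i hi rfl
      exact hj hi
    -- Both flags may be replaced by `j`-adjacent ones, hence assumed to be in the first orbit.
    have h1 : ∀ g h : G, (∀ i ∈ K, FlagConn (groupAdj a) {i}ᶜ (g, false) (h, false)) →
        FlagConn (groupAdj a) Kᶜ (g, false) (h, false) := by
      intro g h hc
      rw [flagConn_groupAdj]
      exact hint K hK _ fun i hi => flagConn_groupAdj.1 (hc i hi)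
    have h2 : ∀ (g : G) β, (∀ i ∈ K, FlagConn (groupAdj a) {i}ᶜ (g, false) β) →
        FlagConn (groupAdj a) Kᶜ (g, false) β := by
      rintro g ⟨h, _ | _⟩ hc
      · exact h1 g h hc
      · rw [← flagConn_step_iff groupAdj_groupAdj hjc]
        refine h1 g _ fun i hi => ?_
        exact (flagConn_step_iff groupAdj_groupAdj (hji i hi)).2 (hc i hi)
    rintro ⟨g, _ | _⟩ β hc
    · exact h2 g β hc
    · refine (FlagConn.step hjc _).trans (h2 _ β fun i hi => ?_)
      have := FlagConn.step (r := groupAdj a) (hji i hi) (g, true)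
      exact (this.symm groupAdj_groupAdj).trans (hc i hi)
  refine ⟨groupAdj_groupAdj, ?_, ?_, ?_⟩
  · intro i x h
    have := groupAdj_snd (a := a) i x
    rw [h] at this
    cases hx : x.2 <;> simp [hx] at this
  · intro i j hij x
    have h1 := hcomm i j hij
    have h2 : (a j)⁻¹ * a i = (a i)⁻¹ * a j := by
      have : (a i)⁻¹ * (a i * (a j)⁻¹) * a i = (a i)⁻¹ * (a j * (a i)⁻¹) * a i := by rw [h1]
      simpa only [inv_mul_cancel_left, mul_assoc, inv_mul_cancel, mul_one] using this
    rcases x with ⟨g, _ | _⟩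
    · simp only [groupAdj, mul_assoc, h1]
    · simp only [groupAdj, mul_assoc, h2]
  · intro K α β h
    by_cases hK : K = Set.univ
    swap
    · exact hproper K hK α β h
    subst hK
    have h1 : FlagConn (groupAdj a) ({0}ᶜᶜ) α β := by
      refine hproper _ ?_ α β fun i _ => h i (Set.mem_univ _)
      intro hu
      have : (0 : Fin n) ∈ ({0}ᶜ : Set (Fin n)) := hu ▸ Set.mem_univ _
      exact this rfl
    rw [compl_compl] at h1
    rcases h1.eq_or_eq groupAdj_groupAdj with rfl | rfl
    · exact FlagConn.refl _
    · exfalso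
      obtain ⟨j, hj, hja⟩ := hodd
      have hjc : j ∈ ({0}ᶜ : Set (Fin n)) := hj
      have h2 : ∀ g, ¬ FlagConn (groupAdj a) {0}ᶜ (g, false) (g, true) := by
        intro g hg
        rw [← flagConn_step_iff groupAdj_groupAdj hjc] at hg
        rw [groupAdj, flagConn_groupAdj] at hg
        exact hja (by simpa using hg)
      have h3 := h 0 (Set.mem_univ _)
      rcases α with ⟨g, _ | _⟩
      · exact h2 g (by simpa [groupAdj, h0] using h3)
      · exact h2 g (by simpa [groupAdj, h0] using h3.symm groupAdj_groupAdj)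

theorem IsPolytopal.mem_quotientSubgroup (h : IsPolytopal (groupAdj a)) {K : Set (Fin n)} {x : G}
    (hx : ∀ i ∈ K, x ∈ quotientSubgroup a {i}ᶜ) : x ∈ quotientSubgroup a Kᶜ := by
  have := h.inter K (1, false) (x, false) fun i hi => flagConn_groupAdj.2 (by simpa using hx i hi)
  simpa using flagConn_groupAdj.1 this

theorem IsPolytopal.apply_ne {Ω : Type*} {r : Fin n → Ω → Ω} (h : IsPolytopal r) {i j : Fin n}
    (hij : i ≠ j) (α : Ω) : r i α ≠ r j α := by
  intro he
  have : FlagConn r (Set.univ)ᶜ α (r i α) := by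
    refine h.inter _ _ _ fun k _ => ?_
    by_cases hk : i = k
    · rw [he]
      exact FlagConn.step (show j ≠ k from fun h => hij (hk.trans h.symm)) _
    · exact FlagConn.step hk _
  rw [Set.compl_univ] at this
  exact h.ne i α this.eq_of_empty

theorem IsPolytopal.closure_range (h : IsPolytopal (groupAdj a)) :
    Subgroup.closure (Set.range a) = ⊤ := by
  rw [eq_top_iff]
  intro x _
  have h1 := h.mem_quotientSubgroup (K := ∅) (x := x) (by simp)
  refine (Subgroup.closure_le _).2 ?_ h1
  rintro _ ⟨i, -, j, -, rfl⟩
  exact mul_mem (Subgroup.subset_closure ⟨i, rfl⟩)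
    (inv_mem (Subgroup.subset_closure ⟨j, rfl⟩))

theorem IsPolytopal.mul_inv_eq (h : IsPolytopal (groupAdj a)) {i j : Fin n}
    (hij : (i : ℕ) + 2 ≤ j) : a j * (a i)⁻¹ = a i * (a j)⁻¹ := by
  have := h.comm i j hij (1, false)
  simpa [groupAdj] using this

/-- A map between flag sets that commutes with the adjacency maps induces a homomorphism. -/
theorem exists_hom_of_groupAdj {G' : Type*} [Group G'] [NeZero n] {b : Fin n → G'}
    (ha : a 0 = 1) (hb : b 0 = 1) (hgen : Subgroup.closure (Set.range a) = ⊤)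
    (ρ : G × Bool → G' × Bool) (hρ : ∀ i x, ρ (groupAdj a i x) = groupAdj b i (ρ x))
    (h1 : ρ (1, false) = (1, false)) : ∃ θ : G →* G', ∀ i, θ (a i) = b i := by
  have step : ∀ i g, (ρ (g, false)).2 = false →
      ρ (g * a i, false) = ((ρ (g, false)).1 * b i, false) := by
    intro i g hg
    have h2 : (g * a i, false) = groupAdj a 0 (groupAdj a i (g, false)) := by
      simp [groupAdj, ha]
    have h3 : ρ (g, false) = ((ρ (g, false)).1, false) := Prod.ext rfl hg
    rw [h2, hρ, hρ, h3]
    simp [groupAdj, hb]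
  have step' : ∀ i g, (ρ (g, false)).2 = false →
      ρ (g * (a i)⁻¹, false) = ((ρ (g, false)).1 * (b i)⁻¹, false) := by
    intro i g hg
    have h2 : (g * (a i)⁻¹, false) = groupAdj a i (groupAdj a 0 (g, false)) := by
      simp [groupAdj, ha]
    have h3 : ρ (g, false) = ((ρ (g, false)).1, false) := Prod.ext rfl hg
    rw [h2, hρ, hρ, h3]
    simp [groupAdj, hb]
  have key : ∀ x, ∃ c, ∀ g, (ρ (g, false)).2 = false →
      ρ (g * x, false) = ((ρ (g, false)).1 * c, false) := by
    intro x
    have hx : x ∈ Subgroup.closure (Set.range a) := hgen ▸ Subgroup.mem_top x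
    induction hx using Subgroup.closure_induction_right with
    | one => exact ⟨1, fun g hg => by rw [mul_one, mul_one]; exact Prod.ext rfl hg⟩
    | mul_right x _ y hy ih =>
      obtain ⟨c, hc⟩ := ih
      obtain ⟨i, rfl⟩ := hy
      refine ⟨c * b i, fun g hg => ?_⟩
      rw [← mul_assoc, step i _ (by rw [hc g hg]), hc g hg, mul_assoc]
    | mul_inv_cancel x _ y hy ih =>
      obtain ⟨c, hc⟩ := ih
      obtain ⟨i, rfl⟩ := hy
      refine ⟨c * (b i)⁻¹, fun g hg => ?_⟩
      rw [← mul_assoc, step' i _ (by rw [hc g hg]), hc g hg, mul_assoc]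
  have heven : ∀ g, (ρ (g, false)).2 = false := by
    intro g
    obtain ⟨c, hc⟩ := key g
    have := hc 1 (by rw [h1])
    rw [one_mul] at this
    rw [this]
  refine ⟨{ toFun := fun g => (ρ (g, false)).1, map_one' := by rw [h1], map_mul' := ?_ }, ?_⟩
  · intro g x
    obtain ⟨c, hc⟩ := key x
    have h2 := hc 1 (by rw [h1])
    rw [h1, one_mul, one_mul] at h2
    rw [hc g (heven g), h2]
  · intro i
    have := step i 1 (by rw [h1])
    rw [one_mul, h1, one_mul] at this
    simp [this]

end groupAdj

/-- The flags of `X` correspond to `G × Bool` with adjacency maps `groupAdj a`, so that the base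
flag corresponds to `(1, false)` and `σ` acts as left multiplication by `f σ`. -/
def GroupModel {n : ℕ} (X : BasedPolytope.{u} n) {G : Type*} [Group G] (a : Fin n → G)
    (f : X.Aut ≃* G) : Prop :=
  ∃ e : Flag X.Face ≃ G × Bool, e X.baseFlag = (1, false) ∧
    (∀ i Φ, e (X.adj i Φ) = groupAdj a i (e Φ)) ∧
    ∀ (σ : X.Aut) (Φ : Flag X.Face), e (σ • Φ) = (f σ * (e Φ).1, (e Φ).2)

section GroupModel

open AbstractPolytope

variable {n : ℕ} {X Y : BasedPolytope.{u} n} {G : Type*} [Group G] {a b : Fin n → G}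

theorem GroupModel.flagModel {f : X.Aut ≃* G} (h : GroupModel X a f) :
    FlagModel X (groupAdj a) (1, false) := by
  obtain ⟨e, h1, h2, -⟩ := h
  exact FlagModel.iff_adj.2 ⟨e, h1, h2⟩

/-- In a chiral polytope, the flags in the orbit of the base flag and the flags in the orbit
of its `0`-adjacent flag make up all flags. -/
theorem exists_groupModel [NeZero n] (hX : X.IsChiral) (f : X.Aut ≃* G) :
    ∃ a : Fin n → G, a 0 = 1 ∧ GroupModel X a f := by
  obtain ⟨hcard, hadj⟩ := hX
  set Φ := X.baseFlag with hΦ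
  have hnot : ∀ (i : Fin n) (Ψ : Flag X.Face), X.adj i Ψ ∉ MulAction.orbit X.Aut Ψ :=
    fun i Ψ => hadj _ _ _ (X.flagAdj_adj i Ψ)
  have htwo : ∀ Ψ, Ψ ∉ MulAction.orbit X.Aut Φ → Ψ ∈ MulAction.orbit X.Aut (X.adj 0 Φ) := by
    intro Ψ hΨ
    let π : Flag X.Face → MulAction.orbitRel.Quotient X.Aut (Flag X.Face) := Quotient.mk _
    have hπ : ∀ A B, π A = π B ↔ A ∈ MulAction.orbit X.Aut B := fun A B => by
      rw [← MulAction.orbitRel_apply]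
      exact Quotient.eq
    obtain ⟨y, -, hy⟩ := (Nat.card_eq_two_iff' (π Φ)).1 hcard
    rw [← hπ]
    rw [← hπ] at hΨ
    have h2 : π (X.adj 0 Φ) ≠ π Φ := fun h => hnot 0 Φ ((hπ _ _).1 h)
    rw [hy _ hΨ, hy _ h2]
  let E : G × Bool → Flag X.Face := fun x => f.symm x.1 • (if x.2 then X.adj 0 Φ else Φ)
  have hEmul : ∀ g x, E (g * x.1, x.2) = f.symm g • E x := by
    intro g x
    simp only [E, map_mul, mul_smul]
  have hEf : ∀ g, E (g, false) = f.symm g • Φ := fun g => by simp [E]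
  have hEt : ∀ g, E (g, true) = f.symm g • X.adj 0 Φ := fun g => by simp [E]
  have hne : ∀ g h, E (g, false) ≠ E (h, true) := by
    intro g h he
    rw [hEf, hEt] at he
    refine hnot 0 Φ ⟨(f.symm h)⁻¹ * f.symm g, ?_⟩
    simp only [mul_smul, he, inv_smul_smul]
  have hbij : Function.Bijective E := by
    constructor
    · rintro ⟨g, _ | _⟩ ⟨h, _ | _⟩ he
      · rw [hEf, hEf] at he
        rw [f.symm.injective (smul_injective_of_flag he)]
      · exact absurd he (hne _ _)
      · exact absurd he.symm (hne _ _)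
      · rw [hEt, hEt] at he
        rw [f.symm.injective (smul_injective_of_flag he)]
    · intro Ψ
      by_cases hΨ : Ψ ∈ MulAction.orbit X.Aut Φ
      · obtain ⟨σ, rfl⟩ := hΨ
        exact ⟨(f σ, false), by simp [hEf]⟩
      · obtain ⟨σ, rfl⟩ := htwo Ψ hΨ
        exact ⟨(f σ, true), by simp [hEt]⟩
  let e := (Equiv.ofBijective E hbij).symm
  have heE : ∀ x, e (E x) = x := (Equiv.ofBijective E hbij).symm_apply_apply
  have hesmul : ∀ (σ : X.Aut) (Ψ : Flag X.Face), e (σ • Ψ) = (f σ * (e Ψ).1, (e Ψ).2) := by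
    intro σ Ψ
    obtain ⟨x, rfl⟩ := hbij.2 Ψ
    have := hEmul (f σ) x
    rw [f.symm_apply_apply] at this
    rw [← this, heE, heE]
  have hbase : e Φ = (1, false) := by
    rw [← heE (1, false), hEf, map_one, one_smul]
  have hbase' : e (X.adj 0 Φ) = (1, true) := by
    rw [← heE (1, true), hEt, map_one, one_smul]
  choose s hs using fun i => htwo (X.adj i Φ) (hnot i Φ)
  have hs' : ∀ i, e (X.adj i Φ) = (f (s i), true) := fun i => by
    have : s i • X.adj 0 Φ = X.adj i Φ := hs i
    rw [← this, hesmul, hbase', mul_one]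
  refine ⟨fun i => f (s i), ?_, e, hbase, ?_, hesmul⟩
  · have := hs' 0
    rw [hbase'] at this
    exact (congrArg Prod.fst this).symm
  · have hf : ∀ (i : Fin n) (σ : X.Aut), e (X.adj i (σ • Φ)) = (f σ * f (s i), true) := by
      intro i σ
      rw [← smul_adj, hesmul, hs']
    have hf' : ∀ i Ψ, (e Ψ).2 = false → e (X.adj i Ψ) = ((e Ψ).1 * f (s i), true) := by
      intro i Ψ h
      obtain ⟨⟨g, b⟩, rfl⟩ := hbij.2 Ψ
      rw [heE] at h ⊢
      simp only at h
      subst h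
      rw [hEf, hf, f.apply_symm_apply]
    intro i Ψ
    rcases hΨ : e Ψ with ⟨g, _ | _⟩
    · rw [hf' i Ψ (by rw [hΨ]), hΨ]
      rfl
    · have h1 : e (X.adj i (E (g * (f (s i))⁻¹, false))) = e Ψ := by
        rw [hf' _ _ (by rw [heE]), heE, hΨ]
        simp
      rw [← e.injective h1, X.adj_adj, heE]
      rfl

/-- An automorphism of `G` that inverts all `a i` maps the base flag to an adjacent one. -/
theorem FlagModel.not_isChiral [NeZero n] (h : FlagModel X (groupAdj a) (1, false)) (h0 : a 0 = 1)
    (θ : G ≃* G) (hθ : ∀ i, θ (a i) = (a i)⁻¹) : ¬ X.IsChiral := by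
  obtain ⟨e, he, hadj⟩ := FlagModel.iff_adj.1 h
  let ρ : G × Bool ≃ G × Bool := Equiv.prodCongr θ.toEquiv (Equiv.boolNot)
  have hρ : ∀ i x, ρ (groupAdj a i x) = groupAdj a i (ρ x) := by
    rintro i ⟨g, _ | _⟩ <;> simp [ρ, groupAdj, hθ]
  obtain ⟨E, hE⟩ := exists_orderIso_of_equiv (P := X.toAbstractPolytope)
    (Q := X.toAbstractPolytope) ((e.trans ρ).trans e.symm) (by
      intro i Φ
      simp only [Equiv.trans_apply]
      rw [Equiv.symm_apply_eq, hadj, hρ, hadj, e.apply_symm_apply])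
  rintro ⟨-, hc⟩
  refine hc _ _ _ (X.flagAdj_adj 0 X.baseFlag) ⟨E, ?_⟩
  change Flag.map E X.baseFlag = _
  rw [hE]
  simp only [Equiv.trans_apply]
  rw [Equiv.symm_apply_eq, hadj, he]
  simp [ρ, groupAdj, h0]

/-- If no endomorphism of `G` inverts all `a i`, every automorphism of the polytope acts
on the flags as a left multiplication. -/
theorem FlagModel.exists_groupModel [NeZero n] (h : FlagModel X (groupAdj a) (1, false))
    (h0 : a 0 = 1)
    (hθ : ¬ ∃ θ : G →* G, ∀ i, θ (a i) = (a i)⁻¹) :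
    X.IsChiral ∧ ∃ f : X.Aut ≃* G, GroupModel X a f := by
  have hgen := h.isPolytopal.closure_range
  obtain ⟨e, he, hadj⟩ := FlagModel.iff_adj.1 h
  have hL : ∀ g : G, ∃ σ : X.Aut, ∀ Φ : Flag X.Face, e (σ • Φ) = (g * (e Φ).1, (e Φ).2) := by
    intro g
    let ρ : G × Bool ≃ G × Bool := Equiv.prodCongr (Equiv.mulLeft g) (Equiv.refl _)
    obtain ⟨E, hE⟩ := exists_orderIso_of_equiv (P := X.toAbstractPolytope)
      (Q := X.toAbstractPolytope) ((e.trans ρ).trans e.symm) (by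
        intro i Φ
        simp only [Equiv.trans_apply]
        rw [Equiv.symm_apply_eq, hadj, hadj, e.apply_symm_apply]
        exact (groupAdj_mul i g (e Φ)).symm)
    refine ⟨E, fun Φ => ?_⟩
    change e (Flag.map E Φ) = _
    rw [hE]
    simp only [Equiv.trans_apply, Equiv.apply_symm_apply]
    rfl
  choose s hs using hL
  have heven : ∀ σ : X.Aut, (e (σ • X.baseFlag)).2 = false := by
    intro σ
    by_contra hodd
    rw [Bool.not_eq_false] at hodd
    -- After a translation, `σ` maps `(1, false)` to `(1, true)`; exchanging the two orbits in the
    -- target turns it into a map that yields an endomorphism inverting the `a i`.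
    let σ' := s (e (σ • X.baseFlag)).1⁻¹ * σ
    have hσ' : e (σ' • X.baseFlag) = (1, true) := by
      rw [mul_smul, hs, hodd, inv_mul_cancel]
    apply hθ
    refine exists_hom_of_groupAdj (b := fun i => (a i)⁻¹) h0 (by simp [h0]) hgen
      (fun x => ((e (σ' • e.symm x)).1, !(e (σ' • e.symm x)).2)) ?_ ?_
    · intro i x
      have h1 : e.symm (groupAdj a i x) = X.adj i (e.symm x) := by
        rw [Equiv.symm_apply_eq, hadj, e.apply_symm_apply]
      rw [h1, smul_adj, hadj]
      rcases e (σ' • e.symm x) with ⟨g, _ | _⟩ <;> simp [groupAdj]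
    · have h1 : e.symm (1, false) = X.baseFlag := by rw [Equiv.symm_apply_eq, he]
      simp only [h1, hσ', Bool.not_true]
  have hs1 : ∀ g, e (s g • X.baseFlag) = (g, false) := fun g => by rw [hs, he, mul_one]
  let S : G →* X.Aut := MonoidHom.mk' s fun g g' => by
    refine smul_injective_of_flag (Φ := X.baseFlag) (e.injective ?_)
    rw [mul_smul, hs1, hs, hs1]
  have hS : Function.Bijective S := by
    constructor
    · intro g g' hgg
      have := hs1 g
      change s g = s g' at hgg
      rw [hgg, hs1] at this
      exact (congrArg Prod.fst this).symm
    · intro σ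
      refine ⟨(e (σ • X.baseFlag)).1, smul_injective_of_flag (Φ := X.baseFlag) (e.injective ?_)⟩
      change e (s _ • _) = _
      rw [hs1, ← heven σ]
  let f := (MulEquiv.ofBijective S hS).symm
  have hf : ∀ (σ : X.Aut) (Φ : Flag X.Face), e (σ • Φ) = (f σ * (e Φ).1, (e Φ).2) := by
    intro σ Φ
    have : σ = s (f σ) := ((MulEquiv.ofBijective S hS).apply_symm_apply σ).symm
    rw [← hs, ← this]
  have horb : ∀ Φ Ψ : Flag X.Face, Φ ∈ MulAction.orbit X.Aut Ψ ↔ (e Φ).2 = (e Ψ).2 := by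
    intro Φ Ψ
    constructor
    · rintro ⟨σ, rfl⟩
      change (e (σ • Ψ)).2 = _
      rw [hf]
    · intro h
      refine ⟨f.symm ((e Φ).1 * (e Ψ).1⁻¹), e.injective ?_⟩
      change e (f.symm _ • Ψ) = _
      rw [hf, f.apply_symm_apply, inv_mul_cancel_right, ← h]
  refine ⟨⟨?_, ?_⟩, f, e, he, hadj, hf⟩
  · let π : MulAction.orbitRel.Quotient X.Aut (Flag X.Face) → Bool :=
      Quotient.lift (fun Φ => (e Φ).2) fun Φ Ψ h => (horb Φ Ψ).1 h
    have hπ : Function.Bijective π := by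
      constructor
      · rintro ⟨Φ⟩ ⟨Ψ⟩ h
        exact Quotient.sound ((horb Φ Ψ).2 h)
      · intro b
        exact ⟨Quotient.mk _ (e.symm (1, b)), by simp [π]⟩
    rw [Nat.card_congr (Equiv.ofBijective π hπ)]
    simp
  · intro i Φ Ψ hΦΨ
    obtain ⟨j, rfl⟩ := X.exists_fin_of_flagAdj hΦΨ
    obtain rfl := X.flagAdj_iff.1 hΦΨ
    rw [horb, hadj, groupAdj_snd]
    simp

/-- The `i`-th distinguished generator corresponds to `a i * (a (i - 1))⁻¹`. -/
theorem GroupModel.isDistinguished_iff {f : X.Aut ≃* G} (h : GroupModel X a f) {i j : Fin n}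
    (hij : (j : ℕ) = i + 1) {σ : X.Aut} :
    X.IsDistinguished X.baseFlag (j : ℕ) σ ↔ f σ = a j * (a i)⁻¹ := by
  obtain ⟨e, he, hadj, hf⟩ := h
  have hi : ((j : ℕ) : ℤ) - 1 = ((i : ℕ) : ℤ) := by omega
  unfold AbstractPolytope.IsDistinguished
  rw [hi]
  have h1 : ∀ Ψ, (FlagAdj X.rank (j : ℕ) X.baseFlag Ψ ∧ FlagAdj X.rank (i : ℕ) Ψ (σ • X.baseFlag)) ↔
      (Ψ = X.adj j X.baseFlag ∧ σ • X.baseFlag = X.adj i Ψ) := fun Ψ => by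
    rw [X.flagAdj_iff, X.flagAdj_iff]
  simp only [h1, exists_eq_left]
  rw [← e.apply_eq_iff_eq, hf, hadj, hadj, he]
  simp [groupAdj]

theorem GroupModel.map_mem_parabolic {f : X.Aut ≃* G} (h : GroupModel X a f) {i j k : Fin n}
    (hij : (j : ℕ) = i + 1) (hjk : (k : ℕ) = j + 1) {H : Subgroup G} :
    (∀ σ ∈ X.parabolic X.baseFlag (j : ℕ) (k : ℕ), f σ ∈ H) ↔
      a j * (a i)⁻¹ ∈ H ∧ a k * (a j)⁻¹ ∈ H := by
  constructor
  · intro hH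
    constructor
    · have := hH (f.symm (a j * (a i)⁻¹)) (Subgroup.subset_closure
        (Or.inl ((h.isDistinguished_iff hij).2 (f.apply_symm_apply _))))
      rwa [f.apply_symm_apply] at this
    · have := hH (f.symm (a k * (a j)⁻¹)) (Subgroup.subset_closure
        (Or.inr ((h.isDistinguished_iff hjk).2 (f.apply_symm_apply _))))
      rwa [f.apply_symm_apply] at this
  · rintro ⟨h1, h2⟩
    have : X.parabolic X.baseFlag (j : ℕ) (k : ℕ) ≤ H.comap f.toMonoidHom := by
      refine (Subgroup.closure_le _).2 ?_
      rintro σ (hσ | hσ)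
      · rw [h.isDistinguished_iff hij] at hσ
        change f σ ∈ H
        rwa [hσ]
      · rw [h.isDistinguished_iff hjk] at hσ
        change f σ ∈ H
        rwa [hσ]
    exact this

theorem FlagModel.map_groupAdj {G' : Type*} [Group G'] (h : FlagModel X (groupAdj a) (1, false))
    (θ : G ≃* G') : FlagModel X (groupAdj fun i => θ (a i)) (1, false) := by
  have := h.transport (r' := groupAdj fun i => θ (a i))
    (Equiv.prodCongr θ.toEquiv (Equiv.refl _)) (by
      rintro i ⟨g, _ | _⟩ <;> simp [groupAdj])
  simpa using this

theorem FlagModel.exists_hom [NeZero n] {G' : Type*} [Group G'] {b : Fin n → G'}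
    (h : FlagModel X (groupAdj a) (1, false)) (h' : FlagModel X (groupAdj b) (1, false))
    (ha : a 0 = 1) (hb : b 0 = 1) : ∃ θ : G →* G', ∀ i, θ (a i) = b i := by
  have hgen := h.isPolytopal.closure_range
  obtain ⟨e, he, hadj⟩ := FlagModel.iff_adj.1 h
  obtain ⟨e', he', hadj'⟩ := FlagModel.iff_adj.1 h'
  refine exists_hom_of_groupAdj ha hb hgen (fun x => e' (e.symm x)) (fun i x => ?_) ?_
  · rw [← hadj']
    congr 1
    rw [Equiv.symm_apply_eq, hadj, e.apply_symm_apply]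
  · rw [← he', ← he, e.symm_apply_apply]

end GroupModel

/-! ### The type of a polytope with two flag orbits -/

section HasType

open AbstractPolytope

variable {n : ℕ} {X : BasedPolytope.{u} n} {G : Type*} [Group G] {a : Fin n → G}

/-- Among the faces of a flag in rank `i`, those of the flags `(g * s ^ m, false)` with
`s = a (i + 1) * (a i)⁻¹` run through all the vertices of the corresponding `2`-dimensional
section exactly once. -/
theorem FlagModel.hasType [Finite G] (h : FlagModel X (groupAdj a) (1, false)) :
    X.HasType fun i => orderOf (a ⟨i + 1, by omega⟩ * (a ⟨i, by omega⟩)⁻¹) := by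
  obtain ⟨e, -, hadj⟩ := FlagModel.iff_adj.1 h
  intro i F K hFK hF hK
  refine ⟨orderOf_pos _, ?_⟩
  set i0 : Fin n := ⟨i, by omega⟩ with hi0
  set i1 : Fin n := ⟨i + 1, by omega⟩ with hi1
  set s := a i1 * (a i0)⁻¹ with hs
  obtain ⟨Φ, hFΦ, hKΦ, hΦ⟩ : ∃ Φ : Flag X.Face, F ∈ Φ ∧ K ∈ Φ ∧ (e Φ).2 = false := by
    obtain ⟨Φ, hFΦ, hKΦ⟩ := Flag.exists_mem_mem hFK
    cases hΦ : (e Φ).2 with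
    | false => exact ⟨Φ, hFΦ, hKΦ, hΦ⟩
    | true =>
      refine ⟨X.adj i0 Φ, (X.mem_adj ?_).2 hFΦ, (X.mem_adj ?_).2 hKΦ, ?_⟩
      · rw [hF, hi0]; simp only; omega
      · rw [hK, hi0]; simp only; omega
      · rw [hadj, groupAdj_snd, hΦ]; rfl
  obtain ⟨g, hg⟩ : ∃ g, e Φ = (g, false) := ⟨(e Φ).1, Prod.ext rfl hΦ⟩
  let Ψ : G → Flag X.Face := fun x => e.symm (g * x, false)
  have hadj' : ∀ j x, e.symm (groupAdj a j x) = X.adj j (e.symm x) := fun j x => by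
    rw [Equiv.symm_apply_eq, hadj, e.apply_symm_apply]
  -- The flags obtained from `Φ` by changing faces of ranks `i` and `i + 1`.
  have hmem : ∀ Δ, FlagConn X.adj {i0, i1} Φ Δ →
      ∃ x ∈ Subgroup.zpowers s, Δ = Ψ x ∨ Δ = X.adj i1 (Ψ x) := by
    intro Δ hΔ
    induction hΔ with
    | refl => exact ⟨1, one_mem _, Or.inl (by simp [Ψ, ← hg])⟩
    | tail _ hst ih =>
      obtain ⟨j, hj, rfl⟩ := hst
      obtain ⟨x, hx, hx'⟩ := ih
      have hsm : s ∈ Subgroup.zpowers s := Subgroup.mem_zpowers s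
      rcases hj with rfl | hj
      · rcases hx' with rfl | rfl
        · refine ⟨x * s⁻¹, mul_mem hx (inv_mem hsm), Or.inr ?_⟩
          simp only [Ψ, ← hadj']
          simp [groupAdj, hs, mul_assoc]
        · refine ⟨x * s, mul_mem hx hsm, Or.inl ?_⟩
          simp only [Ψ, ← hadj']
          simp [groupAdj, hs, mul_assoc]
      · obtain rfl : j = i1 := hj
        rcases hx' with rfl | rfl
        · exact ⟨x, hx, Or.inr rfl⟩
        · exact ⟨x, hx, Or.inl (X.adj_adj _ _)⟩
  have hconn : ∀ x ∈ Subgroup.zpowers s, FlagConn X.adj {i0, i1} Φ (Ψ x) := by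
    intro x hx
    have h1 : x ∈ quotientSubgroup a {i0, i1} := by
      refine (Subgroup.zpowers_le.2 ?_) hx
      exact mul_inv_mem_quotientSubgroup (by simp) (by simp)
    have h2 := (flagConn_groupAdj (g := g) (h := g * x)).2 (by simpa using h1)
    have h3 := h2.map e.symm hadj'
    rwa [← hg, e.symm_apply_apply] at h3
  have hFm : ∀ Δ, FlagConn X.adj {i0, i1} Φ Δ → F ∈ Δ := fun Δ hΔ =>
    mem_of_flagConn hΔ (by
      rintro j (rfl | hj)
      · simp only [hF, hi0]; omega
      · rw [Set.mem_singleton_iff.1 hj]; simp only [hF, hi1]; push_cast; omega) hFΦ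
  have hKm : ∀ Δ, FlagConn X.adj {i0, i1} Φ Δ → K ∈ Δ := fun Δ hΔ =>
    mem_of_flagConn hΔ (by
      rintro j (rfl | hj)
      · simp only [hK, hi0]; omega
      · rw [Set.mem_singleton_iff.1 hj]; simp only [hK, hi1]; push_cast; omega) hKΦ
  have hface : ∀ x, ∃ A, A ∈ Ψ x ∧ X.rank A = (i : ℕ) := fun x =>
    X.exists_mem_flag (Ψ x) (i := (i : ℕ)) (by omega) (by omega)
  choose A hA hAi using hface
  have hlt : ∀ x ∈ Subgroup.zpowers s, F < A x ∧ A x < K ∧ X.rank (A x) = (i : ℕ) := fun x hx =>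
    ⟨X.lt_of_mem_flag (hFm _ (hconn x hx)) (hA x) (by rw [hF, hAi]; omega),
      X.lt_of_mem_flag (hA x) (hKm _ (hconn x hx)) (by rw [hK, hAi]; omega), hAi x⟩
  change _ = orderOf s
  rw [← Nat.card_zpowers]
  symm
  refine Nat.card_congr (Equiv.ofBijective (fun x : Subgroup.zpowers s =>
    (⟨A x, hlt x x.2⟩ : {y : X.Face // F < y ∧ y < K ∧ X.rank y = (i : ℕ)})) ⟨?_, ?_⟩)
  · rintro ⟨x, hx⟩ ⟨y, hy⟩ hxy
    have hxy' : A x = A y := congrArg Subtype.val hxy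
    have h1 : FlagConn X.adj {i1} (Ψ x) (Ψ y) := by
      have : ({i1}ᶜᶜ : Set (Fin n)) = {i1} := compl_compl _
      rw [← this]
      refine flagConn_of_mem fun j hj => ?_
      by_cases hji : j = i0
      · exact ⟨A x, by rw [hAi, hji], hA x, hxy' ▸ hA y⟩
      · obtain ⟨B, hB, hBj⟩ := X.exists_mem_flag Φ (i := (j : ℕ)) (by omega) (by omega)
        have hBm : ∀ Δ, FlagConn X.adj {i0, i1} Φ Δ → B ∈ Δ := fun Δ hΔ =>
          mem_of_flagConn hΔ (by
            rintro k hk hk'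
            have : k = j := Fin.ext (by omega)
            rcases hk with hk | hk
            · exact hji (this ▸ hk)
            · exact hj (this ▸ hk)) hB
        exact ⟨B, hBj, hBm _ (hconn x hx), hBm _ (hconn y hy)⟩
    rcases h1.eq_or_eq X.adj_adj with h2 | h2
    · have := e.symm.injective h2
      simp only [Prod.mk.injEq, mul_right_inj, and_true] at this
      exact Subtype.ext this.symm
    · exfalso
      simp only [Ψ, ← hadj'] at h2
      have := e.symm.injective h2
      simp [groupAdj] at this
  · rintro ⟨B, hFB, hBK, hB⟩
    have hchain : IsChain (· ≤ ·) (insert B {C | C ∈ Φ ∧ (C ≤ F ∨ K ≤ C)}) := by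
      refine IsChain.insert (fun C hC D hD hne => Φ.chain_le hC.1 hD.1 hne) ?_
      rintro C ⟨hC, hC' | hC'⟩ -
      · exact Or.inr (hC'.trans hFB.le)
      · exact Or.inl (hBK.le.trans hC')
    obtain ⟨Δ, hΔ⟩ := hchain.exists_subset_flag
    have hBΔ : B ∈ Δ := hΔ (Set.mem_insert _ _)
    have hc : FlagConn X.adj {i0, i1} Φ Δ := by
      have : ({i0, i1}ᶜᶜ : Set (Fin n)) = {i0, i1} := compl_compl _
      rw [← this]
      refine flagConn_of_mem fun j hj => ?_
      have hj0 : (j : ℕ) ≠ i := fun h => hj (Or.inl (Fin.ext h))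
      have hj1 : (j : ℕ) ≠ i + 1 := fun h => hj (Or.inr (Fin.ext h))
      obtain ⟨C, hC, hCj⟩ := X.exists_mem_flag Φ (i := (j : ℕ)) (by omega) (by omega)
      refine ⟨C, hCj, hC, hΔ (Set.mem_insert_of_mem _ ⟨hC, ?_⟩)⟩
      rcases lt_or_ge (j : ℕ) (i : ℕ) with h | h
      · exact Or.inl (X.le_of_mem_flag hC hFΦ (by omega))
      · exact Or.inr (X.le_of_mem_flag hKΦ hC (by omega))
    obtain ⟨x, hx, hx'⟩ := hmem Δ hc
    refine ⟨⟨x, hx⟩, Subtype.ext ?_⟩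
    refine X.eq_of_mem_flag (hA x) ?_ (by rw [hAi, hB])
    rcases hx' with rfl | rfl
    · exact hBΔ
    · refine (X.mem_adj ?_).1 hBΔ
      rw [hB, hi1]; simp only; push_cast; omega

theorem AbstractPolytope.HasType.unique {P : AbstractPolytope.{u} n} {p p' : Fin (n - 1) → ℕ}
    (h : P.HasType p) (h' : P.HasType p') : p = p' := by
  funext i
  obtain ⟨Φ⟩ : Nonempty (Flag P.Face) := inferInstance
  obtain ⟨F, hF, hFi⟩ := P.exists_mem_flag Φ (i := (i : ℤ) - 1) (by omega) (by omega)
  obtain ⟨K, hK, hKi⟩ := P.exists_mem_flag Φ (i := (i : ℤ) + 2) (by omega) (by omega)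
  have hle := P.le_of_mem_flag hF hK (by omega)
  rw [← (h i F K hle hFi hKi).2, (h' i F K hle hFi hKi).2]

end HasType

/-! ### The intersection property in rank four -/

/-- In a group generated by an element `s` and an involution `t` inverting it, every element
outside the powers of `s` becomes a power of `s` when multiplied with `t`. -/
theorem mem_or_mul_mem_zpowers_of_mem_closure {G : Type*} [Group G] {s t : G} (ht : t * t = 1)
    (hst : t * s * t = s⁻¹) {T : Set G}
    (hT : ∀ y ∈ T, y ∈ Subgroup.zpowers s ∨ y * t ∈ Subgroup.zpowers s) {x : G}
    (hx : x ∈ Subgroup.closure T) : x ∈ Subgroup.zpowers s ∨ x * t ∈ Subgroup.zpowers s := by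
  have hconj : ∀ y ∈ Subgroup.zpowers s, t * y * t ∈ Subgroup.zpowers s := by
    have htinv : t⁻¹ = t := inv_eq_of_mul_eq_one_right ht
    rintro _ ⟨m, rfl⟩
    refine ⟨-m, ?_⟩
    have : t * s ^ m * t = (t * s * t) ^ m := by
      have := conj_zpow (i := m) (a := t) (b := s)
      rw [htinv] at this
      exact this.symm
    simp only [this, hst, zpow_neg, inv_zpow']
  have hcancel : ∀ y, y * t * t = y := fun y => by rw [mul_assoc, ht, mul_one]
  have hcancel' : ∀ y, t * (t * y) = y := fun y => by rw [← mul_assoc, ht, one_mul]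
  induction hx using Subgroup.closure_induction with
  | mem y hy => exact hT y hy
  | one => exact Or.inl (one_mem _)
  | mul x y _ _ hx hy =>
    rcases hx with hx | hx <;> rcases hy with hy | hy
    · exact Or.inl (mul_mem hx hy)
    · exact Or.inr (by rw [mul_assoc]; exact mul_mem hx hy)
    · refine Or.inr ?_
      have := mul_mem hx (hconj y hy)
      simpa only [mul_assoc, hcancel'] using this
    · refine Or.inl ?_
      have := mul_mem hx (hconj _ hy)
      simpa only [mul_assoc, hcancel', ht, mul_one] using this
  | inv x _ hx =>
    rcases hx with hx | hx
    · exact Or.inl (inv_mem hx)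
    · refine Or.inr ?_
      have htinv : t⁻¹ = t := inv_eq_of_mul_eq_one_right ht
      have := hconj _ (inv_mem hx)
      simpa only [mul_inv_rev, htinv, mul_assoc, hcancel'] using this

/-- In rank four, the intersection property of all the subgroups follows from that of the
stabilizers of the base vertex and of the base facet and of the cyclic subgroups. -/
theorem isPolytopal_groupAdj_four {G : Type*} [Group G] {a : Fin 4 → G} (h0 : a 0 = 1)
    (h2 : a 2 * a 2 = 1) (h3 : a 3 * a 3 = 1) (h13 : a 3 * (a 1)⁻¹ = a 1 * (a 3)⁻¹)
    (hgen : Subgroup.closure (Set.range a) = ⊤)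
    (hs1 : a 1 ≠ 1) (hs2 : a 2 * (a 1)⁻¹ ≠ 1) (hs3 : a 3 * (a 2)⁻¹ ≠ 1)
    (h1v : ∀ x ∈ Subgroup.zpowers (a 1), x ∈ quotientSubgroup a {0}ᶜ → x = 1)
    (h3f : ∀ x ∈ Subgroup.zpowers (a 3 * (a 2)⁻¹), x ∈ quotientSubgroup a {3}ᶜ → x = 1)
    (hvf : ∀ x ∈ quotientSubgroup a {0}ᶜ, x ∈ quotientSubgroup a {3}ᶜ →
      x ∈ Subgroup.zpowers (a 2 * (a 1)⁻¹)) : IsPolytopal (groupAdj a) := by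
  have i2 : (a 2)⁻¹ = a 2 := inv_eq_of_mul_eq_one_right h2
  have i3 : (a 3)⁻¹ = a 3 := inv_eq_of_mul_eq_one_right h3
  set s3 := a 3 * (a 2)⁻¹ with hs3d
  have q : ∀ {K : Set (Fin 4)} (i j : Fin 4) (_ : i ∉ K) (_ : j ∉ K),
      a i * (a j)⁻¹ ∈ quotientSubgroup a Kᶜ := fun {K} i j hi hj =>
    mul_inv_mem_quotientSubgroup (J := Kᶜ) hi hj
  have q0 : ∀ {K : Set (Fin 4)} (i : Fin 4) (_ : i ∉ K) (_ : (0 : Fin 4) ∉ K),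
      a i ∈ quotientSubgroup a Kᶜ := fun {K} i hi h => by
    simpa [h0] using q i 0 hi h
  have hle : ∀ J : Set (Fin 4), quotientSubgroup a J ≤ Subgroup.closure (a '' J) := by
    intro J
    refine (Subgroup.closure_le _).2 ?_
    rintro _ ⟨i, hi, j, hj, rfl⟩
    exact mul_mem (Subgroup.subset_closure ⟨i, hi, rfl⟩)
      (inv_mem (Subgroup.subset_closure ⟨j, hj, rfl⟩))
  -- The stabilizers of the base edge and of the base ridge are dihedral.
  have hH1 : ∀ x ∈ quotientSubgroup a {1}ᶜ,
      x ∈ Subgroup.zpowers s3 ∨ x * a 2 ∈ Subgroup.zpowers s3 := by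
    intro x hx
    refine mem_or_mul_mem_zpowers_of_mem_closure h2 ?_ ?_ (hle _ hx)
    · rw [hs3d, mul_inv_rev, inv_inv, i3, mul_assoc, inv_mul_cancel_right]
    · rintro _ ⟨i, hi, rfl⟩
      fin_cases i
      · exact Or.inl (by simp [h0])
      · exact absurd rfl hi
      · exact Or.inr (by simp [h2])
      · refine Or.inr ?_
        have : a 3 * a 2 = s3 := by rw [hs3d, i2]
        simp [this]
  have hH2 : ∀ x ∈ quotientSubgroup a {2}ᶜ,
      x ∈ Subgroup.zpowers (a 1) ∨ x * a 3 ∈ Subgroup.zpowers (a 1) := by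
    intro x hx
    refine mem_or_mul_mem_zpowers_of_mem_closure h3 ?_ ?_ (hle _ hx)
    · have h13' : a 3 * (a 1)⁻¹ = a 1 * a 3 := by rw [h13, i3]
      rw [mul_assoc, ← h13', ← mul_assoc, h3, one_mul]
    · rintro _ ⟨i, hi, rfl⟩
      fin_cases i
      · exact Or.inl (by simp [h0])
      · exact Or.inl (by simp)
      · exact absurd rfl hi
      · exact Or.inr (by simp [h3])
  have z1f : ∀ x ∈ Subgroup.zpowers (a 1), x ∈ quotientSubgroup a {3}ᶜ := fun x hx =>
    Subgroup.zpowers_le.2 (q0 1 (by simp) (by simp)) hx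
  have z3v : ∀ x ∈ Subgroup.zpowers s3, x ∈ quotientSubgroup a {0}ᶜ := fun x hx =>
    Subgroup.zpowers_le.2 (q 3 2 (by simp) (by simp)) hx
  have a1H0 : a 1 ∉ quotientSubgroup a {0}ᶜ := fun h =>
    hs1 (h1v _ (Subgroup.mem_zpowers _) h)
  have a2H0 : a 2 ∉ quotientSubgroup a {0}ᶜ := fun h => a1H0 (by
    have h' := mul_mem (inv_mem (q (K := {0}) 2 1 (by simp) (by simp))) h
    simpa using h')
  have a3H3 : a 3 ∉ quotientSubgroup a {3}ᶜ := fun h =>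
    hs3 (h3f _ (Subgroup.mem_zpowers _) (mul_mem h (inv_mem (q0 2 (by simp) (by simp)))))
  have a2H3 : a 2 ∈ quotientSubgroup a {3}ᶜ := q0 2 (by simp) (by simp)
  have a3H1 : a 3 ∈ quotientSubgroup a {1}ᶜ := q0 3 (by simp) (by simp)
  have p01 : ∀ x ∈ quotientSubgroup a {0}ᶜ, x ∈ quotientSubgroup a {1}ᶜ →
      x ∈ Subgroup.zpowers s3 := by
    intro x hx hx'
    rcases hH1 x hx' with h | h
    · exact h
    · refine absurd ?_ a2H0
      simpa using mul_mem (inv_mem hx) (z3v _ h)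
  have p02 : ∀ x ∈ quotientSubgroup a {0}ᶜ, x ∈ quotientSubgroup a {2}ᶜ →
      x = 1 ∨ x = a 1 * (a 3)⁻¹ := by
    intro x hx hx'
    rcases hH2 x hx' with h | h
    · exact Or.inl (h1v x h hx)
    · refine Or.inr ?_
      have h4 : x * (a 3 * (a 1)⁻¹) = 1 := by
        refine h1v _ ?_ (mul_mem hx (q 3 1 (by simp) (by simp)))
        rw [← mul_assoc]
        exact mul_mem h (inv_mem (Subgroup.mem_zpowers _))
      rw [eq_inv_of_mul_eq_one_left h4, mul_inv_rev, inv_inv]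
  have p12 : ∀ x ∈ quotientSubgroup a {1}ᶜ, x ∈ Subgroup.zpowers (a 1) → x = 1 := by
    intro x hx hx'
    rcases hH1 x hx with h | h
    · exact h3f x h (z1f x hx')
    · have h4 := h3f _ h (mul_mem (z1f x hx') a2H3)
      have h5 : x = a 2 := by rw [eq_inv_of_mul_eq_one_left h4, i2]
      refine absurd (h1v (a 2 * (a 1)⁻¹) ?_ (q 2 1 (by simp) (by simp))) hs2
      rw [← h5]
      exact mul_mem hx' (inv_mem (Subgroup.mem_zpowers _))
  have p13 : ∀ x ∈ quotientSubgroup a {1}ᶜ, x ∈ quotientSubgroup a {3}ᶜ →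
      x = 1 ∨ x = a 2 := by
    intro x hx hx'
    rcases hH1 x hx with h | h
    · exact Or.inl (h3f x h hx')
    · have h4 := h3f _ h (mul_mem hx' a2H3)
      exact Or.inr (by rw [eq_inv_of_mul_eq_one_left h4, i2])
  have p23 : ∀ x ∈ quotientSubgroup a {2}ᶜ, x ∈ quotientSubgroup a {3}ᶜ →
      x ∈ Subgroup.zpowers (a 1) := by
    intro x hx hx'
    rcases hH2 x hx with h | h
    · exact h
    · refine absurd ?_ a3H3
      simpa using mul_mem (inv_mem hx') (z1f _ h)
  refine isPolytopal_groupAdj h0 ?_ ⟨1, by simp, a1H0⟩ ?_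
  · intro i j hij
    obtain ⟨rfl, rfl⟩ | ⟨rfl, rfl⟩ | ⟨rfl, rfl⟩ : (i = 0 ∧ j = 2) ∨ (i = 0 ∧ j = 3) ∨
        (i = 1 ∧ j = 3) := by
      have := j.2
      simp only [Fin.ext_iff, Fin.val_zero, Fin.val_one, Fin.val_two,
        show ((3 : Fin 4) : ℕ) = 3 from rfl]
      omega
    · simp [h0, i2]
    · simp [h0, i3]
    · exact h13
  intro K hK x hx
  have m1 : ∀ k : Fin 4, K ⊆ {k} → k ∈ K → x ∈ quotientSubgroup a Kᶜ := by
    intro k hk hkK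
    exact quotientSubgroup_mono (Set.compl_subset_compl.2 hk) (hx k hkK)
  have mz : ∀ (i j : Fin 4) (_ : i ∉ K) (_ : j ∉ K),
      x ∈ Subgroup.zpowers (a i * (a j)⁻¹) → x ∈ quotientSubgroup a Kᶜ := fun i j hi hj h =>
    Subgroup.zpowers_le.2 (q i j hi hj) h
  have mone : x = 1 → x ∈ quotientSubgroup a Kᶜ := fun h => h ▸ one_mem _
  by_cases k0 : (0 : Fin 4) ∈ K <;> by_cases k1 : (1 : Fin 4) ∈ K <;>
    by_cases k2 : (2 : Fin 4) ∈ K <;> by_cases k3 : (3 : Fin 4) ∈ K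
  · refine absurd (Set.eq_univ_of_forall fun i => ?_) hK
    fin_cases i <;> assumption
  · refine mone ?_
    rcases p02 x (hx 0 k0) (hx 2 k2) with h | h
    · exact h
    · refine absurd (p12 (a 1) ?_ (Subgroup.mem_zpowers _)) hs1
      have := mul_mem (hx 1 k1) a3H1
      simpa [h] using this
  · exact mone (h3f x (p01 x (hx 0 k0) (hx 1 k1)) (hx 3 k3))
  · exact mz 3 2 k3 k2 (p01 x (hx 0 k0) (hx 1 k1))
  · exact mone (h1v x (p23 x (hx 2 k2) (hx 3 k3)) (hx 0 k0))
  · rcases p02 x (hx 0 k0) (hx 2 k2) with h | h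
    · exact mone h
    · exact h ▸ q 1 3 k1 k3
  · exact mz 2 1 k2 k1 (hvf x (hx 0 k0) (hx 3 k3))
  · refine m1 0 (fun i hi => ?_) k0
    fin_cases i <;> first | rfl | contradiction
  · exact mone (p12 x (hx 1 k1) (p23 x (hx 2 k2) (hx 3 k3)))
  · rcases hH2 x (hx 2 k2) with h | h
    · exact mone (p12 x (hx 1 k1) h)
    · have h4 := p12 _ (mul_mem (hx 1 k1) a3H1) h
      rw [eq_inv_of_mul_eq_one_left h4, i3]
      exact q0 3 k3 k0
  · rcases p13 x (hx 1 k1) (hx 3 k3) with h | h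
    · exact mone h
    · exact h ▸ q0 2 k2 k0
  · refine m1 1 (fun i hi => ?_) k1
    fin_cases i <;> first | rfl | contradiction
  · refine mz 1 0 k1 k0 ?_
    simpa [h0] using p23 x (hx 2 k2) (hx 3 k3)
  · refine m1 2 (fun i hi => ?_) k2
    fin_cases i <;> first | rfl | contradiction
  · refine m1 3 (fun i hi => ?_) k3
    fin_cases i <;> first | rfl | contradiction
  · have hx' : x ∈ Subgroup.closure (Set.range a) := hgen ▸ Subgroup.mem_top x
    refine (Subgroup.closure_le _).2 ?_ hx'
    rintro _ ⟨i, rfl⟩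
    refine q0 i ?_ k0
    fin_cases i <;> assumption

/-! ### Calculations in `PGL(2, F)` -/

section PGL

open Matrix Projectivization

variable {F : Type v} [Field F]

/-- The class in `PGL(2, F)` of the matrix with rows `(x, y)` and `(z, w)`, and `1` if this matrix
is singular. -/
noncomputable def pgl (x y z w : F) : PGL(Fin 2, F) :=
  open scoped Classical in
  if h : x * w - y * z ≠ 0 then
    ProjGenLinGroup.mk (GeneralLinearGroup.mkOfDetNeZero !![x, y; z, w] (by rwa [det_fin_two_of]))
  else 1

theorem pgl_of_ne {x y z w : F} (h : x * w - y * z ≠ 0) : pgl x y z w =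
    ProjGenLinGroup.mk
      (GeneralLinearGroup.mkOfDetNeZero !![x, y; z, w] (by rwa [det_fin_two_of])) := by
  rw [pgl, dif_pos h]

theorem exists_eq_pgl (g : PGL(Fin 2, F)) :
    ∃ x y z w : F, x * w - y * z ≠ 0 ∧ g = pgl x y z w := by
  induction g using ProjGenLinGroup.induction_on with
  | mk g =>
    have h : g.1 0 0 * g.1 1 1 - g.1 0 1 * g.1 1 0 ≠ 0 := by
      rw [← det_fin_two]
      exact GeneralLinearGroup.det_ne_zero g
    refine ⟨_, _, _, _, h, ?_⟩
    rw [pgl_of_ne h]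
    congr 1
    apply Units.ext
    exact eta_fin_two g.1

theorem pgl_eq_pgl_iff {x y z w x' y' z' w' : F} (h : x * w - y * z ≠ 0)
    (h' : x' * w' - y' * z' ≠ 0) : pgl x y z w = pgl x' y' z' w' ↔
      ∃ c ≠ 0, x' = c * x ∧ y' = c * y ∧ z' = c * z ∧ w' = c * w := by
  rw [pgl_of_ne h, pgl_of_ne h', ProjGenLinGroup.mk_eq_mk_iff]
  have key : ∀ c : F, !![x, y; z, w] * Matrix.scalar (Fin 2) c = !![x', y'; z', w'] ↔
      x' = c * x ∧ y' = c * y ∧ z' = c * z ∧ w' = c * w := by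
    intro c
    rw [← Matrix.ext_iff]
    simp [Fin.forall_fin_two, Matrix.mul_apply, mul_comm, eq_comm, and_assoc]
  constructor
  · rintro ⟨c, hc⟩
    refine ⟨c, c.ne_zero, (key c).1 ?_⟩
    exact congrArg Units.val hc
  · rintro ⟨c, hc, h⟩
    refine ⟨Units.mk0 c hc, Units.ext ?_⟩
    exact (key c).2 h

theorem pgl_mul {x y z w x' y' z' w' : F} (h : x * w - y * z ≠ 0)
    (h' : x' * w' - y' * z' ≠ 0) : pgl x y z w * pgl x' y' z' w' =
      pgl (x * x' + y * z') (x * y' + y * w') (z * x' + w * z') (z * y' + w * w') := by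
  have h'' : (x * x' + y * z') * (z * y' + w * w') - (x * y' + y * w') * (z * x' + w * z') ≠ 0 := by
    have := mul_ne_zero h h'
    rwa [show (x * x' + y * z') * (z * y' + w * w') - (x * y' + y * w') * (z * x' + w * z') =
      (x * w - y * z) * (x' * w' - y' * z') by ring]
  rw [pgl_of_ne h, pgl_of_ne h', pgl_of_ne h'', ← map_mul]
  congr 1
  apply Units.ext
  change !![x, y; z, w] * !![x', y'; z', w'] = _
  rw [mul_fin_two]
  rfl

theorem pgl_mul_eq {x y z w x' y' z' w' x'' y'' z'' w'' : F} (c : F) (hc : c ≠ 0)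
    (h : x * w - y * z ≠ 0) (h' : x' * w' - y' * z' ≠ 0)
    (h1 : x * x' + y * z' = c * x'') (h2 : x * y' + y * w' = c * y'')
    (h3 : z * x' + w * z' = c * z'') (h4 : z * y' + w * w' = c * w'') :
    pgl x y z w * pgl x' y' z' w' = pgl x'' y'' z'' w'' := by
  have hd : c * x'' * (c * w'') - c * y'' * (c * z'') ≠ 0 := by
    rw [← h1, ← h2, ← h3, ← h4]
    have := mul_ne_zero h h'
    rwa [show (x * x' + y * z') * (z * y' + w * w') - (x * y' + y * w') * (z * x' + w * z') =
      (x * w - y * z) * (x' * w' - y' * z') by ring]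
  have hd' : x'' * w'' - y'' * z'' ≠ 0 := by
    intro h0
    apply hd
    linear_combination c ^ 2 * h0
  rw [pgl_mul h h', h1, h2, h3, h4]
  exact ((pgl_eq_pgl_iff hd' hd).2 ⟨c, hc, rfl, rfl, rfl, rfl⟩).symm

theorem pgl_one : pgl (1 : F) 0 0 1 = 1 := by
  rw [pgl_of_ne (by simp)]
  refine (congrArg _ (Units.ext ?_)).trans (map_one _)
  exact one_fin_two.symm

theorem pgl_scalar (x : F) : pgl x 0 0 x = 1 := by
  by_cases hx : x = 0
  · simp [pgl, hx]
  · rw [← pgl_one, eq_comm, pgl_eq_pgl_iff (by simp) (by simpa using hx)]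
    exact ⟨x, hx, by simp⟩

theorem pgl_smul {c : F} (hc : c ≠ 0) {x y z w : F} (h : x * w - y * z ≠ 0) :
    pgl (c * x) (c * y) (c * z) (c * w) = pgl x y z w := by
  rw [eq_comm, pgl_eq_pgl_iff h]
  · exact ⟨c, hc, rfl, rfl, rfl, rfl⟩
  · have := mul_ne_zero (mul_ne_zero hc hc) h
    intro h0
    apply this
    linear_combination h0

theorem pgl_inv {x y z w : F} (h : x * w - y * z ≠ 0) :
    (pgl x y z w)⁻¹ = pgl w (-y) (-z) x := by
  rw [inv_eq_iff_mul_eq_one, ← pgl_one]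
  refine pgl_mul_eq _ h h (fun h0 => h (by linear_combination h0)) ?_ ?_ ?_ ?_ <;> ring

/-- The point of the projective line with homogeneous coordinates `(1, t)`. The elements of
`PGL(2, F)` are described as maps in the coordinate `x = 1 / t`, with `x = ∞` for `t = 0`. -/
def finPt (t : F) : ℙ F (Fin 2 → F) :=
  Projectivization.mk F ![1, t] fun h => one_ne_zero (congrFun h 0)

/-- The point of the projective line with homogeneous coordinates `(0, 1)`, i.e. `t = ∞` and
`x = 0`. -/
def infPt (F : Type v) [Field F] : ℙ F (Fin 2 → F) :=
  Projectivization.mk F ![0, 1] fun h => one_ne_zero (congrFun h 1)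

theorem pgl_smul_mk {x y z w : F} (h : x * w - y * z ≠ 0) {s t : F} (hv : ![s, t] ≠ 0)
    (hv' : ![x * s + y * t, z * s + w * t] ≠ 0) :
    pgl x y z w • Projectivization.mk F ![s, t] hv = Projectivization.mk F _ hv' := by
  rw [pgl_of_ne h, PGL.mk_smul_mk]
  congr 1
  change !![x, y; z, w] *ᵥ ![s, t] = _
  ext i
  fin_cases i <;> simp [Matrix.mulVec, dotProduct]

theorem vec_ne_zero_of_det {x y z w : F} (h : x * w - y * z ≠ 0) {s t : F} (hv : ![s, t] ≠ 0) :
    ![x * s + y * t, z * s + w * t] ≠ 0 := by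
  intro h0
  have h1 : x * s + y * t = 0 := congrFun h0 0
  have h2 : z * s + w * t = 0 := congrFun h0 1
  have hs : s = 0 := by
    have : (x * w - y * z) * s = 0 := by linear_combination w * h1 - y * h2
    exact (mul_eq_zero.1 this).resolve_left h
  have ht : t = 0 := by
    have : (x * w - y * z) * t = 0 := by linear_combination x * h2 - z * h1
    exact (mul_eq_zero.1 this).resolve_left h
  apply hv
  ext i
  fin_cases i <;> simp [hs, ht]

theorem mk_eq_mk_iff_mul {s t s' t' : F} (hv : ![s, t] ≠ 0) (hv' : ![s', t'] ≠ 0) :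
    Projectivization.mk F ![s, t] hv = Projectivization.mk F ![s', t'] hv' ↔
      s * t' = s' * t := by
  rw [Projectivization.mk_eq_mk_iff']
  constructor
  · rintro ⟨a, ha⟩
    have h1 : a * s' = s := congrFun ha 0
    have h2 : a * t' = t := congrFun ha 1
    rw [← h1, ← h2]
    ring
  · intro h
    by_cases hs : s' = 0
    · have ht' : t' ≠ 0 := by
        rintro rfl
        apply hv'
        ext i
        fin_cases i <;> simp [hs]
      have hs' : s = 0 := by
        rw [hs, zero_mul] at h
        exact (mul_eq_zero.1 h).resolve_right ht'
      refine ⟨t / t', ?_⟩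
      ext i
      fin_cases i
      · simp [hs, hs']
      · simp [ht']
    · refine ⟨s / s', ?_⟩
      ext i
      fin_cases i
      · simp [hs]
      · simp only [Fin.mk_one, Pi.smul_apply, cons_val_one, cons_val_fin_one, smul_eq_mul]
        field_simp
        linear_combination h

theorem pgl_smul_finPt_iff {x y z w : F} (h : x * w - y * z ≠ 0) {t : F} :
    pgl x y z w • finPt t = finPt t ↔ z + w * t = (x + y * t) * t := by
  unfold finPt
  rw [pgl_smul_mk h _ (vec_ne_zero_of_det h (fun h => one_ne_zero (congrFun h 0))),
    mk_eq_mk_iff_mul]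
  simp only [mul_one, one_mul]
  exact eq_comm

theorem pgl_smul_infPt_iff {x y z w : F} (h : x * w - y * z ≠ 0) :
    pgl x y z w • infPt F = infPt F ↔ y = 0 := by
  unfold infPt
  rw [pgl_smul_mk h _ (vec_ne_zero_of_det h (fun h => one_ne_zero (congrFun h 1))),
    mk_eq_mk_iff_mul]
  simp

/-- An element that fixes three points of the projective line is trivial. -/
theorem eq_one_of_smul_eq {g : PGL(Fin 2, F)} {t : F} (ht : t ≠ 0)
    (h0 : g • finPt (0 : F) = finPt 0)
    (hi : g • infPt F = infPt F) (h1 : g • finPt t = finPt t) : g = 1 := by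
  obtain ⟨x, y, z, w, h, rfl⟩ := exists_eq_pgl g
  rw [pgl_smul_finPt_iff h] at h0 h1
  rw [pgl_smul_infPt_iff h] at hi
  subst hi
  obtain rfl : z = 0 := by simpa using h0
  obtain rfl : w = x := mul_right_cancel₀ ht (by simpa using h1)
  exact pgl_scalar _

theorem exists_smul_eq_pair {a b : ℙ F (Fin 2 → F)} (hab : a ≠ b) :
    ∃ g : PGL(Fin 2, F), g • finPt (0 : F) = a ∧ g • infPt F = b := by
  induction a using Projectivization.ind with
  | _ v hv =>
  induction b using Projectivization.ind with
  | _ u hu =>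
  obtain ⟨s, t, rfl⟩ : ∃ s t, v = ![s, t] := ⟨v 0, v 1, by ext i; fin_cases i <;> rfl⟩
  obtain ⟨s', t', rfl⟩ : ∃ s t, u = ![s, t] := ⟨u 0, u 1, by ext i; fin_cases i <;> rfl⟩
  rw [Ne, mk_eq_mk_iff_mul] at hab
  have h : s * t' - s' * t ≠ 0 := sub_ne_zero.2 hab
  refine ⟨pgl s s' t t', ?_, ?_⟩
  · unfold finPt
    rw [pgl_smul_mk h _ (vec_ne_zero_of_det h (fun h => one_ne_zero (congrFun h 0))),
      mk_eq_mk_iff_mul]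
    ring
  · unfold infPt
    rw [pgl_smul_mk h _ (vec_ne_zero_of_det h (fun h => one_ne_zero (congrFun h 1))),
      mk_eq_mk_iff_mul]
    ring

theorem exists_smul_ne (a : ℙ F (Fin 2 → F)) : ∃ g : PGL(Fin 2, F), g • a ≠ a := by
  have h01 : (finPt 0 : ℙ F (Fin 2 → F)) ≠ infPt F := by
    unfold finPt infPt
    rw [Ne, mk_eq_mk_iff_mul]
    simp
  by_cases ha : a = finPt 0
  · obtain ⟨g, hg, -⟩ := exists_smul_eq_pair h01.symm
    exact ⟨g, by rw [ha, hg]; exact h01.symm⟩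
  · obtain ⟨g, hg, hg'⟩ := exists_smul_eq_pair (Ne.symm ha)
    obtain ⟨k, hk, hk'⟩ := exists_smul_eq_pair h01.symm
    refine ⟨g * k * g⁻¹, fun h => ha ?_⟩
    have h1 : g⁻¹ • a = infPt F := by rw [inv_smul_eq_iff, hg']
    rw [mul_smul, mul_smul, h1, hk', hg] at h
    exact h.symm

/-- The diagonal element `x ↦ u x`. -/
noncomputable abbrev pglDiag (u : F) : PGL(Fin 2, F) := pgl u 0 0 1

/-- The translation `x ↦ x + b`. -/
noncomputable abbrev pglTrans (b : F) : PGL(Fin 2, F) := pgl 1 b 0 1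

theorem pglTrans_add (b c : F) : pglTrans (b + c) = pglTrans b * pglTrans c := by
  symm
  refine pgl_mul_eq 1 one_ne_zero (by simp) (by simp) ?_ ?_ ?_ ?_ <;> ring

theorem pglTrans_zero : pglTrans (0 : F) = 1 := pgl_one

theorem pglTrans_neg (b : F) : pglTrans (-b) = (pglTrans b)⁻¹ := by
  rw [eq_inv_iff_mul_eq_one, ← pglTrans_add, neg_add_cancel, pglTrans_zero]

theorem pglTrans_injective : Function.Injective (pglTrans : F → PGL(Fin 2, F)) := by
  intro b c h
  obtain ⟨k, -, h1, h2, -, -⟩ := (pgl_eq_pgl_iff (by simp) (by simp)).1 h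
  rw [mul_one] at h1
  rw [h2, ← h1, one_mul]

theorem pglDiag_mul {u u' : F} (hu : u ≠ 0) (hu' : u' ≠ 0) :
    pglDiag (u * u') = pglDiag u * pglDiag u' := by
  symm
  refine pgl_mul_eq 1 one_ne_zero (by simpa) (by simpa) ?_ ?_ ?_ ?_ <;> ring

theorem pglDiag_inv {u : F} (hu : u ≠ 0) : pglDiag u⁻¹ = (pglDiag u)⁻¹ := by
  rw [eq_inv_iff_mul_eq_one, ← pglDiag_mul (inv_ne_zero hu) hu, inv_mul_cancel₀ hu]
  exact pgl_one

theorem pglDiag_eq_iff {u u' : F} (hu : u ≠ 0) (hu' : u' ≠ 0) :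
    pglDiag u = pglDiag u' ↔ u = u' := by
  refine ⟨fun h => ?_, fun h => h ▸ rfl⟩
  obtain ⟨c, -, h1, -, -, h2⟩ := (pgl_eq_pgl_iff (by simpa) (by simpa)).1 h
  rw [mul_one] at h2
  rw [h1, ← h2, one_mul]

theorem pglDiag_conj {u : F} (hu : u ≠ 0) (b : F) :
    pglDiag u * pglTrans b * (pglDiag u)⁻¹ = pglTrans (u * b) := by
  rw [mul_inv_eq_iff_eq_mul]
  rw [pgl_mul (by simpa) (by simp), pgl_mul (by simp) (by simpa)]
  congr 1 <;> ring

/-- The commutator of the involution `x ↦ c - x` and `x ↦ u x` is a translation. -/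
theorem pgl_commutator {u : F} (hu : u ≠ 0) (c : F) :
    pgl (-1) c 0 1 * pglDiag u * (pgl (-1) c 0 1)⁻¹ * (pglDiag u)⁻¹ =
      pglTrans (c * (1 - u)) := by
  rw [mul_inv_eq_iff_eq_mul, mul_inv_eq_iff_eq_mul, pgl_mul (by simp) (by simpa),
    pgl_mul (by simp) (by simpa), pgl_mul (by simpa) (by simp)]
  congr 1 <;> ring

theorem orderOf_pglDiag {u : F} (hu : u ≠ 0) : orderOf (pglDiag u) = orderOf u := by
  let D : Fˣ →* PGL(Fin 2, F) :=
    MonoidHom.mk' (fun u => pglDiag (u : F)) fun a b => by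
      rw [Units.val_mul, pglDiag_mul a.ne_zero b.ne_zero]
  have hD : Function.Injective D := fun a b h =>
    Units.ext ((pglDiag_eq_iff a.ne_zero b.ne_zero).1 h)
  have := orderOf_injective D hD (Units.mk0 u hu)
  rw [← orderOf_units, Units.val_mk0] at this
  exact this

/-! ### Generation of `PGL(2, F)` -/

/-- A subgroup that contains `x ↦ u x` for a generator `u` of the field, and an involution
`x ↦ c - x` with `c ≠ 0`, contains all translations: the translations in it form a vector space over
the field generated by `u`. -/
theorem pglTrans_mem {H : Subgroup (PGL(Fin 2, F))} {u c : F} (hu0 : u ≠ 0) (hu1 : u ≠ 1)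
    (hc : c ≠ 0) (hgen : Subring.closure {u} = ⊤) (hD : pglDiag u ∈ H)
    (hR : pgl (-1) c 0 1 ∈ H) (b : F) : pglTrans b ∈ H := by
  let A : AddSubgroup F :=
    { carrier := {b | pglTrans b ∈ H}
      zero_mem' := by
        change pglTrans 0 ∈ H
        rw [pglTrans_zero]
        exact one_mem _
      add_mem' := by
        intro b c hb hc
        change pglTrans (b + c) ∈ H
        rw [pglTrans_add]
        exact mul_mem hb hc
      neg_mem' := by
        intro b hb
        change pglTrans (-b) ∈ H
        rw [pglTrans_neg]
        exact inv_mem hb }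
  have hb0 : c * (1 - u) ∈ A := by
    change pglTrans (c * (1 - u)) ∈ H
    rw [← pgl_commutator hu0]
    exact mul_mem (mul_mem (mul_mem hR hD) (inv_mem hR)) (inv_mem hD)
  have hall : ∀ s : F, ∀ b ∈ A, s * b ∈ A := by
    intro s
    have hs : s ∈ Subring.closure {u} := hgen ▸ Subring.mem_top s
    induction hs using Subring.closure_induction with
    | mem s hs =>
      obtain rfl : s = u := hs
      intro b hb
      change pglTrans (s * b) ∈ H
      rw [← pglDiag_conj hu0]
      exact mul_mem (mul_mem hD hb) (inv_mem hD)
    | zero => intro b _; rw [zero_mul]; exact zero_mem _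
    | one => intro b hb; rwa [one_mul]
    | add s t _ _ hs ht => intro b hb; rw [add_mul]; exact add_mem (hs b hb) (ht b hb)
    | neg s _ hs => intro b hb; rw [neg_mul]; exact neg_mem (hs b hb)
    | mul s t _ _ hs ht => intro b hb; rw [mul_assoc]; exact hs _ (ht b hb)
  have hne : c * (1 - u) ≠ 0 := mul_ne_zero hc (sub_ne_zero.2 hu1.symm)
  have := hall (b / (c * (1 - u))) _ hb0
  rwa [div_mul_cancel₀ _ hne] at this

theorem pgl_lower_mem {H : Subgroup (PGL(Fin 2, F))} {u c : F} (hu0 : u ≠ 0) (hu1 : u ≠ 1)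
    (hc : c ≠ 0) (hgen : Subring.closure {u} = ⊤) (hD : pglDiag u ∈ H)
    (hR : pgl 1 0 c (-1) ∈ H) (b : F) : pgl 1 0 b 1 ∈ H := by
  let W : PGL(Fin 2, F) := pgl 0 1 1 0
  have hW : (0 : F) * 0 - 1 * 1 ≠ 0 := by simp
  have hWW : W⁻¹ = W := by
    rw [inv_eq_iff_mul_eq_one, ← pgl_one]
    refine pgl_mul_eq 1 one_ne_zero hW hW ?_ ?_ ?_ ?_ <;> ring
  have conj : ∀ x y z w : F, x * w - y * z ≠ 0 →
      MulAut.conj W (pgl x y z w) = pgl w z y x := by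
    intro x y z w h
    rw [MulAut.conj_apply, hWW, pgl_mul hW h, pgl_mul (fun h0 => h (by linear_combination -h0)) hW]
    congr 1 <;> ring
  have key := pglTrans_mem (H := H.comap (MulAut.conj W).toMonoidHom) hu0 hu1 hc hgen ?_ ?_ b
  · rw [Subgroup.mem_comap] at key
    change MulAut.conj W _ ∈ H at key
    rwa [conj _ _ _ _ (by simp)] at key
  · change MulAut.conj W _ ∈ H
    rw [conj _ _ _ _ (by simpa)]
    have := inv_mem hD
    rw [pgl_inv (by simpa)] at this
    simpa using this
  · change MulAut.conj W _ ∈ H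
    rw [conj _ _ _ _ (by simp)]
    have : pgl (1 : F) 0 c (-1) = pgl 1 0 c (-1) := rfl
    exact hR

/-- The upper and lower unipotent matrices generate all elements of determinant one. By the
condition on squares, every determinant is that of a scalar matrix, up to a factor `u`. -/
theorem eq_top_of_trans_mem {H : Subgroup (PGL(Fin 2, F))} {u : F} (hu : u ≠ 0)
    (hT : ∀ b, pglTrans b ∈ H) (hL : ∀ b, pgl 1 0 b 1 ∈ H) (hD : pglDiag u ∈ H)
    (hsq : ∀ δ : F, IsSquare δ ∨ IsSquare (δ * u)) : H = ⊤ := by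
  have h1 : ∀ x y z w : F, x * w - y * z = 1 → z ≠ 0 → pgl x y z w ∈ H := by
    intro x y z w h hz
    have : pgl x y z w = pglTrans ((x - 1) / z) * (pgl 1 0 z 1 * pglTrans ((w - 1) / z)) := by
      rw [pgl_mul (by simp) (by simp)]
      symm
      refine pgl_mul_eq 1 one_ne_zero (by simp)
        (fun h0 => one_ne_zero (α := F) (by linear_combination h0)) ?_ ?_ ?_ ?_ <;> field_simp
      · ring
      · linear_combination h
      · ring
      · ring
    rw [this]
    exact mul_mem (hT _) (mul_mem (hL _) (hT _))
  have h2 : ∀ x y z w : F, x * w - y * z = 1 → pgl x y z w ∈ H := by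
    intro x y z w h
    by_cases hz : z = 0
    · have hx : x ≠ 0 := by
        rintro rfl
        rw [hz] at h
        simp at h
      have h3 : pgl 1 0 1 1 * pgl x y z w ∈ H := by
        rw [pgl_mul (by simp) (by rw [h]; exact one_ne_zero)]
        refine h1 _ _ _ _ ?_ ?_
        · linear_combination h
        · simpa [hz] using hx
      exact (Subgroup.mul_mem_cancel_left _ (hL 1)).1 h3
    · exact h1 x y z w h hz
  have h3 : ∀ x y z w : F, x * w - y * z ≠ 0 → IsSquare (x * w - y * z) → pgl x y z w ∈ H := by
    rintro x y z w h ⟨s, hs⟩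
    have hs0 : s ≠ 0 := by
      rintro rfl
      exact h (by rw [hs, zero_mul])
    rw [← pgl_smul (inv_ne_zero hs0) h]
    refine h2 _ _ _ _ ?_
    field_simp
    linear_combination hs
  rw [eq_top_iff]
  intro g _
  obtain ⟨x, y, z, w, h, rfl⟩ := exists_eq_pgl g
  rcases hsq (x * w - y * z) with hδ | hδ
  · exact h3 x y z w h hδ
  · have h4 : pgl x y z w * pglDiag u ∈ H := by
      rw [pgl_mul h (by simpa)]
      have e : (x * u + y * 0) * (z * 0 + w * 1) - (x * 0 + y * 1) * (z * u + w * 0) =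
          (x * w - y * z) * u := by ring
      refine h3 _ _ _ _ ?_ ?_
      · rw [e]
        exact mul_ne_zero h hu
      · rwa [e]
    exact (Subgroup.mul_mem_cancel_right _ hD).1 h4

/-- If `PGL(2, F)` is generated by matrices of square determinant, all elements of `F` are
squares. -/
theorem isSquare_of_closure_eq_top {T : Set (PGL(Fin 2, F))} (hT : Subgroup.closure T = ⊤)
    (h : ∀ g ∈ T, ∃ x y z w : F, x * w - y * z ≠ 0 ∧ g = pgl x y z w ∧ IsSquare (x * w - y * z))
    (δ : F) : IsSquare δ := by
  have hall : ∀ g, ∃ x y z w : F, x * w - y * z ≠ 0 ∧ g = pgl x y z w ∧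
      IsSquare (x * w - y * z) := by
    intro g
    have hg : g ∈ Subgroup.closure T := hT ▸ Subgroup.mem_top g
    induction hg using Subgroup.closure_induction with
    | mem g hg => exact h g hg
    | one => exact ⟨1, 0, 0, 1, by simp, pgl_one.symm, by simp⟩
    | mul g g' _ _ hg hg' =>
      obtain ⟨x, y, z, w, h1, rfl, h2⟩ := hg
      obtain ⟨x', y', z', w', h1', rfl, h2'⟩ := hg'
      have e : (x * x' + y * z') * (z * y' + w * w') - (x * y' + y * w') * (z * x' + w * z') =
        (x * w - y * z) * (x' * w' - y' * z') := by ring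
      refine ⟨_, _, _, _, ?_, pgl_mul h1 h1', ?_⟩
      · rw [e]; exact mul_ne_zero h1 h1'
      · rw [e]; exact h2.mul h2'
    | inv g _ hg =>
      obtain ⟨x, y, z, w, h1, rfl, h2⟩ := hg
      have e : w * x - -y * -z = x * w - y * z := by ring
      exact ⟨_, _, _, _, by rwa [e], pgl_inv h1, by rwa [e]⟩
  by_cases hδ : δ = 0
  · simp [hδ]
  obtain ⟨x, y, z, w, h1, h2, r, hr⟩ := hall (pglDiag δ)
  obtain ⟨c, hc, rfl, rfl, rfl, rfl⟩ := (pgl_eq_pgl_iff (by simpa) h1).1 h2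
  refine ⟨r / c, ?_⟩
  field_simp
  linear_combination hr

/-! ### Field automorphisms -/

theorem map_pgl {K : Type*} [Field K] (τ : F →+* K) {x y z w : F} (h : x * w - y * z ≠ 0) :
    ProjGenLinGroup.map τ (pgl x y z w) = pgl (τ x) (τ y) (τ z) (τ w) := by
  have h' : τ x * τ w - τ y * τ z ≠ 0 := by
    rw [← map_mul, ← map_mul, ← map_sub]
    exact (map_ne_zero τ).2 h
  rw [pgl_of_ne h, pgl_of_ne h', ProjGenLinGroup.map_mk]
  congr 1
  apply Units.ext
  ext i j
  fin_cases i <;> fin_cases j <;> rfl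

/-- The automorphism of `PGL(2, F)` induced by an automorphism of `F`. -/
noncomputable def pglFieldAut (τ : F ≃+* F) : PGL(Fin 2, F) ≃* PGL(Fin 2, F) :=
  MonoidHom.toMulEquiv (ProjGenLinGroup.map τ.toRingHom) (ProjGenLinGroup.map τ.symm.toRingHom)
    (by
      rw [← ProjGenLinGroup.map_comp]
      have : τ.symm.toRingHom.comp τ.toRingHom = RingHom.id F := by ext; simp
      rw [this, ProjGenLinGroup.map_id])
    (by
      rw [← ProjGenLinGroup.map_comp]
      have : τ.toRingHom.comp τ.symm.toRingHom = RingHom.id F := by ext; simp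
      rw [this, ProjGenLinGroup.map_id])

theorem pglFieldAut_pgl (τ : F ≃+* F) {x y z w : F} (h : x * w - y * z ≠ 0) :
    pglFieldAut τ (pgl x y z w) = pgl (τ x) (τ y) (τ z) (τ w) :=
  map_pgl τ.toRingHom h

/-- A homomorphism that maps `x ↦ ω x` to `x ↦ ω' x` and a nontrivial translation to a nontrivial
translation matches the polynomial relations of `ω` and `ω'`. -/
theorem aeval_eq_zero_of_hom {θ : PGL(Fin 2, F) →* PGL(Fin 2, F)} {ω ω' b b' : F}
    (hω : ω ≠ 0) (hω' : ω' ≠ 0) (hb' : b' ≠ 0)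
    (hD : θ (pglDiag ω) = pglDiag ω') (hT : θ (pglTrans b) = pglTrans b')
    {f : Polynomial ℤ} (hf : Polynomial.aeval ω f = 0) : Polynomial.aeval ω' f = 0 := by
  have hpow : ∀ n : ℕ, θ (pglTrans (ω ^ n * b)) = pglTrans (ω' ^ n * b') := by
    intro n
    induction n with
    | zero => simpa using hT
    | succ n ih =>
      rw [pow_succ', mul_assoc, ← pglDiag_conj hω, map_mul, map_mul, map_inv, hD, ih,
        pglDiag_conj hω', pow_succ', mul_assoc]
  have hz : ∀ (m : ℤ) (c : F), pglTrans (m * c) = pglTrans c ^ m := by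
    intro m c
    induction m using Int.induction_on with
    | zero => simp [pglTrans_zero]
    | succ k ih => rw [_root_.zpow_add_one, ← ih, ← pglTrans_add]; congr 1; push_cast; ring
    | pred k ih =>
      rw [_root_.zpow_sub_one, ← ih, ← pglTrans_neg, ← pglTrans_add]; congr 1; push_cast; ring
  have key : ∀ f : Polynomial ℤ, θ (pglTrans (Polynomial.aeval ω f * b)) =
      pglTrans (Polynomial.aeval ω' f * b') := by
    intro f
    induction f using Polynomial.induction_on' with
    | add f g hf hg =>
      rw [map_add, map_add, add_mul, add_mul, pglTrans_add, map_mul, hf, hg, pglTrans_add]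
    | monomial n m =>
      simp only [Polynomial.aeval_monomial, algebraMap_int_eq, eq_intCast, mul_assoc]
      rw [hz, map_zpow, hpow, hz]
  have h1 := key f
  rw [hf, zero_mul, pglTrans_zero, map_one, ← pglTrans_zero] at h1
  exact (mul_eq_zero.1 (pglTrans_injective h1).symm).resolve_right hb'

end PGL

/-! ### The standard generators -/

section StdGen

open Matrix Projectivization

variable {F : Type v} [Field F]

/-- The elements `1, σ₁, σ₂ σ₁, σ₃ σ₂ σ₁` for the standard generators `σ₁, σ₂, σ₃` of `PGL(2, F)`
with parameter `ω`. Here `σ₁ : x ↦ (1 - x) / ω` and `σ₂ : x ↦ ω x` fix the point `∞`, which is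
`finPt 0`, and `σ₂` and `σ₃` fix the point `0`, which is `infPt F`. -/
noncomputable def stdGen (ω : F) : Fin 4 → PGL(Fin 2, F) :=
  ![1, pgl (-1) 1 0 ω, pgl (-1) 1 0 1, pgl 1 (-1) (ω + 1) (-1)]

theorem stdGen_zero (ω : F) : stdGen ω 0 = 1 := rfl
theorem stdGen_one (ω : F) : stdGen ω 1 = pgl (-1) 1 0 ω := rfl
theorem stdGen_two (ω : F) : stdGen ω 2 = pgl (-1) 1 0 1 := rfl
theorem stdGen_three (ω : F) : stdGen ω 3 = pgl 1 (-1) (ω + 1) (-1) := rfl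

theorem stdGen_two_mul_self (ω : F) : stdGen ω 2 * stdGen ω 2 = 1 := by
  rw [stdGen_two, ← pgl_one]
  refine pgl_mul_eq 1 one_ne_zero (by simp) (by simp) ?_ ?_ ?_ ?_ <;> ring

/-- The elements of `PGL(2, F)` that are represented by affine maps `x ↦ u x + b` with `u ∈ S`. -/
def affineSubgroup (S : Subgroup Fˣ) : Subgroup (PGL(Fin 2, F)) where
  carrier := {g | ∃ u : Fˣ, u ∈ S ∧ ∃ b : F, g = pgl (u : F) b 0 1}
  one_mem' := ⟨1, one_mem _, 0, pgl_one.symm⟩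
  mul_mem' := by
    rintro _ _ ⟨u, hu, b, rfl⟩ ⟨u', hu', b', rfl⟩
    refine ⟨u * u', mul_mem hu hu', u * b' + b, ?_⟩
    refine pgl_mul_eq 1 one_ne_zero (by simp) (by simp) ?_ ?_ ?_ ?_ <;> push_cast <;> ring
  inv_mem' := by
    rintro _ ⟨u, hu, b, rfl⟩
    refine ⟨u⁻¹, inv_mem hu, -(u : F)⁻¹ * b, ?_⟩
    have hu0 := u.ne_zero
    rw [inv_eq_iff_mul_eq_one, ← pgl_one]
    refine pgl_mul_eq 1 one_ne_zero (by simp) (by simp) ?_ ?_ ?_ ?_ <;> push_cast <;>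
      field_simp <;> ring

theorem mem_affineSubgroup {S : Subgroup Fˣ} {g : PGL(Fin 2, F)} :
    g ∈ affineSubgroup S ↔ ∃ u : Fˣ, u ∈ S ∧ ∃ b : F, g = pgl (u : F) b 0 1 :=
  Iff.rfl

variable {ω : F} (hω : ω ≠ 0)
include hω

theorem det_stdGen_one : (-1 : F) * ω - 1 * 0 ≠ 0 := by simpa

theorem det_stdGen_three : (1 : F) * (-1) - (-1) * (ω + 1) ≠ 0 := by
  rwa [show (1 : F) * (-1) - (-1) * (ω + 1) = ω by ring]

theorem stdGen_three_mul_self : stdGen ω 3 * stdGen ω 3 = 1 := by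
  rw [stdGen_three, ← pgl_one]
  refine pgl_mul_eq (-ω) (neg_ne_zero.2 hω) (det_stdGen_three hω) (det_stdGen_three hω)
    ?_ ?_ ?_ ?_ <;> ring

theorem stdGen_two_mul_inv : stdGen ω 2 * (stdGen ω 1)⁻¹ = pglDiag ω := by
  rw [mul_inv_eq_iff_eq_mul, stdGen_two, stdGen_one, eq_comm]
  refine pgl_mul_eq ω hω (by simpa) (by simpa) ?_ ?_ ?_ ?_ <;> ring

theorem stdGen_three_mul_inv :
    stdGen ω 3 * (stdGen ω 2)⁻¹ = pgl (-1) 0 (-(ω + 1)) ω := by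
  rw [mul_inv_eq_iff_eq_mul, stdGen_two, stdGen_three, eq_comm]
  refine pgl_mul_eq 1 one_ne_zero (by simpa) (by simp) ?_ ?_ ?_ ?_ <;> ring

theorem stdGen_three_mul_inv_one :
    stdGen ω 3 * (stdGen ω 1)⁻¹ = pgl 1 0 (ω + 1) (-1) := by
  rw [mul_inv_eq_iff_eq_mul, stdGen_one, stdGen_three, eq_comm]
  refine pgl_mul_eq (-1) (by simp) (by simp) (by simpa) ?_ ?_ ?_ ?_ <;> ring

theorem stdGen_comm : stdGen ω 3 * (stdGen ω 1)⁻¹ = stdGen ω 1 * (stdGen ω 3)⁻¹ := by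
  have h : stdGen ω 3 * (stdGen ω 1)⁻¹ * (stdGen ω 3 * (stdGen ω 1)⁻¹) = 1 := by
    rw [stdGen_three_mul_inv_one hω, ← pgl_one]
    refine pgl_mul_eq 1 one_ne_zero (by simp) (by simp) ?_ ?_ ?_ ?_ <;> ring
  nth_rewrite 1 [eq_inv_of_mul_eq_one_left h]
  rw [_root_.mul_inv_rev, inv_inv]

theorem orderOf_stdGen_one (hω1 : ω ≠ -1) : orderOf (stdGen ω 1) = orderOf (-ω⁻¹) := by
  have h1 : (1 : F) + ω ≠ 0 := fun h => hω1 (eq_neg_of_add_eq_zero_right h)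
  have hM : (1 : F) * (1 + ω) - 1 * 0 ≠ 0 := by simpa
  have hu : -ω⁻¹ ≠ 0 := neg_ne_zero.2 (inv_ne_zero hω)
  rw [← orderOf_pglDiag hu]
  refine (SemiconjBy.orderOf_eq (pgl 1 1 0 (1 + ω)) ?_).symm
  change pgl 1 1 0 (1 + ω) * pglDiag (-ω⁻¹) = stdGen ω 1 * pgl 1 1 0 (1 + ω)
  rw [stdGen_one, pgl_mul (det_stdGen_one hω) hM]
  have hd : ((-1) * 1 + 1 * 0) * (0 * 1 + ω * (1 + ω)) -
      ((-1) * 1 + 1 * (1 + ω)) * (0 * 1 + ω * 0) ≠ 0 := by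
    rw [show ((-1) * 1 + 1 * 0) * (0 * 1 + ω * (1 + ω)) -
      ((-1) * 1 + 1 * (1 + ω)) * (0 * 1 + ω * 0) = -(ω * (1 + ω)) by ring]
    exact neg_ne_zero.2 (mul_ne_zero hω h1)
  refine pgl_mul_eq ω⁻¹ (inv_ne_zero hω) hM (by simpa using hω) ?_ ?_ ?_ ?_ <;> field_simp <;> ring

theorem orderOf_stdGen_three_mul_inv :
    orderOf (stdGen ω 3 * (stdGen ω 2)⁻¹) = orderOf (-ω⁻¹) := by
  have hu : -ω⁻¹ ≠ 0 := neg_ne_zero.2 (inv_ne_zero hω)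
  rw [← orderOf_pglDiag hu, stdGen_three_mul_inv hω]
  refine (SemiconjBy.orderOf_eq (pgl 1 0 1 1) ?_).symm
  change pgl 1 0 1 1 * pglDiag (-ω⁻¹) = _ * pgl 1 0 1 1
  have hA : (-1 : F) * ω - 0 * (-(ω + 1)) ≠ 0 := by simpa
  have hM : (1 : F) * 1 - 0 * 1 ≠ 0 := by simp
  rw [pgl_mul hA hM]
  refine pgl_mul_eq ω⁻¹ (inv_ne_zero hω) hM (by simpa using hω) ?_ ?_ ?_ ?_ <;>
    field_simp <;> ring

theorem quotientSubgroup_stdGen_le_stabilizer_infPt :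
    quotientSubgroup (stdGen ω) {0}ᶜ ≤ MulAction.stabilizer _ (infPt F) := by
  have h : ∀ i ∈ ({0}ᶜ : Set (Fin 4)), stdGen ω i • finPt 1 = infPt F := by
    have key : ∀ x y z w : F, x * w - y * z ≠ 0 → x + y = 0 →
        pgl x y z w • finPt 1 = infPt F := by
      intro x y z w h hxy
      unfold finPt infPt
      rw [pgl_smul_mk h _ (vec_ne_zero_of_det h (fun h => one_ne_zero (congrFun h 0))),
        mk_eq_mk_iff_mul]
      linear_combination hxy
    intro i hi
    fin_cases i
    · exact absurd rfl hi
    · exact key _ _ _ _ (det_stdGen_one hω) (by ring)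
    · exact key _ _ _ _ (by simp) (by ring)
    · exact key _ _ _ _ (det_stdGen_three hω) (by ring)
  refine (Subgroup.closure_le _).2 ?_
  rintro _ ⟨i, hi, j, hj, rfl⟩
  change (stdGen ω i * (stdGen ω j)⁻¹) • infPt F = infPt F
  have h1 : (stdGen ω j)⁻¹ • infPt F = finPt 1 := by rw [inv_smul_eq_iff, h j hj]
  rw [mul_smul, h1, h i hi]

theorem quotientSubgroup_stdGen_le_affineSubgroup {m : ℕ} (hm : ω ^ m = -1) :
    quotientSubgroup (stdGen ω) {3}ᶜ ≤
      affineSubgroup (Subgroup.zpowers (Units.mk0 ω hω)) := by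
  have hneg : (-1 : Fˣ) ∈ Subgroup.zpowers (Units.mk0 ω hω) :=
    ⟨m, Units.ext (by simpa using hm)⟩
  have h : ∀ i ∈ ({3}ᶜ : Set (Fin 4)),
      stdGen ω i ∈ affineSubgroup (Subgroup.zpowers (Units.mk0 ω hω)) := by
    intro i hi
    fin_cases i
    · exact one_mem _
    · refine mem_affineSubgroup.2 ⟨-1 * (Units.mk0 ω hω)⁻¹,
        mul_mem hneg (inv_mem (Subgroup.mem_zpowers _)), ω⁻¹, ?_⟩
      change pgl (-1) 1 0 ω = _
      rw [← pgl_smul (inv_ne_zero hω) (det_stdGen_one hω)]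
      congr 1 <;> simp [hω]
    · refine mem_affineSubgroup.2 ⟨-1, hneg, 1, ?_⟩
      change pgl (-1) 1 0 1 = _
      simp
    · exact absurd rfl hi
  refine (Subgroup.closure_le _).2 ?_
  rintro _ ⟨i, hi, j, hj, rfl⟩
  exact mul_mem (h i hi) (inv_mem (h j hj))

/-- The intersection property for the standard generators: the relevant elements fix three points of
the projective line. -/
theorem isPolytopal_stdGen (hω1 : ω ≠ 1) (hω2 : ω ≠ -1) {m : ℕ} (hm : ω ^ m = -1)
    (hgen : Subgroup.closure (Set.range (stdGen ω)) = ⊤) :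
    IsPolytopal (groupAdj (stdGen ω)) := by
  have h1 : (1 : F) + ω ≠ 0 := fun h => hω2 (eq_neg_of_add_eq_zero_right h)
  have h3f : ∀ x ∈ quotientSubgroup (stdGen ω) {3}ᶜ, x • finPt (0 : F) = finPt 0 := by
    intro x hx
    obtain ⟨u, -, b, rfl⟩ :=
      mem_affineSubgroup.1 (quotientSubgroup_stdGen_le_affineSubgroup hω hm hx)
    rw [pgl_smul_finPt_iff (by simp)]
    ring
  have h0v : ∀ x ∈ quotientSubgroup (stdGen ω) {0}ᶜ, x • infPt F = infPt F :=
    fun x hx => quotientSubgroup_stdGen_le_stabilizer_infPt hω hx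
  have ha1 : stdGen ω 1 ∈ quotientSubgroup (stdGen ω) {3}ᶜ := by
    have := mul_inv_mem_quotientSubgroup (a := stdGen ω) (J := {3}ᶜ) (i := 1) (j := 0)
      (by simp) (by simp)
    simpa [stdGen_zero] using this
  have hs3 : stdGen ω 3 * (stdGen ω 2)⁻¹ ∈ quotientSubgroup (stdGen ω) {0}ᶜ :=
    mul_inv_mem_quotientSubgroup (by simp) (by simp)
  have hfix1 : ∀ x ∈ Subgroup.zpowers (stdGen ω 1), x • finPt (1 + ω) = finPt (1 + ω) := by
    intro x hx
    have : Subgroup.zpowers (stdGen ω 1) ≤ MulAction.stabilizer _ (finPt (1 + ω)) := by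
      rw [Subgroup.zpowers_le]
      change _ • _ = _
      rw [stdGen_one, pgl_smul_finPt_iff (det_stdGen_one hω)]
      ring
    exact this hx
  have hfix3 : ∀ x ∈ Subgroup.zpowers (stdGen ω 3 * (stdGen ω 2)⁻¹),
      x • finPt (1 : F) = finPt 1 := by
    intro x hx
    have : Subgroup.zpowers (stdGen ω 3 * (stdGen ω 2)⁻¹) ≤
        MulAction.stabilizer _ (finPt (1 : F)) := by
      rw [Subgroup.zpowers_le]
      change _ • _ = _
      rw [stdGen_three_mul_inv hω, pgl_smul_finPt_iff (by simpa)]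
      ring
    exact this hx
  refine isPolytopal_groupAdj_four (stdGen_zero ω) (stdGen_two_mul_self ω)
    (stdGen_three_mul_self hω) (stdGen_comm hω) hgen ?_ ?_ ?_ ?_ ?_ ?_
  · intro h
    have h2 := h1
    rw [stdGen_one, ← pgl_one, pgl_eq_pgl_iff (det_stdGen_one hω) (by simp)] at h
    obtain ⟨c, hc, -, h, -, -⟩ := h
    exact hc (by simpa using h.symm)
  · rw [stdGen_two_mul_inv hω, ← pgl_one]
    exact fun h => hω1 ((pglDiag_eq_iff hω one_ne_zero).1 h)
  · rw [stdGen_three_mul_inv hω, ← pgl_one, Ne, pgl_eq_pgl_iff (by simpa) (by simp)]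
    rintro ⟨c, hc, -, -, h, -⟩
    rcases mul_eq_zero.1 h.symm with h | h
    · exact hc h
    · exact h1 (by linear_combination -h)
  · intro x hx hx'
    exact eq_one_of_smul_eq h1 (h3f x (Subgroup.zpowers_le.2 ha1 hx)) (h0v x hx') (hfix1 x hx)
  · intro x hx hx'
    exact eq_one_of_smul_eq one_ne_zero (h3f x hx') (h0v x (Subgroup.zpowers_le.2 hs3 hx))
      (hfix3 x hx)
  · intro x hx hx'
    obtain ⟨u, ⟨k, rfl⟩, b, rfl⟩ := quotientSubgroup_stdGen_le_affineSubgroup hω hm hx'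
    have hb := h0v _ hx
    rw [pgl_smul_infPt_iff (by simpa using zpow_ne_zero k hω)] at hb
    subst hb
    rw [stdGen_two_mul_inv hω]
    refine ⟨k, ?_⟩
    let D : Fˣ →* PGL(Fin 2, F) :=
      MonoidHom.mk' (fun u => pglDiag (u : F)) fun a b => by
        rw [Units.val_mul, pglDiag_mul a.ne_zero b.ne_zero]
    exact (map_zpow D (Units.mk0 ω hω) k).symm

theorem pglTrans_mem_quotientSubgroup (hω1 : ω ≠ 1) (hgen : Subring.closure {ω} = ⊤) (b : F) :
    pglTrans b ∈ quotientSubgroup (stdGen ω) {3}ᶜ := by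
  refine pglTrans_mem hω hω1 one_ne_zero hgen ?_ ?_ b
  · rw [← stdGen_two_mul_inv hω]
    exact mul_inv_mem_quotientSubgroup (by simp) (by simp)
  · have := mul_inv_mem_quotientSubgroup (a := stdGen ω) (J := {3}ᶜ) (i := 2) (j := 0)
      (by simp) (by simp)
    simpa [stdGen_zero, stdGen_two] using this

theorem pgl_lower_mem_quotientSubgroup (hω1 : ω ≠ 1) (hω2 : ω ≠ -1)
    (hgen : Subring.closure {ω} = ⊤) (b : F) :
    pgl 1 0 b 1 ∈ quotientSubgroup (stdGen ω) {0}ᶜ := by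
  have h1 : ω + 1 ≠ 0 := fun h => hω2 (eq_neg_of_add_eq_zero_left h)
  refine pgl_lower_mem hω hω1 h1 hgen ?_ ?_ b
  · rw [← stdGen_two_mul_inv hω]
    exact mul_inv_mem_quotientSubgroup (by simp) (by simp)
  · rw [← stdGen_three_mul_inv_one hω]
    exact mul_inv_mem_quotientSubgroup (by simp) (by simp)

theorem closure_stdGen_eq_top (hω1 : ω ≠ 1) (hω2 : ω ≠ -1) (hgen : Subring.closure {ω} = ⊤)
    (hsq : ∀ δ : F, IsSquare δ ∨ IsSquare (δ * ω)) :
    Subgroup.closure (Set.range (stdGen ω)) = ⊤ := by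
  have hle : ∀ J, quotientSubgroup (stdGen ω) J ≤ Subgroup.closure (Set.range (stdGen ω)) := by
    intro J
    refine (Subgroup.closure_le _).2 ?_
    rintro _ ⟨i, -, j, -, rfl⟩
    exact mul_mem (Subgroup.subset_closure ⟨i, rfl⟩)
      (inv_mem (Subgroup.subset_closure ⟨j, rfl⟩))
  refine eq_top_of_trans_mem hω
    (fun b => hle _ (pglTrans_mem_quotientSubgroup hω hω1 hgen b))
    (fun b => hle _ (pgl_lower_mem_quotientSubgroup hω hω1 hω2 hgen b)) ?_ hsq
  rw [← stdGen_two_mul_inv hω]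
  exact hle Set.univ (mul_inv_mem_quotientSubgroup (by simp) (by simp))

/-- If the standard generators satisfy the intersection property, then `-1` is a power of `ω`, as
`x ↦ -x` lies in both `⟨σ₁, σ₂⟩` and `⟨σ₂, σ₃⟩`. -/
theorem exists_pow_eq_neg_one_of_isPolytopal (h : IsPolytopal (groupAdj (stdGen ω)))
    (hω1 : ω ≠ 1) (hω2 : ω ≠ -1) (hgen : Subring.closure {ω} = ⊤) : ∃ k : ℤ, ω ^ k = -1 := by
  have h3 : pglDiag (-1 : F) ∈ quotientSubgroup (stdGen ω) {3}ᶜ := by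
    have e : pglDiag (-1 : F) = stdGen ω 2 * (stdGen ω 0)⁻¹ * pglTrans 1 := by
      rw [stdGen_zero, stdGen_two, inv_one, mul_one, eq_comm]
      refine pgl_mul_eq 1 one_ne_zero (by simp) (by simp) ?_ ?_ ?_ ?_ <;> ring
    rw [e]
    exact mul_mem (mul_inv_mem_quotientSubgroup (by simp) (by simp))
      (pglTrans_mem_quotientSubgroup hω hω1 hgen 1)
  have h0 : pglDiag (-1 : F) ∈ quotientSubgroup (stdGen ω) {0}ᶜ := by
    have e : pglDiag (-1 : F) = stdGen ω 3 * (stdGen ω 1)⁻¹ * pgl 1 0 (ω + 1) 1 := by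
      rw [stdGen_three_mul_inv_one hω, eq_comm]
      refine pgl_mul_eq (-1) (by simp) (by simp) (by simp) ?_ ?_ ?_ ?_ <;> ring
    rw [e]
    exact mul_mem (mul_inv_mem_quotientSubgroup (by simp) (by simp))
      (pgl_lower_mem_quotientSubgroup hω hω1 hω2 hgen _)
  have h12 := h.mem_quotientSubgroup (K := {0, 3}) (x := pglDiag (-1 : F)) (by
    rintro i (rfl | rfl)
    · exact h0
    · exact h3)
  let D : Fˣ →* PGL(Fin 2, F) :=
    MonoidHom.mk' (fun u => pglDiag (u : F)) fun a b => by
      rw [Units.val_mul, pglDiag_mul a.ne_zero b.ne_zero]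
  have hle : quotientSubgroup (stdGen ω) ({0, 3}ᶜ) ≤ Subgroup.zpowers (D (Units.mk0 ω hω)) := by
    have hD : stdGen ω 2 * (stdGen ω 1)⁻¹ = D (Units.mk0 ω hω) := stdGen_two_mul_inv hω
    have hD' : stdGen ω 1 * (stdGen ω 2)⁻¹ = (D (Units.mk0 ω hω))⁻¹ := by
      rw [← hD, _root_.mul_inv_rev, inv_inv]
    refine (Subgroup.closure_le _).2 ?_
    rintro _ ⟨i, hi, j, hj, rfl⟩
    have h12 : ∀ i ∈ ({0, 3}ᶜ : Set (Fin 4)), i = 1 ∨ i = 2 := by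
      intro i hi
      fin_cases i
      · exact absurd (Or.inl rfl) hi
      · exact Or.inl rfl
      · exact Or.inr rfl
      · exact absurd (Or.inr rfl) hi
    rcases h12 i hi with rfl | rfl <;> rcases h12 j hj with rfl | rfl
    · rw [mul_inv_cancel]; exact one_mem _
    · rw [hD']; exact inv_mem (Subgroup.mem_zpowers _)
    · rw [hD]; exact Subgroup.mem_zpowers _
    · rw [mul_inv_cancel]; exact one_mem _
  obtain ⟨k, hk⟩ := hle h12
  refine ⟨k, ?_⟩
  have hk' : D (Units.mk0 ω hω ^ k) = pglDiag (-1 : F) := by rw [map_zpow]; exact hk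
  have := (pglDiag_eq_iff (Units.ne_zero _) (by simp)).1 hk'
  simpa using this

theorem aeval_eq_zero_of_hom_stdGen {ω' : F} (hω' : ω' ≠ 0) (hω1' : ω' ≠ 1)
    {θ : PGL(Fin 2, F) →* PGL(Fin 2, F)} (hθ : ∀ i, θ (stdGen ω i) = stdGen ω' i)
    {f : Polynomial ℤ} (hf : Polynomial.aeval ω f = 0) : Polynomial.aeval ω' f = 0 := by
  have hD : θ (pglDiag ω) = pglDiag ω' := by
    rw [← stdGen_two_mul_inv hω, ← stdGen_two_mul_inv hω', map_mul, map_inv, hθ, hθ]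
  refine aeval_eq_zero_of_hom hω hω' (mul_ne_zero one_ne_zero (sub_ne_zero.2 hω1'.symm)) hD
    (b := 1 * (1 - ω)) ?_ hf
  rw [← pgl_commutator hω, ← pgl_commutator hω', ← stdGen_two ω, map_mul, map_mul, map_mul,
    map_inv, map_inv, hD, hθ]
  rfl

/-- Composing a homomorphism that inverts the `stdGen ω i` with the conjugation by the involution
`stdGen ω 2` gives a homomorphism that inverts `x ↦ ω x` and maps a translation to a translation. -/
theorem aeval_inv_eq_zero_of_hom_stdGen (hω1 : ω ≠ 1)
    {θ : PGL(Fin 2, F) →* PGL(Fin 2, F)} (hθ : ∀ i, θ (stdGen ω i) = (stdGen ω i)⁻¹)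
    {f : Polynomial ℤ} (hf : Polynomial.aeval ω f = 0) : Polynomial.aeval ω⁻¹ f = 0 := by
  have h2 : (stdGen ω 2)⁻¹ = stdGen ω 2 := inv_eq_of_mul_eq_one_right (stdGen_two_mul_self ω)
  let θ' := (MulAut.conj (stdGen ω 2)).toMonoidHom.comp θ
  have hθ' : ∀ g, θ' g = stdGen ω 2 * θ g * (stdGen ω 2)⁻¹ := fun g => rfl
  have hD : θ' (pglDiag ω) = pglDiag ω⁻¹ := by
    rw [hθ', pglDiag_inv hω, ← stdGen_two_mul_inv hω, map_mul, map_inv, hθ, hθ, inv_inv,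
      _root_.mul_inv_rev, inv_inv, mul_inv_cancel_left]
  have hR : θ' (stdGen ω 2) = stdGen ω 2 := by
    rw [hθ', hθ, mul_inv_cancel, one_mul, h2]
  have hω1' : ω⁻¹ ≠ 1 := fun h => hω1 (inv_eq_one.1 h)
  refine aeval_eq_zero_of_hom hω (inv_ne_zero hω)
    (mul_ne_zero one_ne_zero (sub_ne_zero.2 hω1'.symm)) hD (b := 1 * (1 - ω)) ?_ hf
  rw [← pgl_commutator hω, ← pgl_commutator (inv_ne_zero hω), ← stdGen_two ω, map_mul, map_mul,
    map_mul, map_inv, map_inv, hD, hR]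

theorem pglFieldAut_stdGen (τ : F ≃+* F) (i : Fin 4) :
    pglFieldAut τ (stdGen ω i) = stdGen (τ ω) i := by
  fin_cases i
  · exact map_one _
  · change pglFieldAut τ (pgl (-1) 1 0 ω) = pgl (-1) 1 0 (τ ω)
    rw [pglFieldAut_pgl _ (det_stdGen_one hω)]
    simp
  · change pglFieldAut τ (pgl (-1) 1 0 1) = pgl (-1) 1 0 1
    rw [pglFieldAut_pgl _ (by simp)]
    simp
  · change pglFieldAut τ (pgl 1 (-1) (ω + 1) (-1)) = pgl 1 (-1) (τ ω + 1) (-1)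
    rw [pglFieldAut_pgl _ (det_stdGen_three hω)]
    simp

/-- If `ω` and `ω⁻¹` are conjugate, some automorphism inverts all `stdGen ω i`. -/
theorem exists_inverting_of_map_eq_inv {τ : F ≃+* F} (hτ : τ ω = ω⁻¹) :
    ∃ θ : PGL(Fin 2, F) ≃* PGL(Fin 2, F), ∀ i, θ (stdGen ω i) = (stdGen ω i)⁻¹ := by
  have hi := inv_ne_zero hω
  refine ⟨(pglFieldAut τ).trans (MulAut.conj (stdGen ω 2)), fun i => ?_⟩
  have h2 : (stdGen ω 2)⁻¹ = stdGen ω 2 := inv_eq_of_mul_eq_one_right (stdGen_two_mul_self ω)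
  change stdGen ω 2 * (pglFieldAut τ (stdGen ω i)) * (stdGen ω 2)⁻¹ = _
  rw [pglFieldAut_stdGen hω, hτ, h2, eq_inv_iff_mul_eq_one]
  have hd2 : (-1 : F) * 1 - 1 * 0 ≠ 0 := by simp
  fin_cases i
  · change stdGen ω 2 * 1 * stdGen ω 2 * 1 = 1
    rw [mul_one, mul_one, stdGen_two_mul_self]
  · change stdGen ω 2 * stdGen ω⁻¹ 1 * stdGen ω 2 * stdGen ω 1 = 1
    rw [mul_assoc, stdGen_two, stdGen_one, stdGen_one]
    rw [show pgl (-1) 1 0 1 * pgl (-1) 1 0 ω⁻¹ = pgl 1 (ω⁻¹ - 1) 0 ω⁻¹ from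
      pgl_mul_eq 1 one_ne_zero hd2 (det_stdGen_one hi) (by ring) (by ring) (by ring) (by ring),
      show pgl (-1) 1 0 1 * pgl (-1) 1 0 ω = pgl 1 (ω - 1) 0 ω from
      pgl_mul_eq 1 one_ne_zero hd2 (det_stdGen_one hω) (by ring) (by ring) (by ring) (by ring),
      ← pgl_one]
    refine pgl_mul_eq 1 one_ne_zero (by simpa) (by simpa) ?_ ?_ ?_ ?_ <;> field_simp <;> ring
  · change stdGen ω 2 * stdGen ω 2 * stdGen ω 2 * stdGen ω 2 = 1
    rw [stdGen_two_mul_self, one_mul, stdGen_two_mul_self]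
  · change stdGen ω 2 * stdGen ω⁻¹ 3 * stdGen ω 2 * stdGen ω 3 = 1
    rw [mul_assoc, stdGen_two, stdGen_three, stdGen_three]
    rw [show pgl (-1) 1 0 1 * pgl 1 (-1) (ω⁻¹ + 1) (-1) = pgl ω⁻¹ 0 (ω⁻¹ + 1) (-1) from
      pgl_mul_eq 1 one_ne_zero hd2 (det_stdGen_three hi) (by ring) (by ring) (by ring) (by ring),
      show pgl (-1) 1 0 1 * pgl 1 (-1) (ω + 1) (-1) = pgl ω 0 (ω + 1) (-1) from
      pgl_mul_eq 1 one_ne_zero hd2 (det_stdGen_three hω) (by ring) (by ring) (by ring) (by ring),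
      ← pgl_one]
    refine pgl_mul_eq 1 one_ne_zero (by simpa) (by simpa) ?_ ?_ ?_ ?_ <;> field_simp <;> ring

omit hω

/-- Up to conjugation, elements of `PGL(2, F)` with the relations of a chiral `4`-polytope and with
the required fixed points are standard generators. -/
theorem exists_conj_eq_stdGen {b : Fin 4 → PGL(Fin 2, F)} (h0 : b 0 = 1) (h2 : b 2 * b 2 = 1)
    (h3 : b 3 * b 3 = 1) (h13 : b 3 * (b 1)⁻¹ = b 1 * (b 3)⁻¹)
    (hx1 : b 1 • finPt (0 : F) = finPt 0) (hx2 : (b 2 * (b 1)⁻¹) • finPt (0 : F) = finPt 0)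
    (hy2 : (b 2 * (b 1)⁻¹) • infPt F = infPt F) (hy3 : (b 3 * (b 2)⁻¹) • infPt F = infPt F)
    (hx3 : b 3 • finPt (0 : F) ≠ finPt 0) (hy1 : b 1 • infPt F ≠ infPt F) :
    ∃ ω : F, ω ≠ 0 ∧ ∃ g : PGL(Fin 2, F), ∀ i, MulAut.conj g (b i) = stdGen ω i := by
  obtain ⟨x, y, z, w, hd, hs2⟩ := exists_eq_pgl (b 2 * (b 1)⁻¹)
  rw [hs2, pgl_smul_finPt_iff hd] at hx2
  rw [hs2, pgl_smul_infPt_iff hd] at hy2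
  subst hy2
  obtain rfl : z = 0 := by simpa using hx2
  simp only [zero_mul, sub_zero] at hd
  have hw : w ≠ 0 := right_ne_zero_of_mul hd
  have hx : x ≠ 0 := left_ne_zero_of_mul hd
  set ω := x / w with hωd
  have hω : ω ≠ 0 := div_ne_zero hx hw
  have hs2' : b 2 * (b 1)⁻¹ = pglDiag ω := by
    rw [hs2, ← pgl_smul (inv_ne_zero hw) (by simpa using hd)]
    congr 1
    · rw [hωd]; field_simp
    · ring
    · ring
    · field_simp
  have hb1 : b 1 = (pglDiag ω)⁻¹ * b 2 := by rw [← hs2']; group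
  have hDx : pglDiag ω • finPt (0 : F) = finPt 0 := by
    rw [pgl_smul_finPt_iff (by simpa)]; ring
  have hDy : pglDiag ω • infPt F = infPt F := by
    rw [pgl_smul_infPt_iff (by simpa)]
  have hb2x : b 2 • finPt (0 : F) = finPt 0 := by
    rw [hb1, mul_smul, inv_smul_eq_iff, hDx] at hx1
    exact hx1
  have hb2y : b 2 • infPt F ≠ infPt F := by
    intro h
    apply hy1
    rw [hb1, mul_smul, h, inv_smul_eq_iff, hDy]
  obtain ⟨s, c, t, r, hd', hb2⟩ := exists_eq_pgl (b 2)
  rw [hb2, pgl_smul_finPt_iff hd'] at hb2x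
  rw [hb2, Ne, pgl_smul_infPt_iff hd'] at hb2y
  obtain rfl : t = 0 := by simpa using hb2x
  have hr : r ≠ 0 := by
    rintro rfl
    simp at hd'
  have hs : s ≠ 0 := by
    rintro rfl
    simp at hd'
  -- An involution fixing the point `∞` but not `0` has the form `x ↦ e - x`.
  have hsr : s = -r := by
    rw [hb2, pgl_mul hd' hd', ← pgl_one, pgl_eq_pgl_iff] at h2
    · obtain ⟨k, hk, -, h, -, -⟩ := h2
      have h' : c * (s + r) = 0 := by
        rcases mul_eq_zero.1 h.symm with h | h
        · exact absurd h hk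
        · linear_combination h
      exact eq_neg_of_add_eq_zero_left ((mul_eq_zero.1 h').resolve_left hb2y)
    · have := mul_ne_zero hd' hd'
      rwa [show (s * s + c * 0) * (0 * c + r * r) - (s * c + c * r) * (0 * s + r * 0) =
        (s * r - c * 0) * (s * r - c * 0) by ring]
    · simp
  subst hsr
  set e := c / r with hed
  have he : e ≠ 0 := div_ne_zero hb2y hr
  have hb2' : b 2 = pgl (-1) e 0 1 := by
    rw [hb2, ← pgl_smul (inv_ne_zero hr) hd']
    congr 1
    · field_simp
    · rw [hed]; field_simp
    · ring
    · field_simp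
  -- The conjugation by the diagonal element turns `e` into `1`.
  let g := pglDiag e⁻¹
  have hei := inv_ne_zero he
  have hg : g⁻¹ = pglDiag e := by rw [← pglDiag_inv hei, inv_inv]
  have gb2 : MulAut.conj g (b 2) = stdGen ω 2 := by
    rw [MulAut.conj_apply, mul_inv_eq_iff_eq_mul, hb2', stdGen_two, pgl_mul (by simpa) (by simp),
      pgl_mul (by simp) (by simpa)]
    congr 1 <;> field_simp <;> ring
  have gD : MulAut.conj g (pglDiag ω) = pglDiag ω := by
    rw [MulAut.conj_apply, mul_inv_eq_iff_eq_mul, ← pglDiag_mul hei hω, ← pglDiag_mul hω hei,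
      mul_comm]
  have gb1 : MulAut.conj g (b 1) = stdGen ω 1 := by
    rw [hb1, map_mul, map_inv, gD, gb2, ← stdGen_two_mul_inv hω]
    group
  have hgx : g • finPt (0 : F) = finPt 0 := by
    rw [pgl_smul_finPt_iff (by simpa)]; ring
  have hgy : g • infPt F = infPt F := by
    rw [pgl_smul_infPt_iff (by simpa)]
  have hgx' : g⁻¹ • finPt (0 : F) = finPt 0 := by rw [inv_smul_eq_iff, hgx]
  have hgy' : g⁻¹ • infPt F = infPt F := by rw [inv_smul_eq_iff, hgy]
  set b3 := MulAut.conj g (b 3) with hb3d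
  have h3' : b3 * b3 = 1 := by rw [hb3d, ← map_mul, h3, map_one]
  have h13' : b3 * (stdGen ω 1)⁻¹ = stdGen ω 1 * b3⁻¹ := by
    rw [hb3d, ← gb1, ← map_inv, ← map_inv, ← map_mul, ← map_mul, h13]
  have hy3' : (b3 * (stdGen ω 2)⁻¹) • infPt F = infPt F := by
    rw [hb3d, ← gb2, ← map_inv, ← map_mul, MulAut.conj_apply, mul_smul, mul_smul, hgy', hy3, hgy]
  have hx3' : b3 • finPt (0 : F) ≠ finPt 0 := by
    rw [hb3d, MulAut.conj_apply, mul_smul, mul_smul, hgx']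
    intro h
    apply hx3
    have h' : b 3 • finPt (0 : F) = g⁻¹ • finPt 0 := by rw [eq_inv_smul_iff, h]
    rw [h', hgx']
  refine ⟨ω, hω, g, fun i => ?_⟩
  fin_cases i
  · change MulAut.conj g (b 0) = 1
    rw [h0, map_one]
  · exact gb1
  · exact gb2
  · change b3 = _
    obtain ⟨x, y, z, w, hd, hs3⟩ := exists_eq_pgl (b3 * (stdGen ω 2)⁻¹)
    rw [hs3, pgl_smul_infPt_iff hd] at hy3'
    subst hy3'
    have hx : x ≠ 0 := by
      rintro rfl
      simp at hd
    have hw : w ≠ 0 := by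
      rintro rfl
      simp at hd
    have hb3 : b3 = pgl (-x) x (-z) (z + w) := by
      rw [mul_inv_eq_iff_eq_mul] at hs3
      rw [hs3, stdGen_two]
      refine pgl_mul_eq 1 one_ne_zero hd (by simp) ?_ ?_ ?_ ?_ <;> ring
    have hd3 : -x * (z + w) - x * -z ≠ 0 := by
      rw [show -x * (z + w) - x * -z = -(x * w) by ring]
      exact neg_ne_zero.2 (mul_ne_zero hx hw)
    have hz : z ≠ 0 := by
      rintro rfl
      apply hx3'
      rw [hb3, pgl_smul_finPt_iff hd3]
      ring
    have ez : z = x - w := by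
      rw [hb3, pgl_mul hd3 hd3, ← pgl_one, pgl_eq_pgl_iff] at h3'
      · obtain ⟨k, hk, -, h, -, -⟩ := h3'
        have h' : x * (z - (x - w)) = 0 := by
          rcases mul_eq_zero.1 h.symm with h | h
          · exact absurd h hk
          · linear_combination h
        exact sub_eq_zero.1 ((mul_eq_zero.1 h').resolve_left hx)
      · have := mul_ne_zero hd3 hd3
        refine fun h0 => this ?_
        linear_combination h0
      · simp
    -- The product `σ₃ σ₂` is an involution.
    have ex : x * ω = -w := by
      have hdω : x * ω * w - 0 * (z * ω) ≠ 0 := by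
        simpa using mul_ne_zero (mul_ne_zero hx hω) hw
      have e1 : b3 * (stdGen ω 1)⁻¹ = pgl (x * ω) 0 (z * ω) w := by
        rw [show b3 * (stdGen ω 1)⁻¹ =
          b3 * (stdGen ω 2)⁻¹ * (stdGen ω 2 * (stdGen ω 1)⁻¹) by group, hs3,
          stdGen_two_mul_inv hω]
        refine pgl_mul_eq 1 one_ne_zero hd (by simpa) ?_ ?_ ?_ ?_ <;> ring
      have e2 : b3 * (stdGen ω 1)⁻¹ * (b3 * (stdGen ω 1)⁻¹) = 1 := by
        nth_rewrite 2 [h13']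
        group
      rw [e1, pgl_mul hdω hdω, ← pgl_one, pgl_eq_pgl_iff] at e2
      · obtain ⟨k, hk, -, -, h, -⟩ := e2
        have h' : (z * ω) * (x * ω + w) = 0 := by
          rcases mul_eq_zero.1 h.symm with h | h
          · exact absurd h hk
          · linear_combination h
        exact eq_neg_of_add_eq_zero_left
          ((mul_eq_zero.1 h').resolve_left (mul_ne_zero hz hω))
      · have := mul_ne_zero hdω hdω
        refine fun h0 => this ?_
        linear_combination h0
      · simp
    change b3 = pgl 1 (-1) (ω + 1) (-1)
    rw [hb3, ← pgl_smul (neg_ne_zero.2 hx) (det_stdGen_three hω)]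
    congr 1
    · ring
    · ring
    · rw [ez]; linear_combination ex
    · rw [ez]; ring

end StdGen

/-! ### Elements of finite fields -/

section FiniteField

variable {F : Type v} [Field F] {ω : F}

theorem pow_sub_one_eq_one_iff (hω : ω ≠ 0) {m : ℕ} (hm : m ≠ 0) : ω ^ (m - 1) = 1 ↔ ω ^ m = ω := by
  rw [← mul_left_inj' hω, ← pow_succ, one_mul, Nat.sub_add_cancel (Nat.pos_of_ne_zero hm)]

theorem pow_add_one_eq_one_iff (hω : ω ≠ 0) {m : ℕ} : ω ^ (m + 1) = 1 ↔ ω ^ m = ω⁻¹ := by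
  rw [pow_succ, ← mul_inv_eq_one₀ (inv_ne_zero hω), inv_inv]

variable [Fintype F] {p d : ℕ} [CharP F p]

/-- An element that lies in no proper subfield generates the field. -/
theorem closure_singleton_eq_top (hF : Fintype.card F = p ^ d)
    (h : ∀ e, 1 ≤ e → e < d → ω ^ p ^ e ≠ ω) : Subring.closure {ω} = ⊤ := by
  classical
  set R := Subring.closure ({ω} : Set F) with hR
  let : Field R := Fintype.fieldOfDomain R
  have hc : CharP R p := (RingHom.charP_iff (R := R) (A := F) R.subtype R.subtype_injective p).2 ‹_›
  obtain ⟨n, hp, hn⟩ := FiniteField.card R p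
  have hω : ω ∈ R := Subring.subset_closure rfl
  have h1 : ω ^ p ^ (n : ℕ) = ω := by
    have := FiniteField.pow_card (⟨ω, hω⟩ : R)
    rw [hn] at this
    exact congrArg Subtype.val this
  have hdn : d ≤ n := not_lt.1 fun hlt => h n n.pos hlt h1
  have hcard : Fintype.card F ≤ Fintype.card R := by
    rw [hF, hn]
    exact Nat.pow_le_pow_right hp.pos hdn
  rw [eq_top_iff]
  intro x _
  obtain ⟨y, rfl⟩ := ((Fintype.bijective_iff_injective_and_card (Subtype.val : R → F)).2
    ⟨Subtype.val_injective, le_antisymm (Fintype.card_le_of_injective _ Subtype.val_injective)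
      hcard⟩).2 x
  exact y.2

/-- Elements with the same polynomial relations are conjugate under a power of the Frobenius
automorphism. -/
theorem exists_eq_pow_of_aeval [Fact p.Prime] (hF : Fintype.card F = p ^ d)
    (hgen : Subring.closure {ω} = ⊤) {ω' : F}
    (h : ∀ f : Polynomial ℤ, Polynomial.aeval ω f = 0 → Polynomial.aeval ω' f = 0) :
    ∃ e < d, ω' = ω ^ p ^ e := by
  let φ : Polynomial ℤ →+* F := (Polynomial.aeval ω : Polynomial ℤ →ₐ[ℤ] F).toRingHom
  let ψ : Polynomial ℤ →+* F := (Polynomial.aeval ω' : Polynomial ℤ →ₐ[ℤ] F).toRingHom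
  have hφ : Function.Surjective φ := by
    rw [← RingHom.range_eq_top, eq_top_iff, ← hgen, Subring.closure_le, Set.singleton_subset_iff]
    exact ⟨Polynomial.X, Polynomial.aeval_X ω⟩
  have hk : RingHom.ker φ ≤ RingHom.ker ψ := fun f hf => h f hf
  let τ : F →+* F := RingHom.liftOfSurjective φ hφ ⟨ψ, hk⟩
  have hτ : τ ω = ω' := by
    have h1 := RingHom.liftOfSurjective_comp_apply φ hφ ⟨ψ, hk⟩ Polynomial.X
    have h2 : φ Polynomial.X = ω := Polynomial.aeval_X ω
    have h3 : ψ Polynomial.X = ω' := Polynomial.aeval_X ω'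
    rw [h2] at h1
    exact h1.trans h3
  let := ZMod.algebra F p
  let τ' : F →ₐ[ZMod p] F :=
    { τ with
      commutes' := fun r => RingHom.congr_fun (Subsingleton.elim
        (τ.comp (algebraMap (ZMod p) F)) (algebraMap (ZMod p) F)) r }
  have hb : Function.Bijective τ' := Finite.injective_iff_bijective.1 τ.injective
  obtain ⟨i, hi⟩ := FiniteField.exists_forall_apply_eq_pow (ZMod p) p F
    (AlgEquiv.ofBijective τ' hb)
  have hi' : ω' = ω ^ p ^ i := by
    rw [← hτ]
    have := hi ω
    rwa [Nat.card_zmod] at this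
  have hd : 0 < d := by
    rcases Nat.eq_zero_or_pos d with rfl | h
    · have := Fintype.one_lt_card (α := F)
      rw [hF] at this
      simp at this
    · exact h
  have hper : ∀ j : ℕ, ω ^ p ^ (d * j) = ω := by
    intro j
    induction j with
    | zero => simp
    | succ j ih => rw [Nat.mul_succ, pow_add, pow_mul, ih, ← hF, FiniteField.pow_card]
  refine ⟨i % d, Nat.mod_lt _ hd, ?_⟩
  rw [hi']
  conv_lhs => rw [← Nat.div_add_mod i d, pow_add, pow_mul, hper]

end FiniteField

/-! ### Admissible orders -/

section Admissible

variable {F : Type v} [Field F] {p d : ℕ} {ω : F}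

theorem AdmissiblePGL.ne_zero (h : AdmissiblePGL p d (orderOf ω)) : ω ≠ 0 := by
  rintro rfl
  have := h.1
  rw [orderOf_zero] at this
  omega

theorem AdmissiblePGL.ne_one (h : AdmissiblePGL p d (orderOf ω)) : ω ≠ 1 := by
  rintro rfl
  have := h.1
  rw [orderOf_one] at this
  omega

theorem AdmissiblePGL.sq_ne_one (h : AdmissiblePGL p d (orderOf ω)) : ω ^ 2 ≠ 1 := fun h2 =>
  absurd (Nat.le_of_dvd two_pos (orderOf_dvd_of_pow_eq_one h2)) (not_le.2 h.1)

theorem AdmissiblePGL.ne_neg_one (h : AdmissiblePGL p d (orderOf ω)) : ω ≠ -1 := by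
  rintro rfl
  exact h.sq_ne_one (by ring)

theorem AdmissiblePGL.pow_ne [Fact p.Prime] (h : AdmissiblePGL p d (orderOf ω)) {e : ℕ} (h1 : 1 ≤ e)
    (he : e < d) : ω ^ p ^ e ≠ ω := by
  rw [Ne, ← pow_sub_one_eq_one_iff h.ne_zero (pow_ne_zero _ (Fact.out : p.Prime).ne_zero),
    ← orderOf_dvd_iff_pow_eq_one]
  exact (h.2.2.2 e h1 he).2

theorem AdmissiblePGL.inv_ne_pow (h : AdmissiblePGL p d (orderOf ω)) {e : ℕ} (he : e < d) :
    ω⁻¹ ≠ ω ^ p ^ e := by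
  intro h'
  have h'' := (pow_add_one_eq_one_iff h.ne_zero).2 h'.symm
  rcases Nat.eq_zero_or_pos e with rfl | h1
  · exact h.sq_ne_one (by simpa using h'')
  · exact (h.2.2.2 e h1 he).1 (orderOf_dvd_of_pow_eq_one h'')

theorem neg_pow_eq_one {m n : ℕ} (h1 : (-1 : F) ≠ 1) {x : F}
    (hx : x ^ m = -1) (hn : x ^ n = 1) : (-x) ^ n = 1 := by
  rcases Nat.even_or_odd n with he | ho
  · rwa [he.neg_pow]
  · exfalso
    apply h1
    calc (-1 : F) = (-1) ^ n := ho.neg_one_pow.symm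
      _ = (x ^ m) ^ n := by rw [hx]
      _ = (x ^ n) ^ m := by rw [← pow_mul, ← pow_mul, mul_comm]
      _ = 1 := by rw [hn, one_pow]

theorem orderOf_neg_inv : orderOf (-ω⁻¹) = orderOf (-ω) := by
  rw [orderOf_eq_orderOf_iff]
  intro n
  rw [show -ω⁻¹ = (-ω)⁻¹ from inv_neg.symm, inv_pow, inv_eq_one]

theorem ringChar_eq_prime [CharP F p] : ringChar F = p := ringChar.eq_iff.2 ‹_›

theorem neg_one_eq_one_of_eq_two [CharP F p] (hp : p = 2) : (-1 : F) = 1 := by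
  subst hp
  exact CharTwo.neg_eq 1

variable [Fintype F] [CharP F p]

theorem AdmissiblePGL.closure_eq_top [Fact p.Prime] (hF : Fintype.card F = p ^ d)
    (h : AdmissiblePGL p d (orderOf ω)) : Subring.closure {ω} = ⊤ :=
  closure_singleton_eq_top hF fun _ h1 he => h.pow_ne h1 he

theorem odd_of_ne_two (hF : Fintype.card F = p ^ d) (hp : p ≠ 2) : p ^ d % 2 = 1 := by
  rw [← hF]
  exact FiniteField.odd_card_of_char_ne_two (by rwa [ringChar_eq_prime (p := p)])

theorem AdmissiblePGL.pow_half_eq (hF : Fintype.card F = p ^ d)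
    (h : AdmissiblePGL p d (orderOf ω)) (hp : p ≠ 2) : ω ^ ((p ^ d - 1) / 2) = -1 := by
  have h1 : ω ^ ((p ^ d - 1) / 2) ≠ 1 := fun h' => h.2.2.1 (orderOf_dvd_of_pow_eq_one h')
  have h2 := odd_of_ne_two hF hp
  have h3 := FiniteField.pow_dichotomy (F := F) (by rwa [ringChar_eq_prime (p := p)]) h.ne_zero
  rw [hF, show p ^ d / 2 = (p ^ d - 1) / 2 by omega] at h3
  exact h3.resolve_left h1

theorem AdmissiblePGL.exists_pow_eq_neg_one (hF : Fintype.card F = p ^ d)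
    (h : AdmissiblePGL p d (orderOf ω)) : ∃ m : ℕ, ω ^ m = -1 := by
  by_cases hp : p = 2
  · exact ⟨0, by rw [pow_zero, neg_one_eq_one_of_eq_two hp]⟩
  · exact ⟨_, h.pow_half_eq hF hp⟩

theorem AdmissiblePGL.isSquare_or (hF : Fintype.card F = p ^ d)
    (h : AdmissiblePGL p d (orderOf ω)) (δ : F) : IsSquare δ ∨ IsSquare (δ * ω) := by
  by_cases hp : p = 2
  · exact Or.inl (FiniteField.isSquare_of_char_two (by rwa [ringChar_eq_prime (p := p)]) δ)
  · have hp' : ringChar F ≠ 2 := by rwa [ringChar_eq_prime (p := p)]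
    rcases eq_or_ne δ 0 with rfl | hδ
    · exact Or.inl (IsSquare.zero)
    have h2 := odd_of_ne_two hF hp
    have h3 := h.pow_half_eq hF hp
    rw [FiniteField.isSquare_iff hp' hδ, FiniteField.isSquare_iff hp' (mul_ne_zero hδ h.ne_zero)]
    rcases FiniteField.pow_dichotomy hp' hδ with h4 | h4
    · exact Or.inl h4
    · refine Or.inr ?_
      rw [mul_pow, h4, hF, show p ^ d / 2 = (p ^ d - 1) / 2 by omega, h3]
      ring

/-- If `q` is odd then `ω ^ ((q - 1) / 2) = -1`, where the exponent is even. So `ω` and `-ω` have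
even order. -/
theorem AdmissiblePGL.orderOf_neg_inv (hF : Fintype.card F = p ^ d)
    (h : AdmissiblePGL p d (orderOf ω)) (h4 : p ^ d % 4 ≠ 3) :
    orderOf (-ω⁻¹) = orderOf ω := by
  rw [_root_.orderOf_neg_inv]
  by_cases hp : p = 2
  · rw [neg_eq_neg_one_mul, neg_one_eq_one_of_eq_two hp, one_mul]
  have h2 := odd_of_ne_two hF hp
  have h3 := h.pow_half_eq hF hp
  have hev : Even ((p ^ d - 1) / 2) := by
    rw [Nat.even_iff]
    omega
  have h1 : (-1 : F) ≠ 1 := Ring.neg_one_ne_one_of_char_ne_two (by rwa [ringChar_eq_prime (p := p)])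
  rw [orderOf_eq_orderOf_iff]
  intro n
  refine ⟨fun hn => ?_, neg_pow_eq_one h1 h3⟩
  have := neg_pow_eq_one h1 (x := -ω) (by rwa [hev.neg_pow]) hn
  rwa [neg_neg] at this

/-- Here `ω ^ ((q - 1) / 2) = -1` with an odd exponent, so that `-ω` has odd order. -/
theorem AdmissiblePGL.orderOf_neg_inv_of_mod (hF : Fintype.card F = p ^ d)
    (h : AdmissiblePGL p d (orderOf ω)) (h4 : p ^ d % 4 = 3) :
    orderOf (-ω⁻¹) = orderOf ω / 2 := by
  rw [_root_.orderOf_neg_inv]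
  have hp : p ≠ 2 := by
    rintro rfl
    rcases Nat.eq_zero_or_pos d with rfl | hd
    · simp at h4
    · have : 2 ∣ 2 ^ d := dvd_pow_self _ hd.ne'
      omega
  have h3 := h.pow_half_eq hF hp
  have hodd : Odd ((p ^ d - 1) / 2) := by
    rw [Nat.odd_iff]
    omega
  have h5 : Odd (orderOf (-ω)) := by
    refine hodd.of_dvd_nat (orderOf_dvd_of_pow_eq_one ?_)
    rw [hodd.neg_pow, h3, neg_neg]
  have h6 : orderOf (-1 : F) = 2 := by
    rw [orderOf_neg_one, if_neg (by rwa [ringChar_eq_prime (p := p)])]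
  have h7 : orderOf (-1 * -ω) = orderOf (-1 : F) * orderOf (-ω) := by
    refine (Commute.all _ _).orderOf_mul_eq_mul_orderOf_of_coprime ?_
    rw [h6]
    exact h5.coprime_two_left
  rw [neg_one_mul, neg_neg, h6] at h7
  omega

end Admissible

/-! ### Chiral polytopes and parameters -/

section Parameter

open Projectivization AbstractPolytope

variable {F : Type v} [Field F]

instance [Finite F] : Finite (PGL(Fin 2, F)) :=
  Finite.of_surjective (fun q : F × F × F × F => pgl q.1 q.2.1 q.2.2.1 q.2.2.2) fun g => by
    obtain ⟨x, y, z, w, -, h⟩ := exists_eq_pgl g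
    exact ⟨(x, y, z, w), h.symm⟩

/-- The polytope `X` is the one whose flags are described by the standard generators with parameter
`ω`. -/
def HasParameter (X : BasedPolytope.{u} 4) (ω : F) : Prop :=
  FlagModel X (groupAdj (stdGen ω)) (1, false)

variable {X Y : BasedPolytope.{u} 4} {ω ω' : F}

theorem HasParameter.hasType [Finite F] (h : HasParameter X ω) (hω : ω ≠ 0) (hω2 : ω ≠ -1) :
    X.HasType ![orderOf (-ω⁻¹), orderOf ω, orderOf (-ω⁻¹)] := by
  convert FlagModel.hasType h using 1
  funext i
  fin_cases i
  · change orderOf (-ω⁻¹) = orderOf (stdGen ω 1 * (stdGen ω 0)⁻¹)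
    rw [stdGen_zero, inv_one, mul_one, orderOf_stdGen_one hω hω2]
  · change orderOf ω = orderOf (stdGen ω 2 * (stdGen ω 1)⁻¹)
    rw [stdGen_two_mul_inv hω, orderOf_pglDiag hω]
  · change orderOf (-ω⁻¹) = orderOf (stdGen ω 3 * (stdGen ω 2)⁻¹)
    rw [orderOf_stdGen_three_mul_inv hω]

theorem exists_smul_ne_of_closure_range {b : Fin 4 → PGL(Fin 2, F)}
    (hb : Subgroup.closure (Set.range b) = ⊤) (x : ℙ F (Fin 2 → F)) : ∃ i, b i • x ≠ x := by
  by_contra! h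
  obtain ⟨g, hg⟩ := exists_smul_ne x
  have hle : Subgroup.closure (Set.range b) ≤ MulAction.stabilizer _ x := by
    rw [Subgroup.closure_le]
    rintro _ ⟨i, rfl⟩
    exact h i
  exact hg (hle (hb ▸ Subgroup.mem_top g))

/-- The two fixed points differ, and the identification with `PGL(2, F)` can be chosen such that
they are `∞` and `0`. -/
theorem exists_hasParameter (hX : X.IsChiralPGLWithFixedPoints F) :
    ∃ ω : F, ω ≠ 0 ∧ HasParameter X ω := by
  obtain ⟨hch, f, ⟨x, hx⟩, ⟨y, hy⟩⟩ := hX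
  obtain ⟨b, hb0, hb⟩ := exists_groupModel hch f
  have hpoly := hb.flagModel.isPolytopal
  have hxs := (hb.map_mem_parabolic (i := 0) (j := 1) (k := 2) rfl rfl
    (H := MulAction.stabilizer _ x)).1 hx
  have hys := (hb.map_mem_parabolic (i := 1) (j := 2) (k := 3) rfl rfl
    (H := MulAction.stabilizer _ y)).1 hy
  rw [hb0, inv_one, mul_one] at hxs
  obtain ⟨hx1, hx2⟩ := hxs
  obtain ⟨hy2, hy3⟩ := hys
  have hb2x : b 2 ∈ MulAction.stabilizer _ x := by simpa using mul_mem hx2 hx1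
  have h0 : ∀ z : ℙ F (Fin 2 → F), b 0 • z = z := fun z => by rw [hb0, one_smul]
  have hx3 : b 3 • x ≠ x := by
    intro h3
    obtain ⟨i, hi⟩ := exists_smul_ne_of_closure_range hpoly.closure_range x
    fin_cases i
    · exact hi (h0 x)
    · exact hi hx1
    · exact hi hb2x
    · exact hi h3
  have hy1 : b 1 • y ≠ y := by
    intro h1
    obtain ⟨i, hi⟩ := exists_smul_ne_of_closure_range hpoly.closure_range y
    have h2 : b 2 ∈ MulAction.stabilizer _ y := by
      simpa using mul_mem hy2 (show b 1 ∈ MulAction.stabilizer _ y from h1)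
    have h3 : b 3 ∈ MulAction.stabilizer _ y := by simpa using mul_mem hy3 h2
    fin_cases i
    · exact hi (h0 y)
    · exact hi h1
    · exact hi h2
    · exact hi h3
  have hxy : x ≠ y := by
    rintro rfl
    exact hy1 hx1
  obtain ⟨g, hg0, hgi⟩ := exists_smul_eq_pair hxy
  have key : ∀ (c : PGL(Fin 2, F)) (z z' : ℙ F (Fin 2 → F)), g • z = z' →
      (MulAut.conj g⁻¹ c • z = z ↔ c • z' = z') := by
    rintro c z _ rfl
    rw [MulAut.conj_apply, inv_inv, mul_smul, mul_smul, inv_smul_eq_iff]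
  have h2 := hpoly.mul_inv_eq (i := 0) (j := 2) (by decide)
  have h3 := hpoly.mul_inv_eq (i := 0) (j := 3) (by decide)
  have h13 := hpoly.mul_inv_eq (i := 1) (j := 3) (by decide)
  rw [hb0, inv_one, mul_one, one_mul, eq_inv_iff_mul_eq_one] at h2 h3
  obtain ⟨ω, hω, k, hk⟩ := exists_conj_eq_stdGen (b := fun i => MulAut.conj g⁻¹ (b i))
    (by rw [hb0, map_one]) (by rw [← map_mul, h2, map_one]) (by rw [← map_mul, h3, map_one])
    (by simp only [← map_inv (MulAut.conj g⁻¹), ← map_mul, h13])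
    ((key _ _ _ hg0).2 hx1) (by rw [← map_inv, ← map_mul]; exact (key _ _ _ hg0).2 hx2)
    (by rw [← map_inv, ← map_mul]; exact (key _ _ _ hgi).2 hy2)
    (by rw [← map_inv, ← map_mul]; exact (key _ _ _ hgi).2 hy3)
    (fun h => hx3 ((key _ _ _ hg0).1 h)) (fun h => hy1 ((key _ _ _ hgi).1 h))
  refine ⟨ω, hω, ?_⟩
  have := hb.flagModel.map_groupAdj ((MulAut.conj g⁻¹).trans (MulAut.conj k))
  have e : (fun i => ((MulAut.conj g⁻¹).trans (MulAut.conj k)) (b i)) = stdGen ω := funext hk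
  rwa [e] at this

/-- For `ω = 1` the generator `σ₂` is trivial. -/
theorem HasParameter.ne_one (h : HasParameter X ω) : ω ≠ 1 := by
  rintro rfl
  exact FlagModel.isPolytopal h |>.apply_ne (i := 1) (j := 2) (by decide) (1, false) rfl

/-- For `ω = -1` all generators fix `∞`. -/
theorem HasParameter.ne_neg_one (h : HasParameter X ω) : ω ≠ -1 := by
  rintro rfl
  obtain ⟨i, hi⟩ :=
    exists_smul_ne_of_closure_range (FlagModel.isPolytopal h).closure_range (finPt (0 : F))
  apply hi
  fin_cases i
  · exact one_smul _ _
  · change pgl (-1) 1 0 (-1) • finPt (0 : F) = finPt 0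
    rw [pgl_smul_finPt_iff (by simp)]
    ring
  · change pgl (-1) 1 0 1 • finPt (0 : F) = finPt 0
    rw [pgl_smul_finPt_iff (by simp)]
    ring
  · change pgl 1 (-1) (-1 + 1) (-1) • finPt (0 : F) = finPt 0
    rw [pgl_smul_finPt_iff (by simp)]
    ring

/-- A field automorphism that fixes the parameter is trivial, since it induces the identity on
`PGL(2, F)`. -/
theorem HasParameter.eq_refl_of_apply_eq (h : HasParameter X ω) (hω : ω ≠ 0) {τ : F ≃+* F}
    (hτ : τ ω = ω) (x : F) : τ x = x := by
  rcases eq_or_ne x 0 with rfl | hx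
  · exact map_zero τ
  have h1 : (pglFieldAut τ).toMonoidHom = MonoidHom.id _ :=
    MonoidHom.eq_of_eqOn_dense (FlagModel.isPolytopal h).closure_range (by
      rintro _ ⟨i, rfl⟩
      change pglFieldAut τ (stdGen ω i) = stdGen ω i
      rw [pglFieldAut_stdGen hω, hτ])
  have h2 : pglFieldAut τ (pglDiag x) = pglDiag x := DFunLike.congr_fun h1 (pglDiag x)
  have h3 : pglFieldAut τ (pglDiag x) = pglDiag (τ x) := by
    unfold pglDiag
    rw [pglFieldAut_pgl _ (by simpa)]
    simp
  rw [h3] at h2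
  exact (pglDiag_eq_iff ((map_ne_zero τ).2 hx) hx).1 h2

variable [Fintype F] {p d : ℕ} [Fact p.Prime] [CharP F p]

theorem HasParameter.pow_ne (h : HasParameter X ω) (hω : ω ≠ 0) (hF : Fintype.card F = p ^ d)
    {e : ℕ} (h1 : 1 ≤ e) (he : e < d) : ω ^ p ^ e ≠ ω := by
  intro hp
  have hall : ∀ x : F, x ^ p ^ e = x := fun x =>
    h.eq_refl_of_apply_eq hω (τ := iterateFrobeniusEquiv F p e) hp x
  -- A generator of `Fˣ` lies in no proper subfield.
  obtain ⟨g, hg⟩ := IsCyclic.exists_generator (α := Fˣ)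
  have hord : orderOf g = p ^ d - 1 := by
    classical
    rw [orderOf_eq_card_of_forall_mem_zpowers hg, Nat.card_eq_fintype_card, Fintype.card_units, hF]
  have hp1 : 1 < p := (Fact.out : p.Prime).one_lt
  have hlt : p ^ e < p ^ d := Nat.pow_lt_pow_right hp1 he
  have h1e : 1 < p ^ e := Nat.one_lt_pow (by omega) hp1
  have : orderOf g ∣ p ^ e - 1 := by
    rw [← orderOf_units, orderOf_dvd_iff_pow_eq_one,
      pow_sub_one_eq_one_iff g.ne_zero (by omega)]
    exact hall g
  have := Nat.le_of_dvd (by omega) this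
  omega

/-- The parameter of a chiral polytope has admissible order. -/
theorem HasParameter.admissible (h : HasParameter X ω) (hX : X.IsChiral) (hω : ω ≠ 0)
    (hF : Fintype.card F = p ^ d) (hq : 4 < p ^ d) : AdmissiblePGL p d (orderOf ω) := by
  have hω1 := h.ne_one
  have hω2 := h.ne_neg_one
  have hpp : p.Prime := Fact.out
  have hpow : ∀ e, 1 ≤ e → e < d → ω ^ p ^ e ≠ ω := fun e h1 he => h.pow_ne hω hF h1 he
  have hk : ∀ e, 1 ≤ e → e < d → ¬ orderOf ω ∣ p ^ e - 1 := by
    intro e h1 he hdvd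
    rw [orderOf_dvd_iff_pow_eq_one,
      pow_sub_one_eq_one_iff hω (pow_ne_zero _ hpp.ne_zero)] at hdvd
    exact hpow e h1 he hdvd
  have hgen : Subring.closure {ω} = ⊤ := closure_singleton_eq_top hF hpow
  refine ⟨?_, ?_, ?_, fun e h1 he => ⟨fun hdvd => ?_, hk e h1 he⟩⟩
  · have h0 : orderOf ω ≠ 0 := by
      rw [orderOf_ne_zero_iff]
      exact isOfFinOrder_iff_pow_eq_one.2
        ⟨Fintype.card F - 1, Nat.sub_pos_of_lt Fintype.one_lt_card,
          FiniteField.pow_card_sub_one_eq_one ω hω⟩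
    have h1 : orderOf ω ≠ 1 := fun h => hω1 (orderOf_eq_one_iff.1 h)
    have h2 : orderOf ω ≠ 2 := by
      intro h2
      have h2' := pow_orderOf_eq_one ω
      rw [h2, sq_eq_one_iff] at h2'
      exact h2'.elim hω1 hω2
    omega
  · rw [orderOf_dvd_iff_pow_eq_one, ← hF]
    exact FiniteField.pow_card_sub_one_eq_one ω hω
  · intro hdvd
    by_cases hp : p = 2
    · subst hp
      have hd : 3 ≤ d := by
        by_contra! hlt
        have : 2 ^ d ≤ 2 ^ 2 := Nat.pow_le_pow_right two_pos (by omega)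
        omega
      -- In even characteristic the truncated quotient `(q - 1) / 2` is `2 ^ (d - 1) - 1`.
      refine hk (d - 1) (by omega) (by omega) ?_
      have : 2 ^ d = 2 * 2 ^ (d - 1) := by rw [← pow_succ', Nat.sub_add_cancel (by omega)]
      rwa [show (2 ^ d - 1) / 2 = 2 ^ (d - 1) - 1 by omega] at hdvd
    · have hp' : ringChar F ≠ 2 := by rwa [ringChar_eq_prime (p := p)]
      have hodd := odd_of_ne_two hF hp
      have hsq : IsSquare ω := by
        rw [FiniteField.isSquare_iff hp' hω, hF, show p ^ d / 2 = (p ^ d - 1) / 2 by omega]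
        exact orderOf_dvd_iff_pow_eq_one.1 hdvd
      have hpoly := FlagModel.isPolytopal h
      -- `-1` is a power of the square `ω`.
      have hneg : IsSquare (-1 : F) := by
        obtain ⟨k, hk⟩ := exists_pow_eq_neg_one_of_isPolytopal hω hpoly hω1 hω2 hgen
        rw [← hk]
        exact hsq.zpow k
      -- So all generators have square determinants.
      obtain ⟨δ, hδ⟩ := FiniteField.exists_nonsquare hp'
      refine hδ (isSquare_of_closure_eq_top hpoly.closure_range ?_ δ)
      rintro _ ⟨i, rfl⟩
      fin_cases i
      · exact ⟨1, 0, 0, 1, by simp, pgl_one.symm, by simp⟩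
      · refine ⟨-1, 1, 0, ω, det_stdGen_one hω, rfl, ?_⟩
        rw [mul_zero, sub_zero]
        exact hneg.mul hsq
      · exact ⟨-1, 1, 0, 1, by simp, rfl, by simpa using hneg⟩
      · refine ⟨1, -1, ω + 1, -1, det_stdGen_three hω, rfl, ?_⟩
        rwa [show (1 : F) * -1 - -1 * (ω + 1) = ω by ring]
  · rw [orderOf_dvd_iff_pow_eq_one, pow_add_one_eq_one_iff hω] at hdvd
    obtain ⟨θ, hθ⟩ :=
      exists_inverting_of_map_eq_inv hω (τ := iterateFrobeniusEquiv F p e) hdvd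
    exact FlagModel.not_isChiral h (stdGen_zero ω) θ hθ hX

/-- Every element of admissible order is the parameter of some polytope. -/
theorem exists_hasParameter_of_admissible (hF : Fintype.card F = p ^ d)
    (h : AdmissiblePGL p d (orderOf ω)) : ∃ X : BasedPolytope.{u} 4, HasParameter X ω := by
  obtain ⟨m, hm⟩ := h.exists_pow_eq_neg_one hF
  exact IsPolytopal.exists_flagModel_of_small.{u, v}
    (isPolytopal_stdGen h.ne_zero h.ne_one h.ne_neg_one hm
      (closure_stdGen_eq_top h.ne_zero h.ne_one h.ne_neg_one (h.closure_eq_top hF)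
        (h.isSquare_or hF))) _

theorem HasParameter.isChiralPGLWithFixedPoints (hX : HasParameter X ω)
    (hF : Fintype.card F = p ^ d) (h : AdmissiblePGL p d (orderOf ω)) :
    X.IsChiralPGLWithFixedPoints F := by
  have hω := h.ne_zero
  obtain ⟨hch, f, hf⟩ := FlagModel.exists_groupModel hX (stdGen_zero ω) (by
    rintro ⟨θ, hθ⟩
    obtain ⟨e, he, he'⟩ := exists_eq_pow_of_aeval hF (h.closure_eq_top hF) (ω' := ω⁻¹)
      fun g hg => aeval_inv_eq_zero_of_hom_stdGen hω h.ne_one hθ hg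
    exact h.inv_ne_pow he he')
  have hD0 : pglDiag ω • finPt (0 : F) = finPt 0 := by
    rw [pgl_smul_finPt_iff (by simpa)]; ring
  have hDi : pglDiag ω • infPt F = infPt F := by
    rw [pgl_smul_infPt_iff (by simpa)]
  refine ⟨hch, f, ⟨finPt 0, ?_⟩, ⟨infPt F, ?_⟩⟩
  · refine (hf.map_mem_parabolic (i := 0) (j := 1) (k := 2) rfl rfl
      (H := MulAction.stabilizer _ (finPt (0 : F)))).2 ⟨?_, ?_⟩
    · rw [stdGen_zero, inv_one, mul_one, stdGen_one]
      change _ • _ = _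
      rw [pgl_smul_finPt_iff (det_stdGen_one hω)]
      ring
    · rw [stdGen_two_mul_inv hω]
      exact hD0
  · refine (hf.map_mem_parabolic (i := 1) (j := 2) (k := 3) rfl rfl
      (H := MulAction.stabilizer _ (infPt F))).2 ⟨?_, ?_⟩
    · rw [stdGen_two_mul_inv hω]
      exact hDi
    · rw [stdGen_three_mul_inv hω]
      change _ • _ = _
      rw [pgl_smul_infPt_iff (by simpa)]

/-- Two parameters give isomorphic based polytopes if and only if they are conjugate under a power
of the Frobenius automorphism. -/
theorem HasParameter.equiv_iff (hX : HasParameter X ω) (hY : HasParameter Y ω')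
    (hF : Fintype.card F = p ^ d) (hω : ω ≠ 0) (hω' : ω' ≠ 0) :
    X ≈ Y ↔ ∃ e < d, ω' = ω ^ p ^ e := by
  constructor
  · intro h
    have hgen : Subring.closure {ω} = ⊤ :=
      closure_singleton_eq_top hF fun e h1 he => hX.pow_ne hω hF h1 he
    obtain ⟨θ, hθ⟩ := FlagModel.exists_hom (FlagModel.of_equiv hX h) hY
      (stdGen_zero ω) (stdGen_zero ω')
    exact exists_eq_pow_of_aeval hF hgen
      fun g hg => aeval_eq_zero_of_hom_stdGen hω hω' hY.ne_one hθ hg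
  · rintro ⟨e, -, rfl⟩
    refine FlagModel.equiv (Ω := PGL(Fin 2, F) × Bool)
      (FlagModel.map_groupAdj hX (pglFieldAut (iterateFrobeniusEquiv F p e))) ?_
    have : (fun i => pglFieldAut (iterateFrobeniusEquiv F p e) (stdGen ω i)) =
        stdGen (ω ^ p ^ e) :=
      funext fun i => pglFieldAut_stdGen hω _ i
    rw [this]
    exact hY

end Parameter

/-! ### Counting -/

theorem ncard_range_mul_eq_card {A B : Type*} [Fintype A] [DecidableEq B] (f : A → B) {m : ℕ}
    (h : ∀ a, {a' | f a' = f a}.ncard = m) : (Set.range f).ncard * m = Fintype.card A := by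
  rw [← Finset.card_univ, Finset.card_eq_sum_card_image f Finset.univ,
    Finset.sum_const_nat (m := m)]
  · rw [← Set.ncard_coe_finset, Finset.coe_image, Finset.coe_univ, Set.image_univ]
  · intro b hb
    obtain ⟨a, -, rfl⟩ := Finset.mem_image.1 hb
    rw [← h a, ← Set.ncard_coe_finset]
    congr 1
    ext
    simp

section Count

variable {F : Type v} [Field F] [Fintype F] {p d : ℕ} [Fact p.Prime] [CharP F p]

theorem orderOf_pow_prime_pow (ω : F) (e : ℕ) :
    orderOf (ω ^ p ^ e) = orderOf ω :=
  orderOf_injective (iterateFrobeniusEquiv F p e : F ≃* F).toMonoidHom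
    (iterateFrobeniusEquiv F p e).injective ω

/-- The conjugates of an element that lies in no proper subfield are distinct. -/
theorem AdmissiblePGL.pow_injOn {ω : F} (h : AdmissiblePGL p d (orderOf ω)) :
    Set.InjOn (fun e : ℕ => ω ^ p ^ e) (Finset.range d : Set ℕ) := by
  have key : ∀ a b : ℕ, a < b → b < d → ω ^ p ^ a ≠ ω ^ p ^ b := by
    intro a b hab hb he
    apply h.pow_ne (e := b - a) (by omega) (by omega)
    refine (iterateFrobeniusEquiv F p a).injective ?_
    change (ω ^ p ^ (b - a)) ^ p ^ a = ω ^ p ^ a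
    rw [he, ← pow_mul, ← pow_add, Nat.sub_add_cancel hab.le]
  intro a ha b hb he
  rw [Finset.coe_range, Set.mem_Iio] at ha hb
  rcases lt_trichotomy a b with hab | hab | hab
  · exact absurd he (key a b hab hb)
  · exact hab
  · exact absurd he.symm (key b a hab ha)

omit [Fact p.Prime] [CharP F p] in
theorem card_orderOf_eq (hF : Fintype.card F = p ^ d) {k : ℕ} (hk : AdmissiblePGL p d k) :
    Nat.card {ω : F // orderOf ω = k} = k.totient := by
  classical
  have hk0 : k ≠ 0 := by
    have := hk.1
    omega
  have e : {ω : F // orderOf ω = k} ≃ {u : Fˣ // orderOf u = k} :=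
    { toFun := fun ω => ⟨Units.mk0 ω.1 (by
          rintro h0
          have := ω.2
          rw [h0, orderOf_zero] at this
          exact hk0 this.symm), by rw [← orderOf_units]; exact ω.2⟩
      invFun := fun u => ⟨u.1, by rw [orderOf_units]; exact u.2⟩
      left_inv := fun ω => rfl
      right_inv := fun u => Subtype.ext (Units.ext rfl) }
  rw [Nat.card_congr e, Nat.card_eq_fintype_card, Fintype.card_subtype]
  refine IsCyclic.card_orderOf_eq_totient ?_
  rw [Fintype.card_units, hF]
  exact hk.2.1

/-- The classes are parametrized by the elements of order `k` up to the action of the Galois group,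
which is free on these elements. -/
theorem countForms_mul_eq_totient (hF : Fintype.card F = p ^ d) (hq : 4 < p ^ d) {c : ℕ → ℕ}
    (hc : ∀ ω : F, AdmissiblePGL p d (orderOf ω) → orderOf (-ω⁻¹) = c (orderOf ω))
    {k : ℕ} (hk : AdmissiblePGL p d k) :
    BasedPolytope.countForms.{u} (fun X =>
      X.IsChiralPGLWithFixedPoints F ∧ X.HasType ![c k, k, c k]) * d = k.totient := by
  classical
  have hex : ∀ ω : {ω : F // orderOf ω = k}, ∃ X : BasedPolytope.{u} 4, HasParameter X ω.1 :=
    fun ω => exists_hasParameter_of_admissible hF (by rwa [ω.2])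
  choose X hX using hex
  have hadm : ∀ ω : {ω : F // orderOf ω = k}, AdmissiblePGL p d (orderOf ω.1) :=
    fun ω => by rwa [ω.2]
  rw [← card_orderOf_eq hF hk, Nat.card_eq_fintype_card,
    ← ncard_range_mul_eq_card
      (fun ω => (Quotient.mk (BasedPolytope.isoSetoid.{u} 4) (X ω))) (m := d)]
  · congr 1
    unfold BasedPolytope.countForms
    congr 1
    ext q
    constructor
    · rintro ⟨Y, ⟨hY, hYt⟩, rfl⟩
      obtain ⟨ω, hω, hYω⟩ := exists_hasParameter hY
      have h1 := hYω.admissible hY.1 hω hF hq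
      have h2 : orderOf ω = k :=
        congrFun ((hYω.hasType hω hYω.ne_neg_one).unique hYt) 1
      exact ⟨⟨ω, h2⟩, Quotient.sound (FlagModel.equiv (hX ⟨ω, h2⟩) hYω)⟩
    · rintro ⟨ω, rfl⟩
      refine ⟨X ω, ⟨(hX ω).isChiralPGLWithFixedPoints hF (hadm ω), ?_⟩, rfl⟩
      have h1 := (hX ω).hasType (hadm ω).ne_zero (hadm ω).ne_neg_one
      rwa [hc _ (hadm ω), ω.2] at h1
  · intro ω
    have h1 : Subtype.val '' {ω' | Quotient.mk (BasedPolytope.isoSetoid.{u} 4) (X ω') =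
        Quotient.mk (BasedPolytope.isoSetoid.{u} 4) (X ω)} =
        (fun e : ℕ => ω.1 ^ p ^ e) '' (Finset.range d : Set ℕ) := by
      ext x
      constructor
      · rintro ⟨ω', h, rfl⟩
        obtain ⟨e, he, h'⟩ := ((hX ω).equiv_iff (hX ω') hF (hadm ω).ne_zero (hadm ω').ne_zero).1
          (Quotient.exact (Eq.symm h))
        exact ⟨e, by simpa using he, h'.symm⟩
      · rintro ⟨e, he, rfl⟩
        have he' : e < d := by simpa using he
        have h2 : orderOf (ω.1 ^ p ^ e) = k := by rw [orderOf_pow_prime_pow, ω.2]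
        refine ⟨⟨_, h2⟩, Eq.symm (Quotient.sound ?_), rfl⟩
        exact ((hX ω).equiv_iff (hX ⟨_, h2⟩) hF (hadm ω).ne_zero (hadm ⟨_, h2⟩).ne_zero).2
          ⟨e, he', rfl⟩
    rw [← Set.ncard_image_of_injective _ Subtype.val_injective, h1,
      (hadm ω).pow_injOn.ncard_image, Set.ncard_coe_finset, Finset.card_range]

/-- The classification, where `c k` is the order of `-ω⁻¹` for elements `ω` of admissible
order `k`. -/
theorem exists_hasType_and_countForms_eq (hF : Fintype.card F = p ^ d) (hq : 4 < p ^ d)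
    {c : ℕ → ℕ}
    (hc : ∀ ω : F, AdmissiblePGL p d (orderOf ω) → orderOf (-ω⁻¹) = c (orderOf ω)) :
    (∀ X : BasedPolytope.{u} 4, X.IsChiralPGLWithFixedPoints F →
      ∃ k, AdmissiblePGL p d k ∧ X.HasType ![c k, k, c k]) ∧
    ∀ k, AdmissiblePGL p d k →
      (BasedPolytope.countForms.{u} (fun X =>
        X.IsChiralPGLWithFixedPoints F ∧ X.HasType ![c k, k, c k]) : ℚ) = (k.totient : ℚ) / d := by
  refine ⟨fun X hX => ?_, fun k hk => ?_⟩
  · obtain ⟨ω, hω, h⟩ := exists_hasParameter hX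
    have h1 := h.admissible hX.1 hω hF hq
    refine ⟨orderOf ω, h1, ?_⟩
    rw [← hc ω h1]
    exact h.hasType hω h.ne_neg_one
  · have hd : (d : ℚ) ≠ 0 := by
      rw [Nat.cast_ne_zero]
      rintro rfl
      simp at hq
    rw [eq_div_iff hd, ← countForms_mul_eq_totient hF hq hc hk, Nat.cast_mul]

end Count

theorem mainTheorem2 (p d : ℕ) (hp : p.Prime) (hq : 4 < p ^ d)
    (F : Type v) [Field F] [Fintype F] (hF : Fintype.card F = p ^ d) :
    (p ^ d % 4 ≠ 3 →
      (∀ X : BasedPolytope.{u} 4, X.IsChiralPGLWithFixedPoints F →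
        ∃ k, AdmissiblePGL p d k ∧ X.HasType ![k, k, k]) ∧
      ∀ k, AdmissiblePGL p d k →
        (BasedPolytope.countForms.{u} (fun X =>
          X.IsChiralPGLWithFixedPoints F ∧ X.HasType ![k, k, k]) : ℚ) = (k.totient : ℚ) / d) ∧
    (p ^ d % 4 = 3 →
      (∀ X : BasedPolytope.{u} 4, X.IsChiralPGLWithFixedPoints F →
        ∃ k, AdmissiblePGL p d k ∧ X.HasType ![k / 2, k, k / 2]) ∧
      ∀ k, AdmissiblePGL p d k →
        (BasedPolytope.countForms.{u} (fun X =>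
          X.IsChiralPGLWithFixedPoints F ∧ X.HasType ![k / 2, k, k / 2]) : ℚ)
            = (k.totient : ℚ) / d) := by
  have : Fact p.Prime := ⟨hp⟩
  have : CharP F p := charP_of_card_eq_prime_pow hF
  exact ⟨fun h4 => exists_hasType_and_countForms_eq hF hq (c := fun k => k)
      fun ω h => h.orderOf_neg_inv hF h4,
    fun h4 => exists_hasType_and_countForms_eq hF hq (c := fun k => k / 2)
      fun ω h => h.orderOf_neg_inv_of_mod hF h4⟩
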